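/- Let $\mathbb{T}=\mathbb{R}/2\pi\mathbb{Z}$ and let $\Gamma\in\mathbb{R}$. For $s\in\mathbb{R}$ let $X^s$ be the space of real-valued (generalized) functions $U(\zeta,\phi)=\sum_{p\text{ odd}}U_p(\zeta)e^{ip\phi}$ on $\mathbb{R}\times\mathbb{T}$ (so $U_{-p}=\bar U_p$ and all even modes vanish) with finite norm $$\|U\|_{X^s}=\Big(\sum_{p\text{ odd}}\int_{\mathbb{R}}(p^2+\xi^2)^s|\hat U_p(\xi)|^2\,d\xi\Big)^{1/2},$$ where $\hat U_p$ is the Fourier transform of $U_p$. For $s>1$ elements of $X^s$ are identified with their continuous representatives. Call $U$ reversible if $U_p(\zeta)=\bar U_p(-\zeta)$ for all odd $p$. Fix $s>1$. Let $U\in X^s$ be a reversible solution of the extended nonlinear Schrödinger system (xNLS) $$U_p''-p^2U_p+\tfrac{2p^2}{3}\Gamma\Big(3U_p\sum_{q\text{ odd}}|U_q|^2+\sum_{q,r\text{ odd}}U_qU_rU_{p-q-r}\Big)=0,\qquad p\text{ odd},$$ equivalently of $(\partial_\zeta^2+\partial_\phi^2)U=\frac23\Gamma\,\partial_\phi^2\big[U^3+3\big(\frac1{2\pi}\int_{-\pi}^{\pi}|U(\zeta,\theta)|^2d\theta\big)U\big]$.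 Assume that the linearization of this system at $U$ is invertible, with bounded inverse, from the reversible subspace of $X^s$ onto the reversible subspace of $X^{s-2}$. Then there are $\mu_0>0$ and $C>0$ such that for every $\mu\in(-\mu_0,\mu_0)$ the stationary extended coupled mode system (xNLCME) with $\Omega=\sqrt{1-\mu^2}$, $$iA_p'+p\,\Omega A_p+pB_p+\tfrac{p\Gamma}{3}\Big(3A_p\sum_{q\text{ odd}}|B_q|^2+\sum_{q,r\text{ odd}}A_qA_rA_{p-q-r}\Big)=0,$$ $$-iB_p'+p\,\Omega B_p+pA_p+\tfrac{p\Gamma}{3}\Big(3B_p\sum_{q\text{ odd}}|A_q|^2+\sum_{q,r\text{ odd}}B_qB_rB_{p-q-r}\Big)=0,\qquad p\text{ odd},$$ has a unique solution $(A,B)$ with $A,B\in X^s$ that is reversible, $A_p(Z)=\bar A_p(-Z)$ and $B_p(Z)=\bar B_p(-Z)$, and satisfies $$\|A-\mu U(\mu\,\cdot,\cdot)\|+\|B+\mu U(\mu\,\cdot,\cdot)\|\le C\mu^2,$$ where the norms are $X^s$ norms in the slow variable $\zeta=\mu Z$; that is, $A(Z,\phi)=a(\mu Z,\phi)$ and $B(Z,\phi)=b(\mu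 Z,\phi)$ for some $a,b\in X^s$ with $\|a-\mu U\|_{X^s}+\|b+\mu U\|_{X^s}\le C\mu^2$. -/

import Mathlib

open MeasureTheory
open scoped SchwartzMap FourierTransform ENNReal ComplexConjugate

namespace GapSoliton

/-- The odd integers, indexing the Fourier modes in the periodic variable. -/
abbrev OddInt : Type := {p : ℤ // Odd p}

/-- The tempered distribution `T` is integration against the function `f`. -/
def Represents (T : 𝓢'(ℝ, ℂ)) (f : ℝ → ℂ) : Prop :=
  ∀ ψ : 𝓢(ℝ, ℂ), Integrable (fun x => ψ x * f x) ∧ T ψ = ∫ x, ψ x * f x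

/-! ### The spaces `X^s`

A (generalized) function `U(ζ, φ) = ∑ U_p(ζ) e^{ipφ}` on `ℝ × 𝕋` is handled through the family
`(U_p)` of its Fourier coefficients in `φ`. For general real `s` these are tempered distributions
on `ℝ`. For `s > 1` (where `H^s(ℝ × 𝕋)` consists of continuous functions) they are continuous
functions. -/

/-- The `X^s` norm `(∑_{p odd} ∫ (p² + ξ²)^s |Û_p(ξ)|² dξ)^{1/2}`, with values in `[0, ∞]`.
`Û_p` is the unitary Fourier transform with dual variable `ξ = 2πη`, where `η` is the variable of
Mathlib's Fourier transform. The infimum runs over all densities `g_p` of the Fourier transforms,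
which are unique up to null sets; the norm is `∞` if there are none. -/
noncomputable def xDistNorm (s : ℝ) (T : ℤ → 𝓢'(ℝ, ℂ)) : ℝ≥0∞ :=
  ⨅ (g : ℤ → ℝ → ℂ) (_ : ∀ p : ℤ, Odd p → Represents (𝓕 (T p)) (g p)),
    (∑' p : OddInt, ∫⁻ η : ℝ,
      ENNReal.ofReal ((((p : ℤ) : ℝ) ^ 2 + (2 * Real.pi * η) ^ 2) ^ s) * ‖g p η‖ₑ ^ 2) ^ (1 / 2 : ℝ)

/-- Membership in `X^s`, for every real `s`: finite norm, real-valuedness `U_{-p} = conj U_p`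
(for distributions, `U_{-p}(conj ψ) = conj (U_p(ψ))`), and vanishing even modes. -/
structure MemXDist (s : ℝ) (T : ℤ → 𝓢'(ℝ, ℂ)) : Prop where
  norm_lt_top : xDistNorm s T < ⊤
  real : ∀ (p : ℤ) (ψ χ : 𝓢(ℝ, ℂ)), (∀ x, χ x = conj (ψ x)) → T (-p) χ = conj (T p ψ)
  even_eq_zero : ∀ p : ℤ, Even p → T p = 0

/-- The `X^s` norm of a family of mode functions. The representing distributions are unique;
the norm is `∞` if the functions do not define tempered distributions. -/
noncomputable def xNorm (s : ℝ) (u : ℤ → ℝ → ℂ) : ℝ≥0∞ :=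
  ⨅ (T : ℤ → 𝓢'(ℝ, ℂ)) (_ : ∀ p, Represents (T p) (u p)), xDistNorm s T

/-- Membership of a family of mode functions in `X^s`, for `s > 1`. Asking for continuity selects
the continuous representative of each class. -/
structure MemX (s : ℝ) (u : ℤ → ℝ → ℂ) : Prop where
  continuous : ∀ p, Continuous (u p)
  norm_lt_top : xNorm s u < ⊤
  real : ∀ p x, u (-p) x = conj (u p x)
  even_eq_zero : ∀ p : ℤ, Even p → ∀ x, u p x = 0

/-- The reversibility symmetry `U_p(ζ) = conj U_p(-ζ)`. -/
def IsReversible (u : ℤ → ℝ → ℂ) : Prop :=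
  ∀ p : ℤ, Odd p → ∀ x, u p x = conj (u p (-x))

/-- The reversibility symmetry `U_p(ζ) = conj U_p(-ζ)` for distributions. -/
def IsReversibleDist (T : ℤ → 𝓢'(ℝ, ℂ)) : Prop :=
  ∀ p : ℤ, Odd p → ∀ ψ χ : 𝓢(ℝ, ℂ), (∀ x, χ x = conj (ψ (-x))) → T p χ = conj (T p ψ)

/-! ### The two stationary systems -/

/-- `3 A_p ∑_q |B_q|² + ∑_{q,r} A_q A_r A_{p-q-r}`, with sums over odd `q`, `r`. -/
noncomputable def cubic (A B : ℤ → ℝ → ℂ) (p : ℤ) (x : ℝ) : ℂ :=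
  3 * A p x * (∑' q : OddInt, (‖B q x‖ ^ 2 : ℝ) : ℝ)
    + ∑' qr : OddInt × OddInt, A qr.1 x * A qr.2 x * A (p - qr.1 - qr.2) x

/-- The stationary extended coupled mode system with `N_{2p} = 1` and frequency `Ω`:
`i A_p' + p Ω A_p + p B_p + p (Γ/3) (3 A_p ∑ |B_q|² + ∑∑ A_q A_r A_{p-q-r}) = 0` and
`-i B_p' + p Ω B_p + p A_p + p (Γ/3) (3 B_p ∑ |A_q|² + ∑∑ B_q B_r B_{p-q-r}) = 0`, `p` odd. -/
structure IsCoupledModeSolution (Γ Ω : ℝ) (A B : ℤ → ℝ → ℂ) : Prop where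
  differentiable_left : ∀ p : ℤ, Odd p → Differentiable ℝ (A p)
  differentiable_right : ∀ p : ℤ, Odd p → Differentiable ℝ (B p)
  left : ∀ p : ℤ, Odd p → ∀ Z : ℝ,
    Complex.I * deriv (A p) Z + p * Ω * A p Z + p * B p Z + p * (Γ / 3) * cubic A B p Z = 0
  right : ∀ p : ℤ, Odd p → ∀ Z : ℝ,
    -Complex.I * deriv (B p) Z + p * Ω * B p Z + p * A p Z + p * (Γ / 3) * cubic B A p Z = 0

/-- The extended nonlinear Schrödinger system
`U_p'' - p² U_p + (2p²/3) Γ (3 U_p ∑ |U_q|² + ∑∑ U_q U_r U_{p-q-r}) = 0`, `p` odd. -/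
structure IsNLSSolution (Γ : ℝ) (U : ℤ → ℝ → ℂ) : Prop where
  contDiff : ∀ p : ℤ, Odd p → ContDiff ℝ 2 (U p)
  eqn : ∀ p : ℤ, Odd p → ∀ ζ : ℝ,
    iteratedDeriv 2 (U p) ζ - (p : ℂ) ^ 2 * U p ζ
      + 2 * (p : ℂ) ^ 2 / 3 * Γ * cubic U U p ζ = 0

/-! ### The linearized operator -/

/-- The derivative of `U ↦ 3 U_p ∑ |U_q|² + ∑∑ U_q U_r U_{p-q-r}` at `U` in the direction `W`. -/
noncomputable def cubicDeriv (U W : ℤ → ℝ → ℂ) (p : ℤ) (x : ℝ) : ℂ :=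
  3 * W p x * (∑' q : OddInt, (‖U q x‖ ^ 2 : ℝ) : ℝ)
    + 3 * U p x * (∑' q : OddInt, 2 * (conj (U q x) * W q x).re : ℝ)
    + 3 * ∑' qr : OddInt × OddInt, U qr.1 x * U qr.2 x * W (p - qr.1 - qr.2) x

/-- `T = L_U W`, where `L_U` is the linearization at `U` of the extended nonlinear Schrödinger
system, `(L_U W)_p = W_p'' - p² W_p + (2p²/3) Γ (cubicDeriv U W)_p`, in the sense of tempered
distributions. -/
def IsLinearizedImage (Γ : ℝ) (U W : ℤ → ℝ → ℂ) (T : ℤ → 𝓢'(ℝ, ℂ)) : Prop :=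
  ∀ p : ℤ, Odd p → ∀ ψ : 𝓢(ℝ, ℂ),
    T p ψ = ∫ ζ : ℝ, (W p ζ * (iteratedDeriv 2 (fun x => ψ x) ζ - (p : ℂ) ^ 2 * ψ ζ)
      + 2 * (p : ℂ) ^ 2 / 3 * Γ * cubicDeriv U W p ζ * ψ ζ)

/-- `L_U`, from the reversible subspace of `X^s` to that of `X^{s-2}`, is bijective and its inverse
is bounded. -/
structure LinearizationInvertible (s Γ : ℝ) (U : ℤ → ℝ → ℂ) : Prop where
  bijective : ∀ T : ℤ → 𝓢'(ℝ, ℂ), MemXDist (s - 2) T → IsReversibleDist T →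
    ∃! W : ℤ → ℝ → ℂ, MemX s W ∧ IsReversible W ∧ IsLinearizedImage Γ U W T
  bounded : ∃ K : ℝ, ∀ (W : ℤ → ℝ → ℂ) (T : ℤ → 𝓢'(ℝ, ℂ)),
    MemX s W → IsReversible W → MemXDist (s - 2) T → IsReversibleDist T →
    IsLinearizedImage Γ U W T → xNorm s W ≤ ENNReal.ofReal K * xDistNorm (s - 2) T

/-- `‖A - μ U(μ·,·)‖ + ‖B + μ U(μ·,·)‖ ≤ δ`, where the `X^s` norms are taken in the slow variable
`ζ = μ Z`: `A(Z, φ) = a(μ Z, φ)` and `B(Z, φ) = b(μ Z, φ)` with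
`‖a - μ U‖ + ‖b + μ U‖ ≤ δ` in `X^s`. -/
def SlowClose (s μ : ℝ) (U A B : ℤ → ℝ → ℂ) (δ : ℝ) : Prop :=
  ∃ a b : ℤ → ℝ → ℂ, MemX s a ∧ MemX s b ∧
    (∀ p Z, A p Z = a p (μ * Z)) ∧ (∀ p Z, B p Z = b p (μ * Z)) ∧
    xNorm s (fun p ζ => a p ζ - μ * U p ζ) + xNorm s (fun p ζ => b p ζ + μ * U p ζ)
      ≤ ENNReal.ofReal δ

end GapSoliton

/-! In the slow variable, with `a`, `b` the Fourier densities of the profiles of `A`, `B` at `(p,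
ξ)` and `n₁`, `n₂` those of the two cubic terms, the coupled mode system is the linear algebra
problem `(pΩ - μξ) a + p b = -p(Γ/3) n₁`, `p a + (pΩ + μξ) b = -p(Γ/3) n₂`. Since `Ω² = 1 - μ²`, its
determinant is exactly `-μ²(p² + ξ²)`. Solving it (`mode_algebra`) gives `μ² a`, `μ² b` as
combinations of `n₁`, `n₂` whose only multipliers are `p²/(p² + ξ²)` and `pξ/(p² + ξ²)`, both
bounded by 1, so no derivative is lost.

Put `a = μ(u + v)`, `b = μ(v - u)`. The nonlinearity is homogeneous of degree three, so a factor
`μ³` cancels on both sides and `(u, v) = branchMap μ (u, v)` remains, a fixed point equation that is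
regular at `μ = 0` (`cub_system_iff_branchMap`). There `Ω = 1`, the second equation reads `v = 0`,
and the first is xNLS multiplied by the inverse of `p² - ∂²` (`nls_fixed_point`). The linearization
in `u` is the linearized xNLS operator composed with `-(p² - ∂²)⁻¹`, hence bijective by assumption
(`linearization_bijective`). The implicit function theorem (`exists_branch`) then produces the
branch, with an `O(μ)` error in `(u, v)`, that is `O(μ²)` in `(a, b)`. Conversely, a solution within
`Cμ²` of the ansatz has `(u, v)` within `O(μ)` of `(w, 0)`, where `w` stands for `U`, and so lies in
the uniqueness neighbourhood for small `μ`.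

The function space is treated on the Fourier side. Reversibility makes the densities real, and
reality of the function then makes them even in `(p, ξ)`. Reversible elements of `X^s` thus form a
closed real subspace `XSpace` of a weighted `L²` space on `ℤ × ℝ`. For `s > 1` the inverse weight is
integrable, so densities are in `L¹` and triple convolutions are bounded (`wmass_conv3_le`); the
cubic maps are therefore continuous trilinear (`exists_triOp`). The theorems `phys_tri`,
`exists_rep_of_memX` and `coupledMode_iff_density` translate between densities and the pointwise
statements. -/

namespace GapSoliton

/-! ### An abstract branch of solutions -/

section Branch

variable {E : Type*} [NormedAddCommGroup E] [NormedSpace ℝ E]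

/-- The cubic map `3 T₁(b, b, a) + T₂(a, a, a)`. -/
noncomputable def cub (T₁ T₂ : E →L[ℝ] E →L[ℝ] E →L[ℝ] E) (a b : E) : E :=
  (3 : ℝ) • T₁ b b a + T₂ a a a

/-- The derivative of `a ↦ cub T₁ T₂ a a` at `a` in the direction `h`. -/
noncomputable def cubD (T₁ T₂ : E →L[ℝ] E →L[ℝ] E →L[ℝ] E) (a h : E) : E :=
  (3 : ℝ) • (T₁ a a h + T₁ a h a + T₁ h a a) + (T₂ a a h + T₂ a h a + T₂ h a a)

lemma cub_smul (T₁ T₂ : E →L[ℝ] E →L[ℝ] E →L[ℝ] E) (c : ℝ) (a b : E) :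
    cub T₁ T₂ (c • a) (c • b) = c ^ 3 • cub T₁ T₂ a b := by
  simp only [cub, map_smul, smul_apply, smul_add, smul_smul]
  congr 2 <;> ring_nf

/-- The right-hand sides of the system in the variables `u = (α - β) / 2μ`, `v = (α + β) / 2μ`. -/
noncomputable def branchMap (P₁ P₂ Q₁ Q₂ : E →L[ℝ] E →L[ℝ] E →L[ℝ] E) (Γ μ : ℝ) (x : E × E) :
    E × E :=
  ((Γ / 6) • ((Real.sqrt (1 - μ ^ 2) + 1) •
      (cub P₁ P₂ (x.1 + x.2) (x.2 - x.1) - cub P₁ P₂ (x.2 - x.1) (x.1 + x.2))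
      + μ • (cub Q₁ Q₂ (x.1 + x.2) (x.2 - x.1) + cub Q₁ Q₂ (x.2 - x.1) (x.1 + x.2))),
    (Γ / 6) • ((Real.sqrt (1 - μ ^ 2) - 1) •
      (cub P₁ P₂ (x.1 + x.2) (x.2 - x.1) + cub P₁ P₂ (x.2 - x.1) (x.1 + x.2))
      + μ • (cub Q₁ Q₂ (x.1 + x.2) (x.2 - x.1) - cub Q₁ Q₂ (x.2 - x.1) (x.1 + x.2))))

lemma hasFDerivAt_trilinear {F : Type*} [NormedAddCommGroup F] [NormedSpace ℝ F]
    (T : E →L[ℝ] E →L[ℝ] E →L[ℝ] E) {a b c : F → E}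
    {a' b' c' : F →L[ℝ] E} {x : F} (ha : HasFDerivAt a a' x) (hb : HasFDerivAt b b' x)
    (hc : HasFDerivAt c c' x) :
    HasFDerivAt (fun y => T (a y) (b y) (c y))
      ((T (a x) (b x)).comp c' + ((T (a x)).flip (c x)).comp b'
        + ((T.flip (b x)).flip (c x)).comp a') x := by
  have h0 : HasFDerivAt (fun y => T (a y)) (T.comp a') x := by
    have hT : HasFDerivAt (fun z => T z) T (a x) := T.hasFDerivAt
    exact HasFDerivAt.comp (g := fun z => T z) (g' := T) x hT ha
  have h1 := h0.clm_apply hb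
  refine (h1.clm_apply hc).congr_fderiv ?_
  ext y
  simp [add_assoc]

lemma hasFDerivAt_cub {F : Type*} [NormedAddCommGroup F] [NormedSpace ℝ F]
    (T₁ T₂ : E →L[ℝ] E →L[ℝ] E →L[ℝ] E) {a b : F → E} {a' b' : F →L[ℝ] E} {x : F}
    (ha : HasFDerivAt a a' x) (hb : HasFDerivAt b b' x) :
    ∃ D : F →L[ℝ] E, HasFDerivAt (fun y => cub T₁ T₂ (a y) (b y)) D x ∧ ∀ h, D h =
      (3 : ℝ) • (T₁ (b x) (b x) (a' h) + T₁ (b x) (b' h) (a x) + T₁ (b' h) (b x) (a x))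
        + (T₂ (a x) (a x) (a' h) + T₂ (a x) (a' h) (a x) + T₂ (a' h) (a x) (a x)) :=
  ⟨_, ((hasFDerivAt_trilinear T₁ hb hb ha).const_smul (3 : ℝ)).add
    (hasFDerivAt_trilinear T₂ ha ha ha), fun h => by simp⟩

lemma contDiff_cub {F : Type*} [NormedAddCommGroup F] [NormedSpace ℝ F]
    (T₁ T₂ : E →L[ℝ] E →L[ℝ] E →L[ℝ] E) {a b : F → E} (ha : ContDiff ℝ 1 a)
    (hb : ContDiff ℝ 1 b) : ContDiff ℝ 1 (fun y => cub T₁ T₂ (a y) (b y)) := by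
  unfold cub
  fun_prop

lemma contDiffAt_branchMap (P₁ P₂ Q₁ Q₂ : E →L[ℝ] E →L[ℝ] E →L[ℝ] E) (Γ : ℝ) (x : E × E) :
    ContDiffAt ℝ 1 (fun y : ℝ × (E × E) => branchMap P₁ P₂ Q₁ Q₂ Γ y.1 y.2) (0, x) := by
  have hs : ContDiffAt ℝ 1 (fun y : ℝ × (E × E) => Real.sqrt (1 - y.1 ^ 2)) (0, x) := by
    refine ContDiffAt.sqrt ?_ (by simp)
    fun_prop
  have e1 : ContDiff ℝ 1 (fun y : ℝ × (E × E) => y.2.1 + y.2.2) := by fun_prop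
  have e2 : ContDiff ℝ 1 (fun y : ℝ × (E × E) => y.2.2 - y.2.1) := by fun_prop
  have c1 := (contDiff_cub P₁ P₂ e1 e2).contDiffAt (x := (0, x))
  have c2 := (contDiff_cub P₁ P₂ e2 e1).contDiffAt (x := (0, x))
  have c3 := (contDiff_cub Q₁ Q₂ e1 e2).contDiffAt (x := (0, x))
  have c4 := (contDiff_cub Q₁ Q₂ e2 e1).contDiffAt (x := (0, x))
  have hm : ContDiffAt ℝ 1 (fun y : ℝ × (E × E) => y.1) (0, x) := by fun_prop
  have k1 := (((hs.add (contDiffAt_const (c := (1 : ℝ)))).smul (c1.sub c2)).add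
    (hm.smul (c3.add c4))).const_smul (Γ / 6)
  have k2 := (((hs.sub (contDiffAt_const (c := (1 : ℝ)))).smul (c1.add c2)).add
    (hm.smul (c3.sub c4))).const_smul (Γ / 6)
  exact k1.prodMk k2

lemma cub_neg_right (T₁ T₂ : E →L[ℝ] E →L[ℝ] E →L[ℝ] E) (a : E) :
    cub T₁ T₂ a (-a) = cub T₁ T₂ a a := by
  simp [cub]

lemma cub_neg_left (T₁ T₂ : E →L[ℝ] E →L[ℝ] E →L[ℝ] E) (a : E) :
    cub T₁ T₂ (-a) a = -cub T₁ T₂ a a := by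
  simp [cub]; abel

/-- The implicit function theorem for `x - branchMap μ x` at `μ = 0`, `x = (w, 0)`. The constant `C`
is fixed before `C₁` because the uniqueness radius will later be chosen as a multiple of `C`. -/
theorem exists_branch [CompleteSpace E] (P₁ P₂ Q₁ Q₂ : E →L[ℝ] E →L[ℝ] E →L[ℝ] E) (Γ : ℝ)
    (w : E) (hw : w = (2 * Γ / 3) • cub P₁ P₂ w w)
    (hbij : Function.Bijective (fun h : E => h - (2 * Γ / 3) • cubD P₁ P₂ w h)) :
    ∃ C : ℝ, 0 < C ∧ ∀ C₁ : ℝ, ∃ μ₀ : ℝ, 0 < μ₀ ∧ ∀ μ : ℝ, |μ| < μ₀ →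
      ∃ x : E × E, x = branchMap P₁ P₂ Q₁ Q₂ Γ μ x ∧ ‖x - (w, 0)‖ ≤ C * |μ| ∧
        ∀ y : E × E, y = branchMap P₁ P₂ Q₁ Q₂ Γ μ y → ‖y - (w, 0)‖ ≤ C₁ * |μ| → y = x := by
  set f : ℝ × (E × E) → E × E := fun y => y.2 - branchMap P₁ P₂ Q₁ Q₂ Γ y.1 y.2 with hf
  set p : ℝ × (E × E) := (0, (w, 0)) with hp
  have hfd : ContDiffAt ℝ 1 f p := contDiffAt_snd.sub (contDiffAt_branchMap P₁ P₂ Q₁ Q₂ Γ _)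
  have hfp : f p = 0 := by
    have : branchMap P₁ P₂ Q₁ Q₂ Γ 0 (w, 0) = (w, 0) := by
      simp only [branchMap, add_zero, zero_sub, cub_neg_right, cub_neg_left]
      ext
      · simp only [ne_eq, OfNat.ofNat_ne_zero, not_false_eq_true, zero_pow, sub_zero,
          Real.sqrt_one, sub_neg_eq_add, zero_smul, add_zero]
        conv_rhs => rw [hw]
        module
      · simp
    simp [hf, hp, this]
  -- the partial derivative
  have hinv : (fderiv ℝ f p ∘L .inr ℝ ℝ (E × E)).IsInvertible := by
    have e1 : HasFDerivAt (fun x : E × E => x.1 + x.2)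
        (ContinuousLinearMap.fst ℝ E E + ContinuousLinearMap.snd ℝ E E) (w, 0) :=
      (hasFDerivAt_fst).add hasFDerivAt_snd
    have e2 : HasFDerivAt (fun x : E × E => x.2 - x.1)
        (ContinuousLinearMap.snd ℝ E E - ContinuousLinearMap.fst ℝ E E) (w, 0) :=
      (hasFDerivAt_snd).sub hasFDerivAt_fst
    obtain ⟨D₁, hD₁, hD₁'⟩ := hasFDerivAt_cub P₁ P₂ e1 e2
    obtain ⟨D₂, hD₂, hD₂'⟩ := hasFDerivAt_cub P₁ P₂ e2 e1
    have hder : HasFDerivAt (fun x : E × E => f (0, x))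
        ((ContinuousLinearMap.fst ℝ E E - (Γ / 6 * 2) • (D₁ - D₂)).prod
          (ContinuousLinearMap.snd ℝ E E)) (w, 0) := by
      have h := ((hasFDerivAt_fst (𝕜 := ℝ) (p := ((w, 0) : E × E))).sub
        ((hD₁.sub hD₂).const_smul (Γ / 6 * 2))).prodMk
          (hasFDerivAt_snd (𝕜 := ℝ) (p := ((w, 0) : E × E)))
      refine h.congr_of_eventuallyEq (Filter.Eventually.of_forall fun x => ?_)
      ext
      · simp only [hf, branchMap, ne_eq, OfNat.ofNat_ne_zero, not_false_eq_true, zero_pow,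
          sub_zero, Real.sqrt_one, zero_smul, add_zero, Prod.fst_sub, Pi.sub_apply,
          Pi.smul_apply]
        module
      · simp [hf, branchMap]
    have hder2 : HasFDerivAt (fun x : E × E => f (0, x))
        (fderiv ℝ f p ∘L .inr ℝ ℝ (E × E)) (w, 0) := by
      have h1 : HasFDerivAt f (fderiv ℝ f p) p := (hfd.differentiableAt (by simp)).hasFDerivAt
      exact HasFDerivAt.comp (g := f) ((w, 0) : E × E) h1
        (hasFDerivAt_prodMk_right (𝕜 := ℝ) (0 : ℝ) ((w, 0) : E × E))
    -- Changing `v` to `-v` sends `cub (u + v) (v - u)` to minus `cub (v - u) (u + v)`, so the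
    -- difference of the two is even in `v` and contributes no `v`-derivative at `v = 0`. The
    -- partial derivative is therefore block diagonal, with blocks `Λ` and the identity.
    rw [hder2.unique hder]
    let Λ : E →L[ℝ] E := .id ℝ E - (2 * Γ / 3) • ((3 : ℝ) • (P₁ w w + (P₁ w).flip w
      + (P₁.flip w).flip w) + (P₂ w w + (P₂ w).flip w + (P₂.flip w).flip w))
    have hΛ : ∀ h, Λ h = h - (2 * Γ / 3) • cubD P₁ P₂ w h := fun h => by simp [Λ, cubD]
    have hΛb : Function.Bijective Λ := by
      have : (Λ : E → E) = fun h => h - (2 * Γ / 3) • cubD P₁ P₂ w h := funext hΛ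
      rw [this]; exact hbij
    -- The open mapping theorem supplies the continuity of the inverse.
    let Le : E ≃L[ℝ] E := ContinuousLinearEquiv.ofBijective Λ
      (LinearMap.ker_eq_bot.2 hΛb.1) (LinearMap.range_eq_top.2 hΛb.2)
    refine ⟨Le.prodCongr (ContinuousLinearEquiv.refl ℝ E), ?_⟩
    refine ContinuousLinearMap.ext fun h => Prod.ext ?_ ?_
    · have : Le h.1 = Λ h.1 := rfl
      simp only [ContinuousLinearEquiv.coe_coe, ContinuousLinearEquiv.prodCongr_apply, this, hΛ,
        ContinuousLinearMap.prod_apply, sub_apply, smul_apply, hD₁', hD₂', cubD,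
        ContinuousLinearMap.coe_fst', ContinuousLinearMap.coe_snd', add_apply]
      simp only [zero_sub, add_zero, map_add, map_sub, map_neg, add_apply, sub_apply, neg_apply]
      module
    · simp
  set ψ := hfd.implicitFunction one_ne_zero hinv with hψ
  have hψ0 : ψ 0 = (w, 0) := hfd.implicitFunction_apply_self one_ne_zero hinv
  have hψs := hfd.hasStrictFDerivAt_implicitFunction one_ne_zero hinv
  -- Differentiability of the branch at `0` gives the linear bound in `μ`.
  obtain ⟨C, hC, hbound⟩ := (hψs.hasFDerivAt.isBigO_sub).exists_pos
  have hsol := hfd.eventually_apply_implicitFunction one_ne_zero hinv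
  have huniq := hfd.eventually_apply_eq_iff_implicitFunction one_ne_zero hinv
  refine ⟨C, hC, fun C₁ => ?_⟩
  obtain ⟨ε₁, hε₁, h1⟩ := Metric.eventually_nhds_iff.1 hbound.bound
  obtain ⟨ε₂, hε₂, h2⟩ := Metric.eventually_nhds_iff.1 hsol
  obtain ⟨ε₃, hε₃, h3⟩ := Metric.eventually_nhds_iff.1 huniq
  -- The last term forces `C₁ * |μ| < ε₃`, placing every competitor `y` in the uniqueness
  -- neighbourhood.
  refine ⟨min (min ε₁ ε₂) (min ε₃ (ε₃ / (|C₁| + 1))), by positivity, fun μ hμ => ?_⟩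
  simp only [lt_min_iff] at hμ
  obtain ⟨⟨hμ1, hμ2⟩, hμ3, hμ4⟩ := hμ
  refine ⟨ψ μ, ?_, ?_, ?_⟩
  · have := h2 (y := μ) (by simpa [hp] using hμ2)
    rw [hfp] at this
    exact sub_eq_zero.1 this
  · have := h1 (y := μ) (by simpa [hp] using hμ1)
    simpa [hp, ← hψ, hψ0] using this
  · intro y hy hyC
    have hlt : C₁ * |μ| < ε₃ := by
      rw [lt_div_iff₀ (by positivity)] at hμ4
      nlinarith [le_abs_self C₁, abs_nonneg μ]
    have := (h3 (y := (μ, y)) ?_).1 ?_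
    · exact this.symm
    · rw [Prod.dist_eq, max_lt_iff]
      refine ⟨by simpa [hp] using hμ3, ?_⟩
      rw [dist_eq_norm]
      exact hyC.trans_lt hlt
    · rw [hfp]; exact sub_eq_zero.2 hy

end Branch

/-! ### Inverse Fourier transforms of integrable functions on the line -/

lemma schwartz_integrable_mul (ψ : 𝓢(ℝ, ℂ)) {ρ : ℝ → ℂ} (hρ : Integrable ρ) :
    Integrable (fun x => ψ x * ρ x) := by
  obtain ⟨C, hC⟩ := ψ.decay 0 0
  refine hρ.bdd_mul (c := C) ψ.continuous.aestronglyMeasurable (Filter.Eventually.of_forall ?_)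
  intro x
  simpa using hC.2 x

lemma schwartz_integrable_mul_bdd (ψ : 𝓢(ℝ, ℂ)) {f : ℝ → ℂ} (hf : Continuous f) {M : ℝ}
    (hM : ∀ x, ‖f x‖ ≤ M) : Integrable (fun x => ψ x * f x) :=
  ψ.integrable.mul_bdd (c := M) hf.aestronglyMeasurable (Filter.Eventually.of_forall hM)

lemma norm_fourierInv_le (ρ : ℝ → ℂ) (x : ℝ) : ‖𝓕⁻ ρ x‖ ≤ ∫ η, ‖ρ η‖ := by
  rw [Real.fourierInv_eq]
  refine (norm_integral_le_integral_norm _).trans (le_of_eq ?_)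
  simp

lemma continuous_fourierInv {ρ : ℝ → ℂ} (hρ : Integrable ρ) : Continuous (𝓕⁻ ρ) := by
  rw [Real.fourierInv_eq_fourier_comp_neg]
  exact VectorFourier.fourierIntegral_continuous Real.continuous_fourierChar
    (by fun_prop) hρ.comp_neg

lemma tendsto_fourierInv_cocompact (ρ : ℝ → ℂ) :
    Filter.Tendsto (𝓕⁻ ρ) (Filter.cocompact ℝ) (nhds 0) := by
  rw [Real.fourierInv_eq_fourier_comp_neg]
  exact Real.zero_at_infty_fourier _

lemma fourierInv_schwartz_apply (ψ : 𝓢(ℝ, ℂ)) (x : ℝ) : 𝓕⁻ ψ x = 𝓕 (ψ : ℝ → ℂ) (-x) := by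
  rw [SchwartzMap.fourierInv_coe, Real.fourierInv_eq_fourier_neg]

/-- Self-adjointness of the Fourier transform (Fubini), applied to the reflected density. It allows
identities between densities to be tested in physical space. -/
lemma integral_mul_fourierInv (ψ : 𝓢(ℝ, ℂ)) {ρ : ℝ → ℂ} (hρ : Integrable ρ) :
    ∫ x, ψ x * 𝓕⁻ ρ x = ∫ η, 𝓕⁻ ψ η * ρ η := by
  have h := VectorFourier.integral_fourierIntegral_smul_eq_flip (L := innerₗ ℝ)
    (μ := volume) (ν := volume) (f := fun x => ψ x) (g := fun x => ρ (-x))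
    Real.continuous_fourierChar (by fun_prop) ψ.integrable hρ.comp_neg
  have h2 : ∫ ξ, 𝓕 (ψ : ℝ → ℂ) ξ * ρ (-ξ) = ∫ x, ψ x * 𝓕 (fun y => ρ (-y)) x := by
    simpa using! h
  rw [Real.fourierInv_eq_fourier_comp_neg, ← h2]
  rw [← integral_neg_eq_self (fun η => 𝓕⁻ ψ η * ρ η)]
  simp [fourierInv_schwartz_apply]

lemma integral_fourier_mul_fourierInv (ψ : 𝓢(ℝ, ℂ)) {ρ : ℝ → ℂ} (hρ : Integrable ρ) :
    ∫ x, 𝓕 ψ x * 𝓕⁻ ρ x = ∫ η, ψ η * ρ η := by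
  rw [integral_mul_fourierInv _ hρ]
  simp

/-- Near each point, multiply by a smooth bump equal to 1 there. -/
lemma locallyIntegrable_of_schwartz {f : ℝ → ℂ}
    (hf : ∀ ψ : 𝓢(ℝ, ℂ), Integrable (fun x => ψ x * f x)) : LocallyIntegrable f := by
  intro x
  obtain ⟨b⟩ : Nonempty (ContDiffBump x) := inferInstance
  have hg₁ : HasCompactSupport (Complex.ofRealCLM ∘ b) := b.hasCompactSupport.comp_left rfl
  have hg₂ : ContDiff ℝ (⊤ : ℕ∞) (Complex.ofRealCLM ∘ b) :=
    Complex.ofRealCLM.contDiff.comp b.contDiff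
  have h := hf (hg₁.toSchwartzMap hg₂)
  refine ⟨Metric.closedBall x b.rIn, Metric.closedBall_mem_nhds _ b.rIn_pos, ?_⟩
  refine (h.integrableOn (s := Metric.closedBall x b.rIn)).congr_fun ?_ measurableSet_closedBall
  intro y hy
  simp [b.one_of_mem_closedBall hy]

lemma ae_eq_zero_of_schwartz {f : ℝ → ℂ}
    (hf : ∀ ψ : 𝓢(ℝ, ℂ), Integrable (fun x => ψ x * f x))
    (h0 : ∀ ψ : 𝓢(ℝ, ℂ), ∫ x, ψ x * f x = 0) : f =ᵐ[volume] 0 := by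
  refine ae_eq_zero_of_integral_contDiff_smul_eq_zero (locallyIntegrable_of_schwartz hf) ?_
  intro g g_smooth g_cpt
  have hg₁ : HasCompactSupport (Complex.ofRealCLM ∘ g) := g_cpt.comp_left rfl
  have hg₂ : ContDiff ℝ (⊤ : ℕ∞) (Complex.ofRealCLM ∘ g) :=
    Complex.ofRealCLM.contDiff.comp g_smooth
  have := h0 (hg₁.toSchwartzMap hg₂)
  simpa using! this

lemma ae_eq_of_schwartz {f g : ℝ → ℂ}
    (hf : ∀ ψ : 𝓢(ℝ, ℂ), Integrable (fun x => ψ x * f x))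
    (hg : ∀ ψ : 𝓢(ℝ, ℂ), Integrable (fun x => ψ x * g x))
    (h0 : ∀ ψ : 𝓢(ℝ, ℂ), ∫ x, ψ x * f x = ∫ x, ψ x * g x) : f =ᵐ[volume] g := by
  have h := ae_eq_zero_of_schwartz (f := fun x => f x - g x)
    (fun ψ => by simpa only [mul_sub] using! (hf ψ).sub (hg ψ))
    (fun ψ => by simp only [mul_sub]; rw [integral_sub (hf ψ) (hg ψ), h0, sub_self])
  filter_upwards [h] with x hx
  exact sub_eq_zero.1 hx

lemma Represents.ae_eq {T : 𝓢'(ℝ, ℂ)} {f g : ℝ → ℂ} (hf : Represents T f)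
    (hg : Represents T g) : f =ᵐ[volume] g :=
  ae_eq_of_schwartz (fun ψ => (hf ψ).1) (fun ψ => (hg ψ).1)
    (fun ψ => by rw [← (hf ψ).2, ← (hg ψ).2])

lemma fourierInv_injective {ρ σ : ℝ → ℂ} (hρ : Integrable ρ) (hσ : Integrable σ)
    (h : ∀ x, 𝓕⁻ ρ x = 𝓕⁻ σ x) : ρ =ᵐ[volume] σ :=
  ae_eq_of_schwartz (fun ψ => schwartz_integrable_mul ψ hρ)
    (fun ψ => schwartz_integrable_mul ψ hσ) fun ψ => by
      rw [← integral_fourier_mul_fourierInv ψ hρ, ← integral_fourier_mul_fourierInv ψ hσ]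
      simp only [h]

lemma hasDerivAt_fourierInv {ρ : ℝ → ℂ} (hρ : Integrable ρ)
    (hρ' : Integrable (fun η : ℝ => (η : ℂ) * ρ η)) (x : ℝ) :
    HasDerivAt (𝓕⁻ ρ) (𝓕⁻ (fun η : ℝ => 2 * Real.pi * Complex.I * η * ρ η) x) x := by
  rw [Real.fourierInv_eq_fourier_comp_neg, Real.fourierInv_eq_fourier_comp_neg]
  have h := Real.hasDerivAt_fourier (f := fun η => ρ (-η)) hρ.comp_neg (by
    simpa using! hρ'.comp_neg.neg) x
  convert! h using 3 with η
  simp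

lemma fourierInv_deriv_schwartz (ψ : 𝓢(ℝ, ℂ)) (η : ℝ) :
    𝓕⁻ (SchwartzMap.derivCLM ℂ ℂ ψ) η = -(2 * Real.pi * Complex.I * η) * 𝓕⁻ ψ η := by
  rw [fourierInv_schwartz_apply, fourierInv_schwartz_apply]
  have h := Real.fourier_deriv ψ.integrable ψ.differentiable
    (by simpa using! (SchwartzMap.derivCLM ℂ ℂ ψ).integrable)
  have e : (SchwartzMap.derivCLM ℂ ℂ ψ : ℝ → ℂ) = deriv ψ := by
    ext x; simp
  rw [e, h]
  simp

/-- Up to sign, `2πiη ψ(η)` is the inverse transform of the derivative of `𝓕 ψ`, hence again a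
Schwartz function. No decay of `ρ` beyond integrability is needed. -/
lemma schwartz_integrable_id_mul (ψ : 𝓢(ℝ, ℂ)) {ρ : ℝ → ℂ} (hρ : Integrable ρ) :
    Integrable (fun η : ℝ => ψ η * (2 * Real.pi * Complex.I * η * ρ η)) := by
  have h := schwartz_integrable_mul (-(𝓕⁻ (SchwartzMap.derivCLM ℂ ℂ (𝓕 ψ)))) hρ
  refine h.congr (Filter.Eventually.of_forall fun η => ?_)
  simp only [neg_apply, fourierInv_deriv_schwartz]
  simp
  ring

lemma schwartz_integral_mul_deriv (χ : 𝓢(ℝ, ℂ)) {f f' : ℝ → ℂ}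
    (hf : ∀ x, HasDerivAt f (f' x) x) (h1 : Integrable fun x => χ x * f' x)
    (h2 : Integrable fun x => SchwartzMap.derivCLM ℂ ℂ χ x * f x)
    (h3 : Integrable fun x => χ x * f x) :
    ∫ x, χ x * f' x = -∫ x, SchwartzMap.derivCLM ℂ ℂ χ x * f x :=
  integral_mul_deriv_eq_deriv_mul_of_integrable
    (fun x _ => by simpa using! χ.differentiable.differentiableAt.hasDerivAt)
    (fun x _ => hf x) h1 h2 h3

/-- Differentiation corresponds to multiplication by `2πiη`. -/
lemma fourierInv_deriv_ae {ρ σ : ℝ → ℂ} (hρ : Integrable ρ) (hσ : Integrable σ)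
    (h : ∀ x, HasDerivAt (𝓕⁻ ρ) (𝓕⁻ σ x) x) :
    (fun η : ℝ => 2 * Real.pi * Complex.I * η * ρ η) =ᵐ[volume] σ := by
  refine ae_eq_of_schwartz (fun ψ => schwartz_integrable_id_mul ψ hρ)
    (fun ψ => schwartz_integrable_mul ψ hσ) fun ψ => ?_
  have hI (χ : 𝓢(ℝ, ℂ)) {τ : ℝ → ℂ} (hτ : Integrable τ) :
      Integrable (fun x => χ x * 𝓕⁻ τ x) :=
    schwartz_integrable_mul_bdd χ (continuous_fourierInv hτ) (norm_fourierInv_le τ)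
  -- The product `η ρ(η)` is not known to be integrable, so the derivative is moved to a Schwartz
  -- function by parts before passing to the Fourier side.
  have key := schwartz_integral_mul_deriv (𝓕 ψ) h (hI _ hσ) (hI _ hρ) (hI _ hρ)
  rw [← integral_fourier_mul_fourierInv ψ hσ, key, integral_mul_fourierInv _ hρ,
    ← integral_neg]
  refine integral_congr_ae (Filter.Eventually.of_forall fun η => ?_)
  simp only [fourierInv_deriv_schwartz]
  simp
  ring

lemma iteratedDeriv_two_schwartz (ψ : 𝓢(ℝ, ℂ)) :
    iteratedDeriv 2 (fun x => ψ x) = SchwartzMap.derivCLM ℂ ℂ (SchwartzMap.derivCLM ℂ ℂ ψ) := by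
  ext x
  have e (χ : 𝓢(ℝ, ℂ)) : deriv χ = (SchwartzMap.derivCLM ℂ ℂ χ : ℝ → ℂ) := by
    ext x; simp
  rw [iteratedDeriv_succ, iteratedDeriv_one]
  change deriv (deriv ψ) x = _
  rw [e, e]

lemma fourierInv_iteratedDeriv_two (ψ : 𝓢(ℝ, ℂ)) (η : ℝ) :
    𝓕⁻ (SchwartzMap.derivCLM ℂ ℂ (SchwartzMap.derivCLM ℂ ℂ ψ)) η
      = -(2 * Real.pi * η) ^ 2 * 𝓕⁻ ψ η := by
  rw [fourierInv_deriv_schwartz, fourierInv_deriv_schwartz]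
  linear_combination (2 * Real.pi * η) ^ 2 * 𝓕⁻ ψ η * Complex.I_sq

lemma schwartz_integrable_sq_mul (ψ : 𝓢(ℝ, ℂ)) {ρ : ℝ → ℂ} (hρ : Integrable ρ) :
    Integrable (fun η : ℝ => ψ η * ((2 * Real.pi * η) ^ 2 * ρ η)) := by
  have h := schwartz_integrable_mul
    (-(𝓕⁻ (SchwartzMap.derivCLM ℂ ℂ (SchwartzMap.derivCLM ℂ ℂ (𝓕 ψ))))) hρ
  refine h.congr (Filter.Eventually.of_forall fun η => ?_)
  simp only [neg_apply, fourierInv_iteratedDeriv_two]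
  simp
  ring

/-- Two derivatives correspond to multiplication by `-(2πη)²`. -/
lemma fourierInv_deriv_two_ae {ρ σ : ℝ → ℂ} (hρ : Integrable ρ) (hσ : Integrable σ)
    (h2 : ContDiff ℝ 2 (𝓕⁻ ρ)) (h : ∀ x, iteratedDeriv 2 (𝓕⁻ ρ) x = 𝓕⁻ σ x) :
    (fun η : ℝ => (2 * Real.pi * η) ^ 2 * ρ η) =ᵐ[volume] fun η => -σ η := by
  refine ae_eq_of_schwartz (fun ψ => schwartz_integrable_sq_mul ψ hρ)
    (fun ψ => schwartz_integrable_mul ψ hσ.neg) fun ψ => ?_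
  have hI (χ : 𝓢(ℝ, ℂ)) {τ : ℝ → ℂ} (hτ : Integrable τ) :
      Integrable (fun x => χ x * 𝓕⁻ τ x) :=
    schwartz_integrable_mul_bdd χ (continuous_fourierInv hτ) (norm_fourierInv_le τ)
  have hd1 : ∀ x, HasDerivAt (𝓕⁻ ρ) (deriv (𝓕⁻ ρ) x) x := fun x =>
    (h2.differentiable (by norm_num)).differentiableAt.hasDerivAt
  have hC1 : ContDiff ℝ 1 (deriv (𝓕⁻ ρ)) :=
    ((contDiff_succ_iff_deriv (n := 1)).1 (by simpa using! h2)).2.2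
  have hd2 : ∀ x, HasDerivAt (deriv (𝓕⁻ ρ)) (𝓕⁻ σ x) x := fun x => by
    have := (hC1.differentiable (by norm_num)).differentiableAt.hasDerivAt (x := x)
    rwa [← h, iteratedDeriv_succ, iteratedDeriv_one]
  set M := ∫ η, ‖σ η‖
  -- The first derivative is not known to be bounded. The second one is, so the mean value
  -- inequality gives linear growth, enough for integrability against Schwartz functions.
  have hgrow : ∀ x, ‖deriv (𝓕⁻ ρ) x‖ ≤ ‖deriv (𝓕⁻ ρ) 0‖ + M * ‖x‖ := fun x => by
    have := Convex.norm_image_sub_le_of_norm_hasDerivWithin_le (f := deriv (𝓕⁻ ρ))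
      (f' := 𝓕⁻ σ) (s := Set.univ) (C := M) (x := 0) (y := x)
      (fun x _ => (hd2 x).hasDerivWithinAt) (fun x _ => norm_fourierInv_le σ x) convex_univ
      (Set.mem_univ _) (Set.mem_univ _)
    rw [sub_zero] at this
    calc ‖deriv (𝓕⁻ ρ) x‖ = ‖deriv (𝓕⁻ ρ) 0 + (deriv (𝓕⁻ ρ) x - deriv (𝓕⁻ ρ) 0)‖ := by
          congr 1; ring
      _ ≤ _ := (norm_add_le _ _).trans (by gcongr)
  have hI' (χ : 𝓢(ℝ, ℂ)) : Integrable (fun x => χ x * deriv (𝓕⁻ ρ) x) := by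
    have b0 := (χ.integrable_pow_mul volume 0).const_mul ‖deriv (𝓕⁻ ρ) 0‖
    have b1 := (χ.integrable_pow_mul volume 1).const_mul M
    refine (b0.add b1).mono' (χ.continuous.mul hC1.continuous).aestronglyMeasurable
      (Filter.Eventually.of_forall fun x => ?_)
    rw [norm_mul]
    calc _ ≤ ‖χ x‖ * (‖deriv (𝓕⁻ ρ) 0‖ + M * ‖x‖) := by gcongr; exact hgrow x
      _ = _ := by simp; ring
  have key1 := schwartz_integral_mul_deriv (𝓕 ψ) hd2 (hI _ hσ) (hI' _) (hI' _)
  have key2 := schwartz_integral_mul_deriv (SchwartzMap.derivCLM ℂ ℂ (𝓕 ψ)) hd1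
    (hI' _) (hI _ hρ) (hI _ hρ)
  have e := integral_fourier_mul_fourierInv ψ hσ
  rw [key1, key2, integral_mul_fourierInv _ hρ, neg_neg] at e
  simp only [mul_neg]
  rw [integral_neg, ← e, ← integral_neg]
  refine integral_congr_ae (Filter.Eventually.of_forall fun η => ?_)
  simp only [fourierInv_iteratedDeriv_two]
  simp
  ring

/-! ### The weight and its convolution estimates -/

/-- The product of the counting measure and Lebesgue measure on the frequency space `ℤ × ℝ`. -/
noncomputable def lam : Measure (ℤ × ℝ) := Measure.count.prod volume

instance : SigmaFinite lam := by unfold lam; infer_instance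

instance : lam.IsAddLeftInvariant := by unfold lam; infer_instance

lemma isNegInvariant_prod {α β : Type*} [MeasurableSpace α] [MeasurableSpace β] [AddGroup α]
    [AddGroup β] [MeasurableNeg α] [MeasurableNeg β] (μ : Measure α) (ν : Measure β) [SFinite μ]
    [SFinite ν] [μ.IsNegInvariant] [ν.IsNegInvariant] : (μ.prod ν).IsNegInvariant where
  neg_eq_self := by
    have h := Measure.map_prod_map μ ν (f := Neg.neg) (g := Neg.neg) measurable_neg measurable_neg
    have e₁ : Measure.map Neg.neg μ = μ := Measure.neg_eq_self _
    have e₂ : Measure.map Neg.neg ν = ν := Measure.neg_eq_self _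
    rw [e₁, e₂] at h
    exact h.symm

instance : lam.IsNegInvariant := isNegInvariant_prod _ _

instance : (lam.prod lam).IsNegInvariant := isNegInvariant_prod _ _

/-- The squared frequency `p² + ξ²`, modified at `p = 0`. -/
noncomputable def freqSq (k : ℤ × ℝ) : ℝ := max 1 ((k.1 : ℝ) ^ 2) + (2 * Real.pi * k.2) ^ 2

/-- The weight of the `X^s` norm. -/
noncomputable def wt (s : ℝ) (k : ℤ × ℝ) : ℝ≥0∞ := ENNReal.ofReal (freqSq k ^ s)

lemma one_le_freqSq (k : ℤ × ℝ) : 1 ≤ freqSq k := by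
  unfold freqSq
  have := le_max_left 1 ((k.1 : ℝ) ^ 2)
  nlinarith [sq_nonneg (2 * Real.pi * k.2)]

lemma freqSq_pos (k : ℤ × ℝ) : 0 < freqSq k := zero_lt_one.trans_le (one_le_freqSq k)

lemma freqSq_neg (k : ℤ × ℝ) : freqSq (-k) = freqSq k := by
  simp [freqSq]

lemma freqSq_of_odd {p : ℤ} (hp : Odd p) (η : ℝ) :
    freqSq (p, η) = (p : ℝ) ^ 2 + (2 * Real.pi * η) ^ 2 := by
  have h0 : p ≠ 0 := by rintro rfl; exact absurd hp (by decide)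
  have h1 : (1 : ℝ) ≤ (p : ℝ) ^ 2 := by exact_mod_cast (by positivity : 0 < p ^ 2)
  simp [freqSq, max_eq_right h1]

lemma measurable_freqSq : Measurable freqSq := by
  unfold freqSq
  have h : Measurable fun k : ℤ × ℝ => (k.1 : ℝ) := (measurable_of_countable _).comp measurable_fst
  fun_prop

lemma measurable_wt (s : ℝ) : Measurable (wt s) :=
  (measurable_freqSq.pow_const s).ennreal_ofReal

lemma wt_ne_zero (s : ℝ) (k : ℤ × ℝ) : wt s k ≠ 0 := by
  simpa [wt] using Real.rpow_pos_of_pos (freqSq_pos k) s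

lemma wt_ne_top (s : ℝ) (k : ℤ × ℝ) : wt s k ≠ ∞ := ENNReal.ofReal_ne_top

lemma freqSq_add_le (a b c : ℤ × ℝ) :
    freqSq (a + b + c) ≤ 3 * (freqSq a + freqSq b + freqSq c) := by
  simp only [freqSq, Prod.fst_add, Prod.snd_add, Int.cast_add]
  have h1 : ((a.1 : ℝ) + b.1 + c.1) ^ 2 ≤ 3 * ((a.1 : ℝ) ^ 2 + b.1 ^ 2 + c.1 ^ 2) := by
    nlinarith [sq_nonneg ((a.1 : ℝ) - b.1), sq_nonneg ((a.1 : ℝ) - c.1),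
      sq_nonneg ((b.1 : ℝ) - c.1)]
  have h2 : (2 * Real.pi * (a.2 + b.2 + c.2)) ^ 2
      ≤ 3 * ((2 * Real.pi * a.2) ^ 2 + (2 * Real.pi * b.2) ^ 2 + (2 * Real.pi * c.2) ^ 2) := by
    nlinarith [sq_nonneg (2 * Real.pi * a.2 - 2 * Real.pi * b.2),
      sq_nonneg (2 * Real.pi * a.2 - 2 * Real.pi * c.2),
      sq_nonneg (2 * Real.pi * b.2 - 2 * Real.pi * c.2)]
  have ha := le_max_left 1 ((a.1 : ℝ) ^ 2)
  have ha' := le_max_right 1 ((a.1 : ℝ) ^ 2)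
  have hb := le_max_left 1 ((b.1 : ℝ) ^ 2)
  have hb' := le_max_right 1 ((b.1 : ℝ) ^ 2)
  have hc := le_max_left 1 ((c.1 : ℝ) ^ 2)
  have hc' := le_max_right 1 ((c.1 : ℝ) ^ 2)
  have : max 1 (((a.1 : ℝ) + b.1 + c.1) ^ 2)
      ≤ 3 * (max 1 ((a.1 : ℝ) ^ 2) + max 1 ((b.1 : ℝ) ^ 2) + max 1 ((c.1 : ℝ) ^ 2)) :=
    max_le (by linarith) (by linarith)
  linarith

/-- The squared frequency of a sum is at most `3 · 3 = 9` times the largest of the three; as `s ≥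
0`, the power is monotone, and a maximum is at most the sum. -/
lemma wt_add_le {s : ℝ} (hs : 0 ≤ s) (a b c : ℤ × ℝ) :
    wt s (a + b + c) ≤ ENNReal.ofReal (9 ^ s) * (wt s a + wt s b + wt s c) := by
  have ha := freqSq_pos a
  have hb := freqSq_pos b
  have hc := freqSq_pos c
  set m := max (freqSq a) (max (freqSq b) (freqSq c)) with hm
  have h1 : freqSq (a + b + c) ≤ 9 * m := by
    have := freqSq_add_le a b c
    have h2 : freqSq a ≤ m := le_max_left _ _
    have h3 : freqSq b ≤ m := (le_max_left _ _).trans (le_max_right _ _)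
    have h4 : freqSq c ≤ m := (le_max_right _ _).trans (le_max_right _ _)
    linarith
  have hm0 : 0 ≤ m := ha.le.trans (le_max_left _ _)
  have h5 : freqSq (a + b + c) ^ s ≤ 9 ^ s * m ^ s := by
    rw [← Real.mul_rpow (by norm_num) hm0]
    exact Real.rpow_le_rpow (freqSq_pos _).le h1 hs
  have pa := Real.rpow_pos_of_pos ha s
  have pb := Real.rpow_pos_of_pos hb s
  have pc := Real.rpow_pos_of_pos hc s
  have h6 : m ^ s ≤ freqSq a ^ s + freqSq b ^ s + freqSq c ^ s := by
    rcases max_choice (freqSq a) (max (freqSq b) (freqSq c)) with h | h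
    · rw [hm, h]; linarith
    · rcases max_choice (freqSq b) (freqSq c) with h' | h' <;> rw [hm, h, h'] <;> linarith
  unfold wt
  rw [← ENNReal.ofReal_add pa.le pb.le, ← ENNReal.ofReal_add (by positivity) pc.le,
    ← ENNReal.ofReal_mul (by positivity)]
  exact ENNReal.ofReal_le_ofReal (h5.trans (by gcongr))

/-- The total mass of the inverse weight. -/
noncomputable def invMass (s : ℝ) : ℝ≥0∞ := ∫⁻ k, (wt s k)⁻¹ ∂lam

/-- Frequency space is two-dimensional, which is where `s > 1` enters. Half of the exponent is spent
on `p` and half on `ξ`, bounding the inverse weight by a product of `|p|^{-s}` (`1` at `p = 0`) and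
`(1 + ξ²)^{-s/2}`, summable and integrable respectively. -/
lemma invMass_lt_top {s : ℝ} (hs : 1 < s) : invMass s < ∞ := by
  have h1 : Summable fun n : ℤ => max 1 ((n : ℝ) ^ 2) ^ (-s / 2) := by
    have hsum : Summable fun n : ℤ => |(n : ℝ)| ^ (-s) + if n = 0 then 1 else 0 :=
      (Real.summable_abs_int_rpow hs).add
        (summable_of_ne_finset_zero (s := {0}) (by intro b hb; simpa using hb))
    refine Summable.of_nonneg_of_le (fun n => by positivity) (fun n => ?_) hsum
    by_cases hn : n = 0
    · simp [hn, Real.rpow_nonneg]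
    · have hn1 : (1 : ℝ) ≤ |(n : ℝ)| := by exact_mod_cast Int.one_le_abs hn
      have h2 : (1 : ℝ) ≤ (n : ℝ) ^ 2 := by rw [← sq_abs]; nlinarith
      rw [max_eq_right h2, if_neg hn, add_zero, ← sq_abs, ← Real.rpow_natCast,
        ← Real.rpow_mul (abs_nonneg _)]
      apply le_of_eq; congr 1; push_cast; ring
  have h2 : Integrable fun η : ℝ => (1 + (2 * Real.pi * η) ^ 2) ^ (-s / 2) := by
    have h := integrable_rpow_neg_one_add_norm_sq (E := ℝ) (μ := volume) (r := s) (by simpa)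
    refine (h.comp_mul_left' (R := 2 * Real.pi) (by positivity)).congr
      (Filter.Eventually.of_forall fun η => ?_)
    simp only [Real.norm_eq_abs, sq_abs]
  have hle : ∀ k : ℤ × ℝ, (wt s k)⁻¹ ≤ ENNReal.ofReal (max 1 ((k.1 : ℝ) ^ 2) ^ (-s / 2))
      * ENNReal.ofReal ((1 + (2 * Real.pi * k.2) ^ 2) ^ (-s / 2)) := fun k => by
    unfold wt
    rw [← ENNReal.ofReal_inv_of_pos (Real.rpow_pos_of_pos (freqSq_pos k) s),
      ← ENNReal.ofReal_mul (by positivity)]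
    refine ENNReal.ofReal_le_ofReal ?_
    have e : (freqSq k ^ s)⁻¹ = freqSq k ^ (-s / 2) * freqSq k ^ (-s / 2) := by
      rw [← Real.rpow_neg (freqSq_pos k).le, ← Real.rpow_add (freqSq_pos k)]; congr 1; ring
    rw [e]
    have b1 : max 1 ((k.1 : ℝ) ^ 2) ≤ freqSq k := by
      unfold freqSq; nlinarith [sq_nonneg (2 * Real.pi * k.2)]
    have b2 : 1 + (2 * Real.pi * k.2) ^ 2 ≤ freqSq k := by
      unfold freqSq; gcongr; exact le_max_left _ _
    have hneg : -s / 2 ≤ 0 := by linarith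
    exact mul_le_mul (Real.rpow_le_rpow_of_nonpos (by positivity) b1 hneg)
      (Real.rpow_le_rpow_of_nonpos (by positivity) b2 hneg)
      (Real.rpow_nonneg (freqSq_pos k).le _) (by positivity)
  refine (lintegral_mono hle).trans_lt ?_
  unfold lam
  rw [lintegral_prod_mul (f := fun p : ℤ => ENNReal.ofReal (max 1 ((p : ℝ) ^ 2) ^ (-s / 2)))
    (g := fun η : ℝ => ENNReal.ofReal ((1 + (2 * Real.pi * η) ^ 2) ^ (-s / 2)))
    (measurable_of_countable _).aemeasurable h2.1.aemeasurable.ennreal_ofReal, lintegral_count]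
  refine ENNReal.mul_lt_top ?_ ?_
  · rw [← ENNReal.ofReal_tsum_of_nonneg (fun n => by positivity) h1]
    exact ENNReal.ofReal_lt_top
  · exact h2.lintegral_lt_top

/-! ### Weighted bounds for triple convolutions. -/

lemma lintegral_prod_mul_shift {f g : ℤ × ℝ → ℝ≥0∞} (hf : Measurable f) (hg : Measurable g)
    (k : ℤ × ℝ) :
    ∫⁻ kk, f kk.1 * g (k - kk.1 - kk.2) ∂(lam.prod lam)
      = (∫⁻ a, f a ∂lam) * ∫⁻ a, g a ∂lam := by
  rw [lintegral_prod _ (by fun_prop)]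
  calc _ = ∫⁻ a, f a * ∫⁻ b, g b ∂lam ∂lam := by
        refine lintegral_congr fun a => ?_
        dsimp only
        rw [lintegral_const_mul _ (by fun_prop), lintegral_sub_left_eq_self g (k - a)]
    _ = _ := lintegral_mul_const _ hf

lemma lintegral_prod_mul_shift' {f g : ℤ × ℝ → ℝ≥0∞} (hf : Measurable f) (hg : Measurable g)
    (k : ℤ × ℝ) :
    ∫⁻ kk, f kk.2 * g (k - kk.1 - kk.2) ∂(lam.prod lam)
      = (∫⁻ a, f a ∂lam) * ∫⁻ a, g a ∂lam := by
  rw [← lintegral_prod_mul_shift hf hg k, ← lintegral_prod_swap]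
  simp only [Prod.fst_swap, Prod.snd_swap, sub_right_comm k]

/-- The weight at `k = a + b + c` is controlled by the sum of the three weights. Each summand
cancels one inverse weight, and the remaining two integrate independently to `invMass s ^ 2`. -/
lemma wt_mul_lintegral_inv_le {s : ℝ} (hs : 1 < s) (k : ℤ × ℝ) :
    wt s k * ∫⁻ kk, (wt s kk.1)⁻¹ * (wt s kk.2)⁻¹ * (wt s (k - kk.1 - kk.2))⁻¹ ∂(lam.prod lam)
      ≤ ENNReal.ofReal (9 ^ s) * (3 * invMass s ^ 2) := by
  have hm : Measurable fun k => (wt s k)⁻¹ := (measurable_wt s).inv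
  rw [← lintegral_const_mul _ (by have := measurable_wt s; fun_prop)]
  have hpt : ∀ kk : (ℤ × ℝ) × (ℤ × ℝ), wt s k * ((wt s kk.1)⁻¹ * (wt s kk.2)⁻¹ *
      (wt s (k - kk.1 - kk.2))⁻¹) ≤ ENNReal.ofReal (9 ^ s) *
      ((wt s kk.2)⁻¹ * (wt s (k - kk.1 - kk.2))⁻¹ + (wt s kk.1)⁻¹ * (wt s (k - kk.1 - kk.2))⁻¹
        + (wt s kk.1)⁻¹ * (wt s kk.2)⁻¹) := fun kk => by
    have h := wt_add_le (zero_le_one.trans hs.le) kk.1 kk.2 (k - kk.1 - kk.2)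
    rw [show kk.1 + kk.2 + (k - kk.1 - kk.2) = k by abel] at h
    refine (mul_le_mul_left h _).trans (le_of_eq ?_)
    have ha := ENNReal.mul_inv_cancel (wt_ne_zero s kk.1) (wt_ne_top s kk.1)
    have hb := ENNReal.mul_inv_cancel (wt_ne_zero s kk.2) (wt_ne_top s kk.2)
    have hc := ENNReal.mul_inv_cancel (wt_ne_zero s (k - kk.1 - kk.2))
      (wt_ne_top s (k - kk.1 - kk.2))
    set a := wt s kk.1
    set b := wt s kk.2
    set c := wt s (k - kk.1 - kk.2)
    calc _ = ENNReal.ofReal (9 ^ s) * ((a * a⁻¹) * (b⁻¹ * c⁻¹) + (b * b⁻¹) * (a⁻¹ * c⁻¹)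
          + (c * c⁻¹) * (a⁻¹ * b⁻¹)) := by ring
      _ = _ := by rw [ha, hb, hc, one_mul, one_mul, one_mul]
  refine (lintegral_mono hpt).trans (le_of_eq ?_)
  have hm' := measurable_wt s
  rw [lintegral_const_mul _ (by fun_prop), lintegral_add_left (by fun_prop),
    lintegral_add_left (by fun_prop), lintegral_prod_mul_shift' hm hm k,
    lintegral_prod_mul_shift hm hm k, lintegral_prod_mul hm.aemeasurable hm.aemeasurable]
  unfold invMass
  ring

/-- The squared weighted `L²` norm. -/
noncomputable def wmass (s : ℝ) (f : ℤ × ℝ → ℝ≥0∞) : ℝ≥0∞ := ∫⁻ k, wt s k * f k ^ 2 ∂lam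

/-- Triple convolution. -/
noncomputable def conv3 (f g h : ℤ × ℝ → ℝ≥0∞) (k : ℤ × ℝ) : ℝ≥0∞ :=
  ∫⁻ kk, f kk.1 * g kk.2 * h (k - kk.1 - kk.2) ∂(lam.prod lam)

lemma rpow_half_sq (a : ℝ≥0∞) : (a ^ (1 / 2 : ℝ)) ^ 2 = a := by
  rw [← ENNReal.rpow_natCast, ← ENNReal.rpow_mul]; norm_num

lemma sq_rpow_half (a : ℝ≥0∞) : (a ^ 2) ^ (1 / 2 : ℝ) = a := by
  rw [← ENNReal.rpow_natCast, ← ENNReal.rpow_mul]; norm_num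

lemma sq_lintegral_mul_le {α : Type*} [MeasurableSpace α] {μ : Measure α} {f g : α → ℝ≥0∞}
    (hf : AEMeasurable f μ) (hg : AEMeasurable g μ) :
    (∫⁻ a, f a * g a ∂μ) ^ 2 ≤ (∫⁻ a, f a ^ 2 ∂μ) * ∫⁻ a, g a ^ 2 ∂μ := by
  have h := ENNReal.lintegral_mul_norm_pow_le (hf.pow_const 2) (hg.pow_const 2)
    (p := 1 / 2) (q := 1 / 2) (by norm_num) (by norm_num) (by norm_num)
  simp only [sq_rpow_half] at h
  calc _ ≤ ((∫⁻ a, f a ^ 2 ∂μ) ^ (1 / 2 : ℝ) * (∫⁻ a, g a ^ 2 ∂μ) ^ (1 / 2 : ℝ)) ^ 2 := by gcongr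
    _ = _ := by rw [mul_pow, rpow_half_sq, rpow_half_sq]

/-- The constant of the algebra property. -/
noncomputable def algConst (s : ℝ) : ℝ≥0∞ := ENNReal.ofReal (9 ^ s) * (3 * invMass s ^ 2)

lemma algConst_lt_top {s : ℝ} (hs : 1 < s) : algConst s < ∞ := by
  have := invMass_lt_top hs
  exact ENNReal.mul_lt_top ENNReal.ofReal_lt_top
    (ENNReal.mul_lt_top (by simp) (ENNReal.pow_lt_top this))

/-- The algebra property of `X^s`. Inside the convolution, Cauchy–Schwarz splits off the inverse
weights `F`, whose contribution is bounded uniformly in `k`; the weighted squares `H` then factor by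
Tonelli and translation invariance. -/
lemma wmass_conv3_le {s : ℝ} (hs : 1 < s) {f g h : ℤ × ℝ → ℝ≥0∞} (hf : Measurable f)
    (hg : Measurable g) (hh : Measurable h) :
    wmass s (conv3 f g h) ≤ algConst s * (wmass s f * wmass s g * wmass s h) := by
  have hw := measurable_wt s
  have hpt : ∀ k, wt s k * conv3 f g h k ^ 2 ≤ algConst s *
      ∫⁻ kk, (wt s kk.1 * f kk.1 ^ 2) * (wt s kk.2 * g kk.2 ^ 2)
        * (wt s (k - kk.1 - kk.2) * h (k - kk.1 - kk.2) ^ 2) ∂(lam.prod lam) := fun k => by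
    set F : (ℤ × ℝ) × (ℤ × ℝ) → ℝ≥0∞ := fun kk => ((wt s kk.1)⁻¹ * (wt s kk.2)⁻¹ *
      (wt s (k - kk.1 - kk.2))⁻¹) ^ (1 / 2 : ℝ)
    set H : (ℤ × ℝ) × (ℤ × ℝ) → ℝ≥0∞ := fun kk => ((wt s kk.1 * f kk.1 ^ 2) *
      (wt s kk.2 * g kk.2 ^ 2) * (wt s (k - kk.1 - kk.2) * h (k - kk.1 - kk.2) ^ 2)) ^ (1 / 2 : ℝ)
    have hFH : ∀ kk, f kk.1 * g kk.2 * h (k - kk.1 - kk.2) = F kk * H kk := fun kk => by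
      have ha := ENNReal.inv_mul_cancel (wt_ne_zero s kk.1) (wt_ne_top s kk.1)
      have hb := ENNReal.inv_mul_cancel (wt_ne_zero s kk.2) (wt_ne_top s kk.2)
      have hc := ENNReal.inv_mul_cancel (wt_ne_zero s (k - kk.1 - kk.2))
        (wt_ne_top s (k - kk.1 - kk.2))
      simp only [F, H]
      rw [← ENNReal.mul_rpow_of_nonneg _ _ (by norm_num : (0 : ℝ) ≤ 1 / 2)]
      set a := wt s kk.1
      set b := wt s kk.2
      set c := wt s (k - kk.1 - kk.2)
      rw [show a⁻¹ * b⁻¹ * c⁻¹ * (a * f kk.1 ^ 2 * (b * g kk.2 ^ 2) *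
          (c * h (k - kk.1 - kk.2) ^ 2)) = (a⁻¹ * a) * (b⁻¹ * b) * (c⁻¹ * c) *
          (f kk.1 * g kk.2 * h (k - kk.1 - kk.2)) ^ 2 by ring, ha, hb, hc, one_mul, one_mul,
        one_mul, sq_rpow_half]
    have hcs := sq_lintegral_mul_le (μ := lam.prod lam) (f := F) (g := H)
      (by fun_prop) (by fun_prop)
    unfold conv3
    simp only [hFH]
    calc _ ≤ wt s k * ((∫⁻ kk, F kk ^ 2 ∂(lam.prod lam)) * ∫⁻ kk, H kk ^ 2 ∂(lam.prod lam)) := by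
          gcongr
      _ = (wt s k * ∫⁻ kk, F kk ^ 2 ∂(lam.prod lam)) * ∫⁻ kk, H kk ^ 2 ∂(lam.prod lam) := by ring
      _ ≤ _ := by
          simp only [F, H, rpow_half_sq]
          gcongr
          exact wt_mul_lintegral_inv_le hs k
  refine (lintegral_mono hpt).trans ?_
  rw [lintegral_const_mul _ (by fun_prop)]
  gcongr
  rw [lintegral_lintegral_swap (by fun_prop)]
  have : ∀ kk : (ℤ × ℝ) × (ℤ × ℝ), ∫⁻ k, (wt s kk.1 * f kk.1 ^ 2) * (wt s kk.2 * g kk.2 ^ 2)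
        * (wt s (k - kk.1 - kk.2) * h (k - kk.1 - kk.2) ^ 2) ∂lam
      = (wt s kk.1 * f kk.1 ^ 2) * (wt s kk.2 * g kk.2 ^ 2) * wmass s h := fun kk => by
    rw [lintegral_const_mul _ (by fun_prop)]
    congr 1
    simp only [sub_sub]
    exact lintegral_sub_right_eq_self (fun k => wt s k * h k ^ 2) (kk.1 + kk.2)
  simp only [this]
  rw [lintegral_mul_const _ (by fun_prop),
    lintegral_prod_mul (f := fun k => wt s k * f k ^ 2) (g := fun k => wt s k * g k ^ 2)
      (by fun_prop) (by fun_prop)]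
  rfl

/-- Cauchy–Schwarz against the inverse weight. With `invMass s` finite, densities are integrable, so
the mode functions are continuous and absolutely summable over `p`. -/
lemma sq_lintegral_le_wmass {s : ℝ} {f : ℤ × ℝ → ℝ≥0∞} (hf : Measurable f) :
    (∫⁻ k, f k ∂lam) ^ 2 ≤ invMass s * wmass s f := by
  have hw := measurable_wt s
  have h := sq_lintegral_mul_le (μ := lam) (f := fun k => ((wt s k)⁻¹) ^ (1 / 2 : ℝ))
    (g := fun k => (wt s k * f k ^ 2) ^ (1 / 2 : ℝ)) (by fun_prop) (by fun_prop)
  simp only [rpow_half_sq] at h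
  refine le_trans (le_of_eq ?_) h
  congr 1
  refine lintegral_congr fun k => ?_
  rw [← ENNReal.mul_rpow_of_nonneg _ _ (by norm_num : (0 : ℝ) ≤ 1 / 2), ← mul_assoc,
    ENNReal.inv_mul_cancel (wt_ne_zero s k) (wt_ne_top s k), one_mul, sq_rpow_half]

/-! ### Admissible densities and the trilinear convolution operators -/

/-- Densities of Fourier transforms of reversible elements of `X^s`: real, even, of finite
weighted norm, and supported on the odd modes. -/
structure Good (s : ℝ) (φ : ℤ × ℝ → ℝ) : Prop where
  meas : Measurable φ
  even : ∀ k, φ (-k) = φ k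
  supp : ∀ k : ℤ × ℝ, Even k.1 → φ k = 0
  fin : wmass s (fun k => ‖φ k‖ₑ) < ∞

lemma Good.lintegral_lt_top {s : ℝ} (hs : 1 < s) {φ : ℤ × ℝ → ℝ} (h : Good s φ) :
    ∫⁻ k, ‖φ k‖ₑ ∂lam < ∞ := by
  have h1 := (sq_lintegral_le_wmass (s := s) h.meas.enorm).trans_lt
    (ENNReal.mul_lt_top (invMass_lt_top hs) h.fin)
  by_contra h2
  rw [not_lt, top_le_iff] at h2
  simp [h2] at h1

lemma Good.integrable {s : ℝ} (hs : 1 < s) {φ : ℤ × ℝ → ℝ} (h : Good s φ) :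
    Integrable φ lam :=
  ⟨h.meas.aestronglyMeasurable, h.lintegral_lt_top hs⟩

/-- Bounded even symbols depending on the integer frequencies. -/
structure IsSymbol (m : ℤ → ℤ → ℝ) : Prop where
  bound : ∀ q r, |m q r| ≤ 1
  even : ∀ q r, m (-q) (-r) = m q r

/-- The trilinear convolution with symbol `m`. -/
noncomputable def tri (m : ℤ → ℤ → ℝ) (f g h : ℤ × ℝ → ℝ) (k : ℤ × ℝ) : ℝ :=
  ∫ kk, m kk.1.1 kk.2.1 * f kk.1 * g kk.2 * h (k - kk.1 - kk.2) ∂(lam.prod lam)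

lemma measurable_symbol (m : ℤ → ℤ → ℝ) :
    Measurable fun kk : (ℤ × ℝ) × (ℤ × ℝ) => m kk.1.1 kk.2.1 := by
  have h : Measurable fun z : ℤ × ℤ => m z.1 z.2 := measurable_of_countable _
  have h2 : Measurable fun kk : (ℤ × ℝ) × (ℤ × ℝ) => (kk.1.1, kk.2.1) := by fun_prop
  exact h.comp h2

lemma measurable_tri (m : ℤ → ℤ → ℝ) {f g h : ℤ × ℝ → ℝ} (hf : Measurable f)
    (hg : Measurable g) (hh : Measurable h) : Measurable (tri m f g h) := by
  have hm := measurable_symbol m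
  have h1 : Measurable fun z : (ℤ × ℝ) × ((ℤ × ℝ) × (ℤ × ℝ)) =>
      m z.2.1.1 z.2.2.1 * f z.2.1 * g z.2.2 * h (z.1 - z.2.1 - z.2.2) :=
    (((hm.comp measurable_snd).mul (by fun_prop)).mul (by fun_prop)).mul (by fun_prop)
  exact h1.stronglyMeasurable.integral_prod_right'.measurable

/-- Null sets pull back to null sets under the argument of the third convolution factor, so `tri`
depends only on almost everywhere classes. -/
lemma quasiMeasurePreserving_shift (k : ℤ × ℝ) :
    Measure.QuasiMeasurePreserving (fun kk : (ℤ × ℝ) × (ℤ × ℝ) => k - kk.1 - kk.2)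
      (lam.prod lam) lam := by
  have hmp : MeasurePreserving (Prod.map (fun a : ℤ × ℝ => k - a) (id : ℤ × ℝ → ℤ × ℝ))
      (lam.prod lam) (lam.prod lam) :=
    (Measure.measurePreserving_sub_left lam k).prod (MeasurePreserving.id lam)
  exact (quasiMeasurePreserving_sub lam lam).comp hmp.quasiMeasurePreserving

lemma tri_congr_ae (m : ℤ → ℤ → ℝ) {f g h f' g' h' : ℤ × ℝ → ℝ} (hf : f =ᵐ[lam] f')
    (hg : g =ᵐ[lam] g') (hh : h =ᵐ[lam] h') (k : ℤ × ℝ) : tri m f g h k = tri m f' g' h' k := by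
  refine integral_congr_ae ?_
  filter_upwards [Measure.quasiMeasurePreserving_fst.ae hf,
    Measure.quasiMeasurePreserving_snd.ae hg, (quasiMeasurePreserving_shift k).ae hh]
    with kk h1 h2 h3
  rw [h1, h2, h3]

lemma enorm_tri_integrand_le {m : ℤ → ℤ → ℝ} (hm : IsSymbol m) (f g h : ℤ × ℝ → ℝ)
    (k : ℤ × ℝ) (kk : (ℤ × ℝ) × (ℤ × ℝ)) :
    ‖m kk.1.1 kk.2.1 * f kk.1 * g kk.2 * h (k - kk.1 - kk.2)‖ₑ
      ≤ ‖f kk.1‖ₑ * ‖g kk.2‖ₑ * ‖h (k - kk.1 - kk.2)‖ₑ := by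
  simp only [enorm_mul]
  have : ‖m kk.1.1 kk.2.1‖ₑ ≤ 1 := by
    rw [← ofReal_norm, ENNReal.ofReal_le_one]
    exact hm.bound _ _
  gcongr
  exact mul_le_of_le_one_left' this

lemma enorm_tri_le {m : ℤ → ℤ → ℝ} (hm : IsSymbol m) (f g h : ℤ × ℝ → ℝ) (k : ℤ × ℝ) :
    ‖tri m f g h k‖ₑ ≤ conv3 (fun k => ‖f k‖ₑ) (fun k => ‖g k‖ₑ) (fun k => ‖h k‖ₑ) k :=
  (enorm_integral_le_lintegral_enorm _).trans
    (lintegral_mono fun kk => enorm_tri_integrand_le hm f g h k kk)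

lemma wmass_mono {s : ℝ} {f g : ℤ × ℝ → ℝ≥0∞} (h : ∀ k, f k ≤ g k) : wmass s f ≤ wmass s g :=
  lintegral_mono fun k => by gcongr; exact h k

lemma wmass_tri_le {s : ℝ} (hs : 1 < s) {m : ℤ → ℤ → ℝ} (hm : IsSymbol m) {f g h : ℤ × ℝ → ℝ}
    (hf : Good s f) (hg : Good s g) (hh : Good s h) :
    wmass s (fun k => ‖tri m f g h k‖ₑ) ≤ algConst s *
      (wmass s (fun k => ‖f k‖ₑ) * wmass s (fun k => ‖g k‖ₑ) * wmass s (fun k => ‖h k‖ₑ)) :=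
  (wmass_mono (enorm_tri_le hm f g h)).trans
    (wmass_conv3_le hs hf.meas.enorm hg.meas.enorm hh.meas.enorm)

lemma wmass_tri_lt_top {s : ℝ} (hs : 1 < s) {m : ℤ → ℤ → ℝ} (hm : IsSymbol m)
    {f g h : ℤ × ℝ → ℝ} (hf : Good s f) (hg : Good s g) (hh : Good s h) :
    wmass s (fun k => ‖tri m f g h k‖ₑ) < ∞ :=
  (wmass_tri_le hs hm hf hg hh).trans_lt (ENNReal.mul_lt_top (algConst_lt_top hs)
    (ENNReal.mul_lt_top (ENNReal.mul_lt_top hf.fin hg.fin) hh.fin))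

/-- Evenness comes from the substitution `kk ↦ -kk`. For the support, if `p` is even then one of
`q`, `r`, `p - q - r` is even, so the integrand vanishes. -/
lemma Good.tri {s : ℝ} (hs : 1 < s) {m : ℤ → ℤ → ℝ} (hm : IsSymbol m) {f g h : ℤ × ℝ → ℝ}
    (hf : Good s f) (hg : Good s g) (hh : Good s h) : Good s (tri m f g h) where
  meas := measurable_tri m hf.meas hg.meas hh.meas
  even k := by
    unfold GapSoliton.tri
    rw [← integral_neg_eq_self]
    refine integral_congr_ae (Filter.Eventually.of_forall fun kk => ?_)
    simp only [Prod.fst_neg, Prod.snd_neg, hm.even, hf.even, hg.even]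
    rw [show -k - -kk.1 - -kk.2 = -(k - kk.1 - kk.2) by abel, hh.even]
  supp k hk := by
    unfold GapSoliton.tri
    refine integral_eq_zero_of_ae (Filter.Eventually.of_forall fun kk => ?_)
    by_cases h1 : Even kk.1.1
    · simp [hf.supp _ h1]
    by_cases h2 : Even kk.2.1
    · simp [hg.supp _ h2]
    have h3 : Even (k - kk.1 - kk.2).1 := by
      simp only [Prod.fst_sub]
      rw [Int.not_even_iff_odd] at h1 h2
      exact (hk.sub_odd h1).sub_odd h2
    simp [hh.supp _ h3]
  fin := wmass_tri_lt_top hs hm hf hg hh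

/-- Additivity of `tri` in each slot requires integrable integrands. The weighted bound on the
convolution of absolute values makes it finite at almost every `k`. -/
lemma ae_integrable_tri {s : ℝ} (hs : 1 < s) {m : ℤ → ℤ → ℝ} (hm : IsSymbol m)
    {f g h : ℤ × ℝ → ℝ} (hf : Good s f) (hg : Good s g) (hh : Good s h) :
    ∀ᵐ k ∂lam, Integrable (fun kk : (ℤ × ℝ) × (ℤ × ℝ) =>
      m kk.1.1 kk.2.1 * f kk.1 * g kk.2 * h (k - kk.1 - kk.2)) (lam.prod lam) := by
  have hw := measurable_wt s
  have hf' := hf.meas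
  have hg' := hg.meas
  have hh' := hh.meas
  have h1 := (wmass_conv3_le hs hf.meas.enorm hg.meas.enorm hh.meas.enorm).trans_lt
    (ENNReal.mul_lt_top (algConst_lt_top hs)
      (ENNReal.mul_lt_top (ENNReal.mul_lt_top hf.fin hg.fin) hh.fin))
  have hc : Measurable (conv3 (fun k => ‖f k‖ₑ) (fun k => ‖g k‖ₑ) (fun k => ‖h k‖ₑ)) := by
    unfold conv3
    refine Measurable.lintegral_prod_right' (f := fun z : (ℤ × ℝ) × ((ℤ × ℝ) × (ℤ × ℝ)) =>
      ‖f z.2.1‖ₑ * ‖g z.2.2‖ₑ * ‖h (z.1 - z.2.1 - z.2.2)‖ₑ) ?_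
    fun_prop
  filter_upwards [ae_lt_top (by fun_prop) h1.ne] with k hk
  refine ⟨?_, ?_⟩
  · exact ((((measurable_symbol m).mul (by fun_prop)).mul (by fun_prop)).mul
      (by fun_prop)).aestronglyMeasurable
  · refine (lintegral_mono fun kk => enorm_tri_integrand_le hm f g h k kk).trans_lt ?_
    by_contra h2
    rw [not_lt, top_le_iff] at h2
    rw [conv3, h2] at hk
    simp [ENNReal.mul_top (wt_ne_zero s k)] at hk

/-! ### The Banach space of reversible densities -/

/-- The weighted measure on the frequency space. -/
noncomputable def nu (s : ℝ) : Measure (ℤ × ℝ) := lam.withDensity (wt s)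

/-- The weight never vanishes, so the weighted and unweighted measures have the same null sets. -/
lemma ae_nu (s : ℝ) : ae (nu s) = ae lam :=
  le_antisymm (withDensity_absolutelyContinuous _ _).ae_le
    (withDensity_absolutelyContinuous' (measurable_wt s).aemeasurable
      (Filter.Eventually.of_forall (wt_ne_zero s))).ae_le

lemma ae_neg {P : ℤ × ℝ → Prop} (h : ∀ᵐ k ∂lam, P k) : ∀ᵐ k ∂lam, P (-k) :=
  (Measure.measurePreserving_neg lam).quasiMeasurePreserving.ae h

lemma eLpNorm_nu {E : Type*} [NormedAddCommGroup E] (s : ℝ) (φ : ℤ × ℝ → E) :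
    eLpNorm φ 2 (nu s) = (wmass s fun k => ‖φ k‖ₑ) ^ (1 / 2 : ℝ) := by
  rw [eLpNorm_eq_lintegral_rpow_enorm_toReal (by simp) (by simp), nu,
    lintegral_withDensity_eq_lintegral_mul_non_measurable _ (measurable_wt s)
      (Filter.Eventually.of_forall fun k => (wt_ne_top s k).lt_top)]
  simp [wmass]

/-- The space of (Fourier transforms of) reversible elements of `X^s`. -/
noncomputable def XSpace (s : ℝ) : Submodule ℝ (Lp ℝ 2 (nu s)) where
  carrier := {f | ∀ᵐ k ∂lam, f (-k) = f k ∧ (Even k.1 → f k = 0)}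
  zero_mem' := by
    have h := Lp.coeFn_zero ℝ 2 (nu s)
    rw [Filter.EventuallyEq, ae_nu] at h
    change ∀ᵐ k ∂lam, _
    filter_upwards [h, ae_neg h] with k h1 h2
    exact ⟨h2.trans h1.symm, fun _ => h1⟩
  add_mem' := by
    intro f g hf hg
    have h := Lp.coeFn_add f g
    rw [Filter.EventuallyEq, ae_nu] at h
    change ∀ᵐ k ∂lam, _
    filter_upwards [h, ae_neg h, hf, hg] with k h1 h2 h3 h4
    simp only [h1, h2, Pi.add_apply, h3.1, h4.1, true_and]
    intro hk
    rw [h3.2 hk, h4.2 hk, add_zero]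
  smul_mem' := by
    intro c f hf
    have h := Lp.coeFn_smul c f
    rw [Filter.EventuallyEq, ae_nu] at h
    change ∀ᵐ k ∂lam, _
    filter_upwards [h, ae_neg h, hf] with k h1 h2 h3
    simp only [h1, h2, Pi.smul_apply, h3.1, true_and]
    intro hk
    rw [h3.2 hk, smul_zero]

lemma mem_XSpace {s : ℝ} {f : Lp ℝ 2 (nu s)} :
    f ∈ XSpace s ↔ ∀ᵐ k ∂lam, f (-k) = f k ∧ (Even k.1 → f k = 0) := Iff.rfl

/-- An `L²`-convergent sequence has an almost everywhere convergent subsequence, and the pointwise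
symmetry and support conditions pass to the limit. -/
lemma isClosed_XSpace (s : ℝ) : IsClosed (XSpace s : Set (Lp ℝ 2 (nu s))) := by
  refine IsSeqClosed.isClosed fun u f hu hf => ?_
  obtain ⟨ns, -, hns⟩ := (tendstoInMeasure_of_tendsto_Lp hf).exists_seq_tendsto_ae
  rw [ae_nu] at hns
  have hall : ∀ᵐ k ∂lam, ∀ n, u n (-k) = u n k ∧ (Even k.1 → u n k = 0) :=
    ae_all_iff.2 fun n => mem_XSpace.1 (hu n)
  refine mem_XSpace.2 ?_
  filter_upwards [hns, ae_neg hns, hall] with k h1 h2 h3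
  refine ⟨tendsto_nhds_unique (h2.congr fun i => (h3 _).1) h1, fun hk => ?_⟩
  exact tendsto_nhds_unique h1 (tendsto_const_nhds.congr fun i => ((h3 _).2 hk).symm)

instance (s : ℝ) : CompleteSpace (XSpace s) := (isClosed_XSpace s).completeSpace_coe

section ReversibleSpace

variable {s : ℝ}

/-- A representative with the symmetries holding everywhere. -/
noncomputable def rep (f : XSpace s) (k : ℤ × ℝ) : ℝ :=
  if Even k.1 then 0 else ((f : Lp ℝ 2 (nu s)) k + (f : Lp ℝ 2 (nu s)) (-k)) / 2

lemma rep_ae (f : XSpace s) : rep f =ᵐ[lam] (f : Lp ℝ 2 (nu s)) := by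
  filter_upwards [mem_XSpace.1 f.2] with k hk
  unfold rep
  split_ifs with h
  · exact (hk.2 h).symm
  · rw [hk.1]; ring

lemma measurable_rep (f : XSpace s) : Measurable (rep f) := by
  have h := (Lp.stronglyMeasurable (f : Lp ℝ 2 (nu s))).measurable
  refine Measurable.ite ?_ measurable_const ((h.add (h.comp measurable_neg)).div_const 2)
  exact measurable_fst (MeasurableSet.of_discrete (s := {p : ℤ | Even p}))

lemma enorm_XSpace (f : XSpace s) : ‖f‖ₑ = (wmass s fun k => ‖rep f k‖ₑ) ^ (1 / 2 : ℝ) := by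
  rw [← eLpNorm_nu, eLpNorm_congr_ae (g := (f : Lp ℝ 2 (nu s))) (by
    rw [Filter.EventuallyEq, ae_nu]; exact rep_ae f), ← Lp.enorm_def]
  rfl

lemma enorm_sq_XSpace (f : XSpace s) : ‖f‖ₑ ^ 2 = wmass s fun k => ‖rep f k‖ₑ := by
  rw [enorm_XSpace, rpow_half_sq]

lemma good_rep (f : XSpace s) : Good s (rep f) where
  meas := measurable_rep f
  even k := by simp [rep, add_comm]
  supp k hk := by simp [rep, hk]
  fin := by
    rw [← enorm_sq_XSpace]
    exact ENNReal.pow_lt_top enorm_lt_top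

lemma Good.memLp {φ : ℤ × ℝ → ℝ} (h : Good s φ) : MemLp φ 2 (nu s) := by
  refine ⟨h.meas.aestronglyMeasurable, ?_⟩
  rw [eLpNorm_nu]
  exact ENNReal.rpow_lt_top_of_nonneg (by norm_num) h.fin.ne

/-- The element of the space with a given density. -/
noncomputable def Good.toX {φ : ℤ × ℝ → ℝ} (h : Good s φ) : XSpace s :=
  ⟨h.memLp.toLp φ, by
    have h1 := h.memLp.coeFn_toLp
    rw [Filter.EventuallyEq, ae_nu] at h1
    refine mem_XSpace.2 ?_
    filter_upwards [h1, ae_neg h1] with k h2 h3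
    rw [h2, h3]
    exact ⟨h.even k, h.supp k⟩⟩

lemma rep_toX {φ : ℤ × ℝ → ℝ} (h : Good s φ) : rep h.toX =ᵐ[lam] φ := by
  have h1 := h.memLp.coeFn_toLp
  rw [Filter.EventuallyEq, ae_nu] at h1
  exact (rep_ae _).trans h1

lemma XSpace_ext {f g : XSpace s} (h : rep f =ᵐ[lam] rep g) : f = g := by
  refine Subtype.ext (Lp.ext ?_)
  rw [Filter.EventuallyEq, ae_nu]
  exact ((rep_ae f).symm.trans h).trans (rep_ae g)

lemma rep_add (f g : XSpace s) : rep (f + g) =ᵐ[lam] fun k => rep f k + rep g k := by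
  have h := Lp.coeFn_add (f : Lp ℝ 2 (nu s)) g
  rw [Filter.EventuallyEq, ae_nu] at h
  filter_upwards [h, rep_ae f, rep_ae g, rep_ae (f + g)] with k h1 h2 h3 h4
  rw [h4, h2, h3, Submodule.coe_add, h1, Pi.add_apply]

lemma rep_smul (c : ℝ) (f : XSpace s) : rep (c • f) =ᵐ[lam] fun k => c * rep f k := by
  have h := Lp.coeFn_smul c (f : Lp ℝ 2 (nu s))
  rw [Filter.EventuallyEq, ae_nu] at h
  filter_upwards [h, rep_ae f, rep_ae (c • f)] with k h1 h2 h4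
  rw [h4, h2, Submodule.coe_smul, h1, Pi.smul_apply, smul_eq_mul]

lemma rep_sub (f g : XSpace s) : rep (f - g) =ᵐ[lam] fun k => rep f k - rep g k := by
  have h := rep_smul (-1) g
  rw [show f - g = f + (-1 : ℝ) • g by module]
  filter_upwards [h, rep_add f ((-1 : ℝ) • g)] with k h1 h2
  rw [h2, h1]; ring

lemma rep_zero : rep (0 : XSpace s) =ᵐ[lam] fun _ => 0 := by
  have h := rep_smul 0 (0 : XSpace s)
  simpa using h

lemma wmass_congr {f g : ℤ × ℝ → ℝ≥0∞} (h : f =ᵐ[lam] g) : wmass s f = wmass s g :=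
  lintegral_congr_ae (by filter_upwards [h] with k hk; rw [hk])

/-! ### Bounded multipliers and the trilinear operators -/

/-- Bounded even Fourier multipliers. -/
structure IsMultiplier (M : ℤ × ℝ → ℝ) : Prop where
  meas : Measurable M
  bound : ∀ k, |M k| ≤ 1
  even : ∀ k, M (-k) = M k

lemma wmass_multiplier_le {M : ℤ × ℝ → ℝ} (hM : IsMultiplier M) (φ : ℤ × ℝ → ℝ) :
    wmass s (fun k => ‖M k * φ k‖ₑ) ≤ wmass s (fun k => ‖φ k‖ₑ) :=
  wmass_mono fun k => by
    rw [enorm_mul]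
    refine mul_le_of_le_one_left' ?_
    rw [← ofReal_norm, ENNReal.ofReal_le_one]
    exact hM.bound k

lemma Good.mul {M : ℤ × ℝ → ℝ} (hM : IsMultiplier M) {φ : ℤ × ℝ → ℝ} (h : Good s φ) :
    Good s (fun k => M k * φ k) where
  meas := hM.meas.mul h.meas
  even k := by rw [hM.even, h.even]
  supp k hk := by rw [h.supp k hk, mul_zero]
  fin := (wmass_multiplier_le hM φ).trans_lt h.fin

lemma exists_continuous_trilinear {E : Type*} [NormedAddCommGroup E] [NormedSpace ℝ E]
    (T : E → E → E → E) (hadd₁ : ∀ f f' g h, T (f + f') g h = T f g h + T f' g h)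
    (hadd₂ : ∀ f g g' h, T f (g + g') h = T f g h + T f g' h)
    (hadd₃ : ∀ f g h h', T f g (h + h') = T f g h + T f g h')
    (hsmul₁ : ∀ (c : ℝ) f g h, T (c • f) g h = c • T f g h)
    (hsmul₂ : ∀ (c : ℝ) f g h, T f (c • g) h = c • T f g h)
    (hsmul₃ : ∀ (c : ℝ) f g h, T f g (c • h) = c • T f g h)
    (C : ℝ) (hC : 0 ≤ C) (hbound : ∀ f g h, ‖T f g h‖ ≤ C * ‖f‖ * ‖g‖ * ‖h‖) :
    ∃ B : E →L[ℝ] E →L[ℝ] E →L[ℝ] E, ∀ f g h, B f g h = T f g h := by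
  let L (f : E) : E →ₗ[ℝ] E →ₗ[ℝ] E :=
    LinearMap.mk₂ ℝ (T f) (hadd₂ f) (fun c g h => hsmul₂ c f g h) (hadd₃ f)
      (fun c g h => hsmul₃ c f g h)
  let B (f : E) : E →L[ℝ] E →L[ℝ] E := (L f).mkContinuous₂ (C * ‖f‖) (hbound f)
  have hB : ∀ f g h, B f g h = T f g h := fun f g h => rfl
  let A : E →ₗ[ℝ] E →L[ℝ] E →L[ℝ] E :=
    { toFun := B
      map_add' := fun f f' => by ext g h; simp [hB, hadd₁]
      map_smul' := fun c f => by ext g h; simp [hB, hsmul₁] }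
  have hA : ∀ f, ‖A f‖ ≤ C * ‖f‖ := fun f =>
    LinearMap.mkContinuous₂_norm_le _ (by positivity) (hbound f)
  exact ⟨⟨A, AddMonoidHomClass.continuous_of_bound A C hA⟩, hB⟩

/-- Multilinearity is inherited from the integral almost everywhere, and boundedness from the
algebra property. The square root in the constant appears because `wmass` is the square of the norm.
-/
theorem exists_triOp (hs : 1 < s) {m : ℤ → ℤ → ℝ} (hm : IsSymbol m) {M : ℤ × ℝ → ℝ}
    (hM : IsMultiplier M) :
    ∃ B : XSpace s →L[ℝ] XSpace s →L[ℝ] XSpace s →L[ℝ] XSpace s, ∀ f g h,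
      rep (B f g h) =ᵐ[lam] fun k => M k * tri m (rep f) (rep g) (rep h) k := by
  have hG (f g h : XSpace s) :=
    ((good_rep f).tri hs hm (good_rep g) (good_rep h)).mul hM
  set T : XSpace s → XSpace s → XSpace s → XSpace s := fun f g h => (hG f g h).toX with hT
  have hTr (f g h : XSpace s) := rep_toX (hG f g h)
  have hI (f g h : XSpace s) :=
    ae_integrable_tri hs hm (good_rep f) (good_rep g) (good_rep h)
  refine (exists_continuous_trilinear T ?_ ?_ ?_ ?_ ?_ ?_ (Real.sqrt (algConst s).toReal)
    (Real.sqrt_nonneg _) ?_).imp fun B hB f g h => by rw [hB]; exact hTr f g h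
  · intro f f' g h
    refine XSpace_ext ?_
    filter_upwards [hTr (f + f') g h, hTr f g h, hTr f' g h, rep_add (T f g h) (T f' g h),
      hI f g h, hI f' g h] with k h1 h2 h3 h4 h5 h6
    rw [h1, h4, h2, h3, ← mul_add, tri_congr_ae m (rep_add f f') (ae_eq_refl _) (ae_eq_refl _)]
    congr 1
    unfold tri
    rw [← integral_add h5 h6]
    congr 1; ext kk; ring
  · intro f g g' h
    refine XSpace_ext ?_
    filter_upwards [hTr f (g + g') h, hTr f g h, hTr f g' h, rep_add (T f g h) (T f g' h),
      hI f g h, hI f g' h] with k h1 h2 h3 h4 h5 h6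
    rw [h1, h4, h2, h3, ← mul_add, tri_congr_ae m (ae_eq_refl _) (rep_add g g') (ae_eq_refl _)]
    congr 1
    unfold tri
    rw [← integral_add h5 h6]
    congr 1; ext kk; ring
  · intro f g h h'
    refine XSpace_ext ?_
    filter_upwards [hTr f g (h + h'), hTr f g h, hTr f g h', rep_add (T f g h) (T f g h'),
      hI f g h, hI f g h'] with k h1 h2 h3 h4 h5 h6
    rw [h1, h4, h2, h3, ← mul_add, tri_congr_ae m (ae_eq_refl _) (ae_eq_refl _) (rep_add h h')]
    congr 1
    unfold tri
    rw [← integral_add h5 h6]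
    congr 1; ext kk; ring
  · intro c f g h
    refine XSpace_ext ?_
    filter_upwards [hTr (c • f) g h, hTr f g h, rep_smul c (T f g h)] with k h1 h2 h4
    rw [h1, h4, h2, tri_congr_ae m (rep_smul c f) (ae_eq_refl _) (ae_eq_refl _), mul_left_comm]
    congr 1
    unfold tri
    rw [← integral_const_mul]
    congr 1; ext kk; ring
  · intro c f g h
    refine XSpace_ext ?_
    filter_upwards [hTr f (c • g) h, hTr f g h, rep_smul c (T f g h)] with k h1 h2 h4
    rw [h1, h4, h2, tri_congr_ae m (ae_eq_refl _) (rep_smul c g) (ae_eq_refl _), mul_left_comm]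
    congr 1
    unfold tri
    rw [← integral_const_mul]
    congr 1; ext kk; ring
  · intro c f g h
    refine XSpace_ext ?_
    filter_upwards [hTr f g (c • h), hTr f g h, rep_smul c (T f g h)] with k h1 h2 h4
    rw [h1, h4, h2, tri_congr_ae m (ae_eq_refl _) (ae_eq_refl _) (rep_smul c h), mul_left_comm]
    congr 1
    unfold tri
    rw [← integral_const_mul]
    congr 1; ext kk; ring
  · intro f g h
    have h1 : ‖T f g h‖ₑ ^ 2 ≤ algConst s * (‖f‖ₑ ^ 2 * ‖g‖ₑ ^ 2 * ‖h‖ₑ ^ 2) := by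
      simp only [enorm_sq_XSpace]
      rw [wmass_congr (g := fun k => ‖M k * tri m (rep f) (rep g) (rep h) k‖ₑ)
        (by filter_upwards [hTr f g h] with k hk; rw [hk])]
      exact (wmass_multiplier_le hM _).trans
        (wmass_tri_le hs hm (good_rep f) (good_rep g) (good_rep h))
    have hc := algConst_lt_top hs
    have h2 := ENNReal.toReal_mono (ENNReal.mul_ne_top hc.ne (ENNReal.mul_ne_top
      (ENNReal.mul_ne_top (ENNReal.pow_ne_top enorm_ne_top) (ENNReal.pow_ne_top enorm_ne_top))
      (ENNReal.pow_ne_top enorm_ne_top))) h1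
    simp only [ENNReal.toReal_mul, ENNReal.toReal_pow, toReal_enorm] at h2
    refine abs_le_of_sq_le_sq' ?_ (by positivity) |>.2
    calc _ ≤ _ := h2
      _ = _ := by rw [mul_pow, mul_pow, mul_pow, Real.sq_sqrt ENNReal.toReal_nonneg]; ring

end ReversibleSpace

/-! ### Mode functions of densities -/

lemma ae_slice {P : ℤ × ℝ → Prop} (h : ∀ᵐ k ∂lam, P k) (p : ℤ) : ∀ᵐ η : ℝ, P (p, η) :=
  Measure.ae_count_iff.1 (Measure.ae_ae_of_ae_prod h) p

lemma ae_of_slice {P : ℤ × ℝ → Prop} (h : ∀ p : ℤ, ∀ᵐ η : ℝ, P (p, η)) : ∀ᵐ k ∂lam, P k := by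
  have hsub : {k : ℤ × ℝ | ¬ P k} ⊆ ⋃ p : ℤ, {p} ×ˢ {η : ℝ | ¬ P (p, η)} := fun k hk =>
    Set.mem_iUnion.2 ⟨k.1, rfl, hk⟩
  refine measure_mono_null hsub (measure_iUnion_null fun p => ?_)
  rw [lam, Measure.prod_prod, show volume {η : ℝ | ¬ P (p, η)} = 0 from h p, mul_zero]

lemma integrable_slice {E : Type*} [NormedAddCommGroup E] {φ : ℤ × ℝ → E}
    (h : Integrable φ lam) (p : ℤ) : Integrable fun η : ℝ => φ (p, η) :=
  Measure.ae_count_iff.1 h.prod_right_ae p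

lemma integral_lam {E : Type*} [NormedAddCommGroup E] [NormedSpace ℝ E] [CompleteSpace E]
    {φ : ℤ × ℝ → E} (h : Integrable φ lam) : ∫ k, φ k ∂lam = ∑' p : ℤ, ∫ η : ℝ, φ (p, η) := by
  unfold lam at *
  rw [integral_prod _ h, integral_countable h.integral_prod_left]
  simp

lemma summable_slice {φ : ℤ × ℝ → ℝ} (h : Integrable φ lam) :
    Summable fun p : ℤ => ∫ η : ℝ, ‖φ (p, η)‖ := by
  unfold lam at h
  refine (integrable_count_iff.1 h.integral_norm_prod_left).congr fun p => ?_
  exact Real.norm_of_nonneg (integral_nonneg fun _ => norm_nonneg _)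

/-- The mode functions with given Fourier densities. -/
noncomputable def phys (φ : ℤ × ℝ → ℝ) (p : ℤ) (x : ℝ) : ℂ :=
  𝓕⁻ (fun η : ℝ => (φ (p, η) : ℂ)) x

/-- The character `t ↦ e^{2πit}`. -/
noncomputable def wave (t : ℝ) : ℂ := Complex.exp ((2 * Real.pi * t : ℝ) * Complex.I)

lemma norm_wave (t : ℝ) : ‖wave t‖ = 1 := Complex.norm_exp_ofReal_mul_I _

lemma continuous_wave : Continuous wave := by
  unfold wave
  fun_prop

lemma wave_add (a b : ℝ) : wave (a + b) = wave a * wave b := by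
  rw [wave, wave, wave, ← Complex.exp_add]
  congr 1; push_cast; ring

lemma conj_wave (t : ℝ) : conj (wave t) = wave (-t) := by
  rw [wave, wave, ← Complex.exp_conj]
  congr 1
  rw [map_mul, Complex.conj_ofReal, Complex.conj_I]
  push_cast; ring

lemma phys_eq (φ : ℤ × ℝ → ℝ) (p : ℤ) (x : ℝ) :
    phys φ p x = ∫ η : ℝ, wave (η * x) * φ (p, η) := by
  rw [phys, Real.fourierInv_eq']
  simp [wave, mul_comm x]

lemma phys_congr {φ φ' : ℤ × ℝ → ℝ} (h : φ =ᵐ[lam] φ') : phys φ = phys φ' := by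
  ext p x
  refine Real.fourierInv_congr_ae ?_ x
  filter_upwards [ae_slice h p] with η hη
  rw [hη]

lemma norm_phys_le (φ : ℤ × ℝ → ℝ) (p : ℤ) (x : ℝ) : ‖phys φ p x‖ ≤ ∫ η : ℝ, ‖φ (p, η)‖ := by
  refine (norm_fourierInv_le _ x).trans (le_of_eq ?_)
  simp

lemma continuous_phys {φ : ℤ × ℝ → ℝ} (h : Integrable φ lam) (p : ℤ) : Continuous (phys φ p) :=
  continuous_fourierInv (integrable_slice h p).ofReal

/-- Real densities: conjugation acts only on the wave and reverses it. This is the reversibility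
symmetry. -/
lemma phys_conj (φ : ℤ × ℝ → ℝ) (p : ℤ) (x : ℝ) : conj (phys φ p x) = phys φ p (-x) := by
  rw [phys_eq, phys_eq, ← integral_conj]
  refine integral_congr_ae (Filter.Eventually.of_forall fun η => ?_)
  simp [conj_wave]

lemma phys_neg {φ : ℤ × ℝ → ℝ} (h : ∀ k, φ (-k) = φ k) (p : ℤ) (x : ℝ) :
    phys φ (-p) x = conj (phys φ p x) := by
  rw [phys_conj, phys_eq, phys_eq, ← integral_neg_eq_self]
  refine integral_congr_ae (Filter.Eventually.of_forall fun η => ?_)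
  have := h (p, η)
  simp only [Prod.neg_mk] at this
  simp [this]

lemma phys_even {s : ℝ} {φ : ℤ × ℝ → ℝ} (h : Good s φ) {p : ℤ} (hp : Even p) (x : ℝ) :
    phys φ p x = 0 := by
  rw [phys_eq]
  simp [h.supp (p, _) hp]

lemma phys_injective {φ φ' : ℤ × ℝ → ℝ} (h : Integrable φ lam) (h' : Integrable φ' lam)
    (he : ∀ p x, phys φ p x = phys φ' p x) : φ =ᵐ[lam] φ' := by
  refine ae_of_slice fun p => ?_
  filter_upwards [fourierInv_injective (integrable_slice h p).ofReal
    (integrable_slice h' p).ofReal (he p)] with η hη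
  exact_mod_cast hη

lemma phys_add {φ φ' : ℤ × ℝ → ℝ} (h : Integrable φ lam) (h' : Integrable φ' lam) (p : ℤ)
    (x : ℝ) : phys (fun k => φ k + φ' k) p x = phys φ p x + phys φ' p x := by
  simp only [phys_eq]
  have hi (φ : ℤ × ℝ → ℝ) (h : Integrable φ lam) :
      Integrable fun η : ℝ => wave (η * x) * φ (p, η) := by
    refine (integrable_slice h p).ofReal.bdd_mul (c := 1) ?_ ?_
    · exact (continuous_wave.comp (by fun_prop) : Continuous fun η : ℝ =>
        wave (η * x)).aestronglyMeasurable
    · exact Filter.Eventually.of_forall fun η => (norm_wave _).le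
  rw [← integral_add (hi φ h) (hi φ' h')]
  congr 1; ext η; push_cast; ring

lemma phys_const_mul (c : ℝ) (φ : ℤ × ℝ → ℝ) (p : ℤ) (x : ℝ) :
    phys (fun k => c * φ k) p x = c * phys φ p x := by
  simp only [phys_eq]
  rw [← integral_const_mul]
  congr 1; ext η; push_cast; ring

lemma summable_phys {φ : ℤ × ℝ → ℝ} (h : Integrable φ lam) (x : ℝ) :
    Summable fun p => ‖phys φ p x‖ :=
  Summable.of_nonneg_of_le (fun _ => norm_nonneg _) (fun p => norm_phys_le φ p x)
    (summable_slice h)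

lemma norm_phys_le_integral {φ : ℤ × ℝ → ℝ} (h : Integrable φ lam) (p : ℤ) (x : ℝ) :
    ‖phys φ p x‖ ≤ ∫ k, ‖φ k‖ ∂lam := by
  rw [integral_lam h.norm]
  exact (norm_phys_le φ p x).trans ((summable_slice h).le_tsum p
    fun _ _ => integral_nonneg fun _ => norm_nonneg _)

lemma summable_phys_triple {m : ℤ → ℤ → ℝ} (hm : IsSymbol m) {f g h : ℤ × ℝ → ℝ}
    (hf : Integrable f lam) (hg : Integrable g lam) (hh : Integrable h lam) (p : ℤ) (x : ℝ) :
    Summable fun z : ℤ × ℤ =>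
      (m z.1 z.2 : ℂ) * phys f z.1 x * phys g z.2 x * phys h (p - z.1 - z.2) x := by
  have h1 := ((summable_phys hf x).mul_of_nonneg (summable_phys hg x)
    (fun _ => norm_nonneg _) (fun _ => norm_nonneg _)).mul_right (∫ k, ‖h k‖ ∂lam)
  refine Summable.of_norm_bounded h1 fun z => ?_
  simp only [norm_mul, Complex.norm_real]
  have := hm.bound z.1 z.2
  gcongr
  · exact mul_le_of_le_one_left (norm_nonneg _) this
  · exact norm_phys_le_integral hh _ _

lemma integrable_fourierChar_mul {φ : ℤ × ℝ → ℝ} (h : Integrable φ lam) (x : ℝ) :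
    Integrable (fun k : ℤ × ℝ => wave (k.2 * x) * φ k) lam := by
  refine h.ofReal.bdd_mul (c := 1) ?_ (Filter.Eventually.of_forall fun k => (norm_wave _).le)
  exact (continuous_wave.comp (by fun_prop) : Continuous fun k : ℤ × ℝ =>
    wave (k.2 * x)).aestronglyMeasurable

/-- The Tonelli bound that justifies exchanging the inverse Fourier integral with the convolution.
Integrating over `η` first sees only one slice of `h`, whose mass is at most the total mass. -/
lemma phys_tri_integrable {m : ℤ → ℤ → ℝ} (hm : IsSymbol m) {f g h : ℤ × ℝ → ℝ}
    (hfm : Measurable f) (hgm : Measurable g) (hhm : Measurable h)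
    (hf : Integrable f lam) (hg : Integrable g lam) (hh : Integrable h lam) (p : ℤ) (x : ℝ) :
    Integrable (fun z : ℝ × ((ℤ × ℝ) × (ℤ × ℝ)) => wave (z.1 * x) *
      ((m z.2.1.1 z.2.2.1 * f z.2.1 * g z.2.2 * h ((p, z.1) - z.2.1 - z.2.2) : ℝ) : ℂ))
      (volume.prod (lam.prod lam)) := by
  have hmm := measurable_symbol m
  have hmeas : Measurable fun z : ℝ × ((ℤ × ℝ) × (ℤ × ℝ)) =>
      m z.2.1.1 z.2.2.1 * f z.2.1 * g z.2.2 * h ((p, z.1) - z.2.1 - z.2.2) := by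
    have h1 : Measurable fun z : ℝ × ((ℤ × ℝ) × (ℤ × ℝ)) => m z.2.1.1 z.2.2.1 :=
      hmm.comp measurable_snd
    have h2 : Measurable fun z : ℝ × ((ℤ × ℝ) × (ℤ × ℝ)) => h ((p, z.1) - z.2.1 - z.2.2) :=
      hhm.comp (by fun_prop)
    fun_prop
  have hint : Integrable (fun z : ℝ × ((ℤ × ℝ) × (ℤ × ℝ)) =>
      m z.2.1.1 z.2.2.1 * f z.2.1 * g z.2.2 * h ((p, z.1) - z.2.1 - z.2.2))
      (volume.prod (lam.prod lam)) := by
    refine ⟨hmeas.aestronglyMeasurable, ?_⟩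
    rw [HasFiniteIntegral, lintegral_prod_symm _ hmeas.enorm.aemeasurable]
    have hb : ∀ kk : (ℤ × ℝ) × (ℤ × ℝ), ∫⁻ η : ℝ,
        ‖m kk.1.1 kk.2.1 * f kk.1 * g kk.2 * h ((p, η) - kk.1 - kk.2)‖ₑ
        ≤ ‖f kk.1‖ₑ * ‖g kk.2‖ₑ * ∫⁻ k, ‖h k‖ₑ ∂lam := fun kk => by
      refine (lintegral_mono fun η => enorm_tri_integrand_le hm f g h (p, η) kk).trans ?_
      rw [lintegral_const_mul _ (by fun_prop)]
      gcongr
      have e : ∫⁻ η : ℝ, ‖h ((p, η) - kk.1 - kk.2)‖ₑ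
          = ∫⁻ η : ℝ, ‖h (p - kk.1.1 - kk.2.1, η)‖ₑ := by
        rw [← lintegral_sub_right_eq_self (fun η => ‖h (p - kk.1.1 - kk.2.1, η)‖ₑ)
          (kk.1.2 + kk.2.2)]
        refine lintegral_congr fun η => ?_
        congr 2
        ext <;> (simp; try ring)
      rw [e]
      unfold lam
      rw [lintegral_prod _ hhm.enorm.aemeasurable, lintegral_count]
      exact ENNReal.le_tsum (f := fun q : ℤ => ∫⁻ η : ℝ, ‖h (q, η)‖ₑ) _
    refine (lintegral_mono hb).trans_lt ?_
    rw [lintegral_mul_const _ (by fun_prop), lintegral_prod_mul (f := fun k => ‖f k‖ₑ)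
      (g := fun k => ‖g k‖ₑ) (by fun_prop) (by fun_prop)]
    exact ENNReal.mul_lt_top (ENNReal.mul_lt_top hf.2 hg.2) hh.2
  refine hint.ofReal.bdd_mul (c := 1) ?_ (Filter.Eventually.of_forall fun k => (norm_wave _).le)
  exact (continuous_wave.comp (by fun_prop) : Continuous fun z : ℝ × ((ℤ × ℝ) × (ℤ × ℝ)) =>
    wave (z.1 * x)).aestronglyMeasurable

lemma integral_fourierChar_shift (h : ℤ × ℝ → ℝ) (p : ℤ) (x : ℝ) (a b : ℤ × ℝ) :
    ∫ η : ℝ, wave (η * x) * h ((p, η) - a - b)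
      = wave (a.2 * x) * wave (b.2 * x)
        * phys h (p - a.1 - b.1) x := by
  rw [phys_eq, ← integral_const_mul, ← integral_sub_right_eq_self
    (fun η => wave (a.2 * x) * wave (b.2 * x) * (wave (η * x) * h (p - a.1 - b.1, η))) (a.2 + b.2)]
  refine integral_congr_ae (Filter.Eventually.of_forall fun η => ?_)
  dsimp only
  rw [show η * x = a.2 * x + (b.2 * x + (η - (a.2 + b.2)) * x) by ring, wave_add, wave_add,
    show ((p, η) : ℤ × ℝ) - a - b = (p - a.1 - b.1, η - (a.2 + b.2)) by
      ext <;> (simp; try ring)]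
  ring

/-- The mode functions of a trilinear convolution are sums of products of mode functions. -/
theorem phys_tri_iterated {s : ℝ} (hs : 1 < s) {m : ℤ → ℤ → ℝ} (hm : IsSymbol m)
    {f g h : ℤ × ℝ → ℝ} (hf : Good s f) (hg : Good s g) (hh : Good s h) (p : ℤ) (x : ℝ) :
    phys (tri m f g h) p x = ∑' q : ℤ, phys f q x *
      ∑' r : ℤ, phys g r x * ((m q r : ℂ) * phys h (p - q - r) x) := by
  have hfi := hf.integrable hs
  have hgi := hg.integrable hs
  have hhi := hh.integrable hs
  have hI := phys_tri_integrable hm hf.meas hg.meas hh.meas hfi hgi hhi p x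
  have hfx := integrable_fourierChar_mul hfi x
  have hgx := integrable_fourierChar_mul hgi x
  have e1 : phys (tri m f g h) p x = ∫ η : ℝ, ∫ kk, wave (η * x) *
      ((m kk.1.1 kk.2.1 * f kk.1 * g kk.2 * h ((p, η) - kk.1 - kk.2) : ℝ) : ℂ)
      ∂(lam.prod lam) := by
    rw [phys_eq]
    refine integral_congr_ae (Filter.Eventually.of_forall fun η => ?_)
    dsimp only
    rw [tri, ← integral_complex_ofReal, ← integral_const_mul]
  have e2 : ∀ kk : (ℤ × ℝ) × (ℤ × ℝ), ∫ η : ℝ, wave (η * x) *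
      ((m kk.1.1 kk.2.1 * f kk.1 * g kk.2 * h ((p, η) - kk.1 - kk.2) : ℝ) : ℂ)
      = (wave (kk.1.2 * x) * f kk.1) *
        ((wave (kk.2.2 * x) * g kk.2) *
          ((m kk.1.1 kk.2.1 : ℂ) * phys h (p - kk.1.1 - kk.2.1) x)) := fun kk => by
    have := integral_fourierChar_shift h p x kk.1 kk.2
    calc _ = ∫ η : ℝ, ((m kk.1.1 kk.2.1 : ℂ) * f kk.1 * g kk.2) *
          (wave (η * x) * h ((p, η) - kk.1 - kk.2)) := by
          congr 1; ext η; push_cast; ring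
      _ = _ := by rw [integral_const_mul, this]; ring
  have hI2 := hI.integral_prod_right
  rw [e1, integral_integral_swap hI]
  simp only [e2] at hI2 ⊢
  rw [integral_prod _ hI2]
  have hin : ∀ q : ℤ, Integrable (fun k : ℤ × ℝ => (wave (k.2 * x) * g k) *
      ((m q k.1 : ℂ) * phys h (p - q - k.1) x)) lam := fun q => by
    refine hgx.mul_bdd (c := ∫ k, ‖h k‖ ∂lam) ?_ (Filter.Eventually.of_forall fun k => ?_)
    · have : Measurable fun r : ℤ => (m q r : ℂ) * phys h (p - q - r) x :=
        measurable_of_countable _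
      exact (this.comp measurable_fst).aestronglyMeasurable
    · rw [norm_mul, Complex.norm_real]
      exact (mul_le_of_le_one_left (norm_nonneg _) (hm.bound q k.1)).trans
        (norm_phys_le_integral hhi _ _)
  have e3 : ∀ a : ℤ × ℝ, ∫ b, (wave (a.2 * x) * f a) *
        ((wave (b.2 * x) * g b) *
          ((m a.1 b.1 : ℂ) * phys h (p - a.1 - b.1) x)) ∂lam
      = (wave (a.2 * x) * f a) *
        ∑' r : ℤ, phys g r x * ((m a.1 r : ℂ) * phys h (p - a.1 - r) x) := fun a => by
    rw [integral_const_mul, integral_lam (hin a.1)]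
    congr 1
    refine tsum_congr fun r => ?_
    dsimp only
    rw [integral_mul_const, phys_eq g]
  have hI3 := hI2.integral_prod_left
  simp only [e3] at hI3 ⊢
  rw [integral_lam hI3]
  refine tsum_congr fun q => ?_
  dsimp only
  rw [integral_mul_const, phys_eq f]

/-- Absolute summability merges the iterated sum into a sum over pairs. -/
theorem phys_tri {s : ℝ} (hs : 1 < s) {m : ℤ → ℤ → ℝ} (hm : IsSymbol m)
    {f g h : ℤ × ℝ → ℝ} (hf : Good s f) (hg : Good s g) (hh : Good s h) (p : ℤ) (x : ℝ) :
    phys (tri m f g h) p x = ∑' z : ℤ × ℤ,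
      (m z.1 z.2 : ℂ) * phys f z.1 x * phys g z.2 x * phys h (p - z.1 - z.2) x := by
  rw [phys_tri_iterated hs hm hf hg hh, (summable_phys_triple hm (hf.integrable hs)
    (hg.integrable hs) (hh.integrable hs) p x).tsum_prod]
  refine tsum_congr fun q => ?_
  rw [← tsum_mul_left]
  refine tsum_congr fun r => ?_
  ring

/-! ### The cubic nonlinearity and its derivative as convolutions. -/

/-- The symbol selecting opposite frequencies. -/
def oppSymbol (q r : ℤ) : ℝ := if r = -q then 1 else 0

lemma isSymbol_opp : IsSymbol oppSymbol where
  bound q r := by unfold oppSymbol; split_ifs <;> simp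
  even q r := by
    unfold oppSymbol
    congr 1
    simp only [eq_iff_iff]
    omega

lemma isSymbol_one : IsSymbol fun _ _ => 1 := ⟨by simp, by simp⟩

/-- Only `r = -q` survives in the inner sum, and then `p - q - r = p`. This is why the iterated form
of the sum is kept. -/
theorem phys_tri_opp {s : ℝ} (hs : 1 < s) {f g h : ℤ × ℝ → ℝ} (hf : Good s f) (hg : Good s g)
    (hh : Good s h) (p : ℤ) (x : ℝ) :
    phys (tri oppSymbol f g h) p x = (∑' q : ℤ, phys f q x * phys g (-q) x) * phys h p x := by
  rw [phys_tri_iterated hs isSymbol_opp hf hg hh, ← tsum_mul_right]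
  refine tsum_congr fun q => ?_
  rw [tsum_eq_single (-q) (fun r hr => by simp [oppSymbol, hr])]
  simp [oppSymbol, mul_assoc]

lemma tsum_odd {F : ℤ → ℂ} (h : ∀ q, Even q → F q = 0) : ∑' q : OddInt, F q = ∑' q : ℤ, F q := by
  refine Function.Injective.tsum_eq Subtype.val_injective fun q hq => ?_
  refine ⟨⟨q, Int.not_even_iff_odd.1 fun he => hq (h q he)⟩, rfl⟩

lemma tsum_odd_prod {F : ℤ × ℤ → ℂ} (h : ∀ z : ℤ × ℤ, Even z.1 ∨ Even z.2 → F z = 0) :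
    ∑' z : OddInt × OddInt, F (z.1, z.2) = ∑' z : ℤ × ℤ, F z := by
  refine Function.Injective.tsum_eq (g := fun z : OddInt × OddInt => ((z.1 : ℤ), (z.2 : ℤ)))
    (f := F) (fun a b hab => ?_) fun z hz => ?_
  · simp only [Prod.mk.injEq] at hab
    exact Prod.ext (Subtype.ext hab.1) (Subtype.ext hab.2)
  · refine ⟨(⟨z.1, Int.not_even_iff_odd.1 fun he => hz (h z (Or.inl he))⟩,
      ⟨z.2, Int.not_even_iff_odd.1 fun he => hz (h z (Or.inr he))⟩), rfl⟩

/-- Since `b_{-q}` is the conjugate of `b_q`, the squared modulus is the product `b_q b_{-q}`, which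
is polynomial in the modes. -/
lemma tsum_norm_sq_phys {s : ℝ} {b : ℤ × ℝ → ℝ} (hb : Good s b) (x : ℝ) :
    (((∑' q : OddInt, (‖phys b q x‖ ^ 2 : ℝ) : ℝ)) : ℂ)
      = ∑' q : ℤ, phys b q x * phys b (-q) x := by
  rw [Complex.ofReal_tsum, ← tsum_odd (fun q hq => by rw [phys_even hb hq, zero_mul])]
  refine tsum_congr fun q => ?_
  rw [phys_neg hb.even, Complex.mul_conj']
  push_cast; rfl

lemma tsum_phys_triple_odd {s : ℝ} {f g : ℤ × ℝ → ℝ} (hf : Good s f) (hg : Good s g)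
    (h : ℤ × ℝ → ℝ) (p : ℤ) (x : ℝ) :
    ∑' z : OddInt × OddInt, phys f z.1 x * phys g z.2 x * phys h (p - z.1 - z.2) x
      = ∑' z : ℤ × ℤ, phys f z.1 x * phys g z.2 x * phys h (p - z.1 - z.2) x := by
  refine tsum_odd_prod (F := fun z : ℤ × ℤ => phys f z.1 x * phys g z.2 x *
    phys h (p - z.1 - z.2) x) fun z hz => ?_
  rcases hz with hz | hz
  · simp [phys_even hf hz]
  · simp [phys_even hg hz]

/-- The density of the cubic nonlinearity. -/
noncomputable def cubDensity (a b : ℤ × ℝ → ℝ) (k : ℤ × ℝ) : ℝ :=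
  3 * tri oppSymbol b b a k + tri (fun _ _ => 1) a a a k

/-- The density of the derivative of the cubic nonlinearity. -/
noncomputable def cubDerivDensity (u w : ℤ × ℝ → ℝ) (k : ℤ × ℝ) : ℝ :=
  3 * (tri oppSymbol u u w k + (tri oppSymbol u w u k + tri oppSymbol w u u k))
    + (tri (fun _ _ => 1) u u w k + (tri (fun _ _ => 1) u w u k + tri (fun _ _ => 1) w u u k))

lemma Good.integrable_tri {s : ℝ} (hs : 1 < s) {m : ℤ → ℤ → ℝ} (hm : IsSymbol m)
    {f g h : ℤ × ℝ → ℝ} (hf : Good s f) (hg : Good s g) (hh : Good s h) :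
    Integrable (GapSoliton.tri m f g h) lam := (hf.tri hs hm hg hh).integrable hs

lemma integrable_cubDensity {s : ℝ} (hs : 1 < s) {a b : ℤ × ℝ → ℝ} (ha : Good s a)
    (hb : Good s b) : Integrable (cubDensity a b) lam :=
  ((hb.integrable_tri hs isSymbol_opp hb ha).const_mul 3).add
    (ha.integrable_tri hs isSymbol_one ha ha)

lemma integrable_cubDerivDensity {s : ℝ} (hs : 1 < s) {u w : ℤ × ℝ → ℝ} (hu : Good s u)
    (hw : Good s w) : Integrable (cubDerivDensity u w) lam :=
  (((hu.integrable_tri hs isSymbol_opp hu hw).add ((hu.integrable_tri hs isSymbol_opp hw hu).add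
    (hw.integrable_tri hs isSymbol_opp hu hu))).const_mul 3).add
    ((hu.integrable_tri hs isSymbol_one hu hw).add ((hu.integrable_tri hs isSymbol_one hw hu).add
    (hw.integrable_tri hs isSymbol_one hu hu)))

theorem cubic_phys {s : ℝ} (hs : 1 < s) {a b : ℤ × ℝ → ℝ} (ha : Good s a) (hb : Good s b)
    (p : ℤ) (x : ℝ) : cubic (phys a) (phys b) p x = phys (cubDensity a b) p x := by
  unfold cubDensity
  rw [phys_add ((hb.integrable_tri hs isSymbol_opp hb ha).const_mul 3)
    (ha.integrable_tri hs isSymbol_one ha ha), phys_const_mul, phys_tri_opp hs hb hb ha,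
    phys_tri hs isSymbol_one ha ha ha, cubic, tsum_norm_sq_phys hb, tsum_phys_triple_odd ha ha]
  push_cast
  simp only [one_mul]
  ring

/-- The involution `(q, r) ↦ (p - q - r, r)`. -/
def reflectFst (p : ℤ) : ℤ × ℤ ≃ ℤ × ℤ where
  toFun z := (p - z.1 - z.2, z.2)
  invFun z := (p - z.1 - z.2, z.2)
  left_inv z := by ext <;> (simp; try ring)
  right_inv z := by ext <;> (simp; try ring)

/-- The involution `(q, r) ↦ (q, p - q - r)`. -/
def reflectSnd (p : ℤ) : ℤ × ℤ ≃ ℤ × ℤ where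
  toFun z := (z.1, p - z.1 - z.2)
  invFun z := (z.1, p - z.1 - z.2)
  left_inv z := by ext <;> (simp; try ring)
  right_inv z := by ext <;> (simp; try ring)

/-- The three positions of `w` in the double sum give the same value after relabelling the
frequencies. The derivative of `|u_q|²` produces `u_q w_{-q}` and `w_q u_{-q}`, which are conjugate
to each other and add up to twice a real part. -/
theorem cubicDeriv_phys {s : ℝ} (hs : 1 < s) {u w : ℤ × ℝ → ℝ} (hu : Good s u) (hw : Good s w)
    (p : ℤ) (x : ℝ) :
    cubicDeriv (phys u) (phys w) p x = phys (cubDerivDensity u w) p x := by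
  have i1 := hu.integrable_tri hs isSymbol_opp hu hw
  have i2 := hu.integrable_tri hs isSymbol_opp hw hu
  have i3 := hw.integrable_tri hs isSymbol_opp hu hu
  have j1 := hu.integrable_tri hs isSymbol_one hu hw
  have j2 := hu.integrable_tri hs isSymbol_one hw hu
  have j3 := hw.integrable_tri hs isSymbol_one hu hu
  have i23 : Integrable (fun k => tri oppSymbol u w u k + tri oppSymbol w u u k) lam := i2.add i3
  have j23 : Integrable (fun k => tri (fun _ _ => 1) u w u k + tri (fun _ _ => 1) w u u k) lam :=
    j2.add j3
  have i123 : Integrable (fun k => 3 * (tri oppSymbol u u w k + (tri oppSymbol u w u k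
    + tri oppSymbol w u u k))) lam := (i1.add i23).const_mul 3
  have j123 : Integrable (fun k => tri (fun _ _ => 1) u u w k + (tri (fun _ _ => 1) u w u k
    + tri (fun _ _ => 1) w u u k)) lam := j1.add j23
  unfold cubDerivDensity
  rw [phys_add i123 j123, phys_const_mul, phys_add i1 i23, phys_add i2 i3, phys_add j1 j23,
    phys_add j2 j3,
    phys_tri_opp hs hu hu hw, phys_tri_opp hs hu hw hu, phys_tri_opp hs hw hu hu,
    phys_tri hs isSymbol_one hu hu hw, phys_tri hs isSymbol_one hu hw hu,
    phys_tri hs isSymbol_one hw hu hu, cubicDeriv, tsum_norm_sq_phys hu,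
    tsum_phys_triple_odd hu hu]
  push_cast
  simp only [one_mul]
  have r1 : ∑' z : ℤ × ℤ, phys w z.1 x * phys u z.2 x * phys u (p - z.1 - z.2) x
      = ∑' z : ℤ × ℤ, phys u z.1 x * phys u z.2 x * phys w (p - z.1 - z.2) x := by
    rw [← (reflectFst p).tsum_eq]
    refine tsum_congr fun z => ?_
    simp only [reflectFst, Equiv.coe_fn_mk]
    rw [show p - (p - z.1 - z.2) - z.2 = z.1 by ring]; ring
  have r2 : ∑' z : ℤ × ℤ, phys u z.1 x * phys w z.2 x * phys u (p - z.1 - z.2) x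
      = ∑' z : ℤ × ℤ, phys u z.1 x * phys u z.2 x * phys w (p - z.1 - z.2) x := by
    rw [← (reflectSnd p).tsum_eq]
    refine tsum_congr fun z => ?_
    simp only [reflectSnd, Equiv.coe_fn_mk]
    rw [show p - z.1 - (p - z.1 - z.2) = z.2 by ring]; ring
  have hsum (f g : ℤ × ℝ → ℝ) (hf : Good s f) (hg : Good s g) :
      Summable fun q : ℤ => phys f q x * phys g (-q) x := by
    refine Summable.of_norm_bounded ((summable_phys (hf.integrable hs) x).mul_right
      (∫ k, ‖g k‖ ∂lam)) fun q => ?_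
    rw [norm_mul]
    gcongr
    exact norm_phys_le_integral (hg.integrable hs) _ _
  have r3 : ∑' q : OddInt, ((2 * (conj (phys u q x) * phys w q x).re : ℝ) : ℂ)
      = ∑' q : ℤ, phys u q x * phys w (-q) x + ∑' q : ℤ, phys w q x * phys u (-q) x := by
    rw [← (hsum u w hu hw).tsum_add (hsum w u hw hu), ← tsum_odd (fun q hq => by
      rw [phys_even hu hq, phys_even hw hq]; ring)]
    refine tsum_congr fun q => ?_
    rw [phys_neg hu.even, phys_neg hw.even]
    push_cast
    rw [Complex.re_eq_add_conj]
    simp only [map_mul, Complex.conj_conj]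
    ring
  rw [r1, r2]
  push_cast at r3
  rw [r3]
  ring

/-! ### Identification of the reversible part of `X^s` -/

/-- The tempered distribution given by an integrable function. -/
noncomputable def distOf {ρ : ℝ → ℂ} (hρ : Integrable ρ) : 𝓢'(ℝ, ℂ) :=
  Lp.toTemperedDistribution ((memLp_one_iff_integrable.2 hρ).toLp ρ)

lemma distOf_apply {ρ : ℝ → ℂ} (hρ : Integrable ρ) (ψ : 𝓢(ℝ, ℂ)) :
    distOf hρ ψ = ∫ x, ψ x * ρ x := by
  rw [distOf, Lp.toTemperedDistribution_apply]
  refine integral_congr_ae ?_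
  filter_upwards [(memLp_one_iff_integrable.2 hρ).coeFn_toLp] with x hx
  rw [hx, smul_eq_mul]

lemma represents_distOf {ρ : ℝ → ℂ} (hρ : Integrable ρ) : Represents (distOf hρ) ρ :=
  fun ψ => ⟨schwartz_integrable_mul ψ hρ, distOf_apply hρ ψ⟩

lemma represents_fourierInv_distOf {ρ : ℝ → ℂ} (hρ : Integrable ρ) :
    Represents (𝓕⁻ (distOf hρ)) (𝓕⁻ ρ) := fun ψ =>
  ⟨schwartz_integrable_mul_bdd ψ (continuous_fourierInv hρ) (norm_fourierInv_le ρ), by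
    rw [TemperedDistribution.fourierInv_apply, distOf_apply, integral_mul_fourierInv ψ hρ]⟩

lemma Represents.unique {T T' : 𝓢'(ℝ, ℂ)} {f : ℝ → ℂ} (h : Represents T f)
    (h' : Represents T' f) : T = T' := by
  ext ψ
  rw [(h ψ).2, (h' ψ).2]

lemma xNorm_eq (s : ℝ) {u : ℤ → ℝ → ℂ} {T : ℤ → 𝓢'(ℝ, ℂ)} (h : ∀ p, Represents (T p) (u p)) :
    xNorm s u = xDistNorm s T := by
  refine le_antisymm (iInf₂_le T h) (le_iInf₂ fun T' h' => ?_)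
  rw [show T = T' from funext fun p => (h p).unique (h' p)]

lemma lintegral_lam {F : ℤ × ℝ → ℝ≥0∞} (hF : AEMeasurable F lam) :
    ∫⁻ k, F k ∂lam = ∑' p : ℤ, ∫⁻ η : ℝ, F (p, η) := by
  unfold lam at *
  rw [lintegral_prod _ hF, lintegral_count]

lemma wmass_eq_tsum_odd (s : ℝ) {F : ℤ × ℝ → ℝ≥0∞} (hF : AEMeasurable F lam)
    (h : ∀ k : ℤ × ℝ, Even k.1 → F k = 0) :
    wmass s F = ∑' p : OddInt, ∫⁻ η : ℝ,
      ENNReal.ofReal ((((p : ℤ) : ℝ) ^ 2 + (2 * Real.pi * η) ^ 2) ^ s) * F (p, η) ^ 2 := by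
  have hw := measurable_wt s
  rw [wmass, lintegral_lam (by fun_prop), ← Function.Injective.tsum_eq
    (g := ((↑) : OddInt → ℤ)) Subtype.val_injective]
  · refine tsum_congr fun p => lintegral_congr fun η => ?_
    rw [wt, freqSq_of_odd p.2]
  · intro q hq
    refine ⟨⟨q, Int.not_even_iff_odd.1 fun he => hq ?_⟩, rfl⟩
    simp [h (q, _) he]

lemma xDistNorm_eq (s : ℝ) {T : ℤ → 𝓢'(ℝ, ℂ)} {g : ℤ → ℝ → ℂ}
    (h : ∀ p : ℤ, Odd p → Represents (𝓕 (T p)) (g p)) :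
    xDistNorm s T = (∑' p : OddInt, ∫⁻ η : ℝ,
      ENNReal.ofReal ((((p : ℤ) : ℝ) ^ 2 + (2 * Real.pi * η) ^ 2) ^ s)
        * ‖g p η‖ₑ ^ 2) ^ (1 / 2 : ℝ) := by
  refine le_antisymm (iInf₂_le g h) (le_iInf₂ fun g' h' => le_of_eq ?_)
  congr 1
  refine tsum_congr fun p => lintegral_congr_ae ?_
  filter_upwards [(h p p.2).ae_eq (h' p p.2)] with η hη
  rw [hη]

section Identification

variable {s : ℝ}

lemma xNorm_phys (hs : 1 < s) {φ : ℤ × ℝ → ℝ} (h : Good s φ) :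
    xNorm s (phys φ) = (wmass s fun k => ‖φ k‖ₑ) ^ (1 / 2 : ℝ) := by
  have hi (p : ℤ) : Integrable fun η : ℝ => (φ (p, η) : ℂ) :=
    (integrable_slice (h.integrable hs) p).ofReal
  have e := xNorm_eq s (u := phys φ) (T := fun p => 𝓕⁻ (distOf (hi p)))
    (fun p => represents_fourierInv_distOf (hi p))
  rw [e, xDistNorm_eq s (g := fun p η => (φ (p, η) : ℂ)) (fun p _ => by
      rw [FourierTransform.fourier_fourierInv_eq]
      exact represents_distOf (hi p)),
    wmass_eq_tsum_odd s h.meas.enorm.aemeasurable (fun k hk => by simp [h.supp k hk])]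
  congr 1
  refine tsum_congr fun p => lintegral_congr fun η => ?_
  rw [← ofReal_norm, Complex.norm_real, ofReal_norm]

lemma memX_phys (hs : 1 < s) {φ : ℤ × ℝ → ℝ} (h : Good s φ) : MemX s (phys φ) where
  continuous p := continuous_phys (h.integrable hs) p
  norm_lt_top := by
    rw [xNorm_phys hs h]
    exact ENNReal.rpow_lt_top_of_nonneg (by norm_num) h.fin.ne
  real p x := phys_neg h.even p x
  even_eq_zero p hp x := phys_even h hp x

lemma isReversible_phys (φ : ℤ × ℝ → ℝ) : IsReversible (phys φ) := fun p _ x => by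
  rw [phys_conj, neg_neg]

lemma xNorm_phys_rep (hs : 1 < s) (f : XSpace s) : xNorm s (phys (rep f)) = ‖f‖ₑ := by
  rw [xNorm_phys hs (good_rep f), enorm_XSpace]

lemma conj_fourierInv (ρ : ℝ → ℂ) (x : ℝ) :
    𝓕⁻ (fun η => conj (ρ η)) x = conj (𝓕⁻ ρ (-x)) := by
  rw [Real.fourierInv_eq', Real.fourierInv_eq', ← integral_conj]
  refine integral_congr_ae (Filter.Eventually.of_forall fun η => ?_)
  simp only [smul_eq_mul, map_mul, ← Complex.exp_conj, Complex.conj_ofReal, Complex.conj_I]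
  congr 2
  simp

lemma fourierInv_comp_neg (ρ : ℝ → ℂ) (x : ℝ) :
    𝓕⁻ (fun η => ρ (-η)) x = 𝓕⁻ ρ (-x) := by
  rw [Real.fourierInv_eq', Real.fourierInv_eq', ← integral_neg_eq_self]
  refine integral_congr_ae (Filter.Eventually.of_forall fun η => ?_)
  simp

/-- A continuous family of finite `X^s` norm has Fourier densities. -/
lemma exists_density (hs : 1 < s) {u : ℤ → ℝ → ℂ} (hu : MemX s u) :
    ∃ g : ℤ × ℝ → ℂ, Measurable g ∧ wmass s (fun k => ‖g k‖ₑ) < ∞ ∧ Integrable g lam ∧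
      (∀ k : ℤ × ℝ, Even k.1 → g k = 0) ∧
      ∀ p : ℤ, ∀ x, u p x = 𝓕⁻ (fun η => g (p, η)) x := by
  obtain ⟨T, hT⟩ := iInf_lt_iff.1 hu.norm_lt_top
  obtain ⟨hTu, hT⟩ := iInf_lt_iff.1 hT
  obtain ⟨g, hg⟩ := iInf_lt_iff.1 hT
  obtain ⟨hgT, hg⟩ := iInf_lt_iff.1 hg
  have hm : ∀ p : ℤ, Odd p → AEStronglyMeasurable (g p) := fun p hp =>
    (locallyIntegrable_of_schwartz fun ψ => (hgT p hp ψ).1).aestronglyMeasurable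
  classical
  -- The norm constrains only odd modes, so the density is set to zero on even ones and replaced by
  -- a measurable representative elsewhere.
  let γ : ℤ → ℝ → ℂ := fun p => if hp : Odd p then (hm p hp).mk (g p) else 0
  have hγ : ∀ p : ℤ, Odd p → γ p =ᵐ[volume] g p := fun p hp => by
    simp only [γ, dif_pos hp]
    exact (hm p hp).ae_eq_mk.symm
  have hγ0 : ∀ p : ℤ, Even p → γ p = 0 := fun p hp => by
    simp only [γ, dif_neg (Int.not_odd_iff_even.2 hp)]
  have hγm : ∀ p, Measurable (γ p) := fun p => by
    by_cases hp : Odd p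
    · simp only [γ, dif_pos hp]
      exact (hm p hp).stronglyMeasurable_mk.measurable
    · rw [hγ0 p (Int.not_odd_iff_even.1 hp)]
      exact measurable_zero
  have hGm : Measurable fun k : ℤ × ℝ => γ k.1 k.2 := measurable_from_prod_countable_right hγm
  have hsupp : ∀ k : ℤ × ℝ, Even k.1 → γ k.1 k.2 = 0 := fun k hk => by rw [hγ0 _ hk]; rfl
  have hfin : wmass s (fun k => ‖γ k.1 k.2‖ₑ) < ∞ := by
    rw [wmass_eq_tsum_odd s hGm.enorm.aemeasurable (fun k hk => by simp [hsupp k hk])]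
    have e : ∀ p : OddInt, ∫⁻ η : ℝ,
        ENNReal.ofReal ((((p : ℤ) : ℝ) ^ 2 + (2 * Real.pi * η) ^ 2) ^ s) * ‖γ p η‖ₑ ^ 2
        = ∫⁻ η : ℝ, ENNReal.ofReal ((((p : ℤ) : ℝ) ^ 2 + (2 * Real.pi * η) ^ 2) ^ s)
          * ‖g p η‖ₑ ^ 2 := fun p => by
      refine lintegral_congr_ae ?_
      filter_upwards [hγ p p.2] with η hη
      rw [hη]
    simp only [e]
    by_contra hc
    rw [not_lt, top_le_iff] at hc
    rw [hc] at hg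
    norm_num at hg
  have hint : Integrable (fun k : ℤ × ℝ => γ k.1 k.2) lam := by
    refine ⟨hGm.aestronglyMeasurable, ?_⟩
    have h1 := (sq_lintegral_le_wmass (s := s) hGm.enorm).trans_lt
      (ENNReal.mul_lt_top (invMass_lt_top hs) hfin)
    by_contra h2
    rw [HasFiniteIntegral, not_lt, top_le_iff] at h2
    simp [h2] at h1
  refine ⟨fun k => γ k.1 k.2, hGm, hfin, hint, hsupp, fun p x => ?_⟩
  by_cases hp : Odd p
  · have hi : Integrable (γ p) := integrable_slice hint p
    have h1 : Represents (𝓕 (T p)) (γ p) := fun ψ => by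
      have hae : (fun x => ψ x * g p x) =ᵐ[volume] fun x => ψ x * γ p x := by
        filter_upwards [hγ p hp] with η hη
        rw [hη]
      exact ⟨(hgT p hp ψ).1.congr hae, by rw [(hgT p hp ψ).2, integral_congr_ae hae]⟩
    have h2 : 𝓕 (T p) = distOf hi := h1.unique (represents_distOf hi)
    have h3 : Represents (T p) (𝓕⁻ (γ p)) := by
      have h : 𝓕⁻ (𝓕 (T p) : 𝓢'(ℝ, ℂ)) = T p := FourierTransform.fourierInv_fourier_eq _
      rw [← h, h2]
      exact represents_fourierInv_distOf hi
    -- Both sides are continuous, so equality almost everywhere becomes equality everywhere.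
    have h4 := ((hTu p).ae_eq h3)
    exact congrFun ((hu.continuous p).ae_eq_iff_eq volume (continuous_fourierInv hi) |>.1 h4) x
  · rw [Int.not_odd_iff_even] at hp
    rw [hu.even_eq_zero p hp, show (fun η => γ p η) = fun _ => 0 from funext fun η => by
      rw [hγ0 p hp]; rfl, Real.fourierInv_eq]
    simp

/-- By injectivity of the inverse transform, reversibility makes the density real; combined with
`u_{-p} = conj u_p` it makes it even in `(p, η)`. Averaging the real part over `±k` makes both
properties hold at every point. -/
theorem exists_good_of_memX (hs : 1 < s) {u : ℤ → ℝ → ℂ} (hu : MemX s u)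
    (hrev : IsReversible u) : ∃ φ : ℤ × ℝ → ℝ, Good s φ ∧ u = phys φ := by
  obtain ⟨g, hgm, hfin, hint, hsupp, hg⟩ := exists_density hs hu
  have hrev' : ∀ p x, u p x = conj (u p (-x)) := fun p x => by
    by_cases hp : Odd p
    · exact hrev p hp x
    · rw [Int.not_odd_iff_even] at hp
      rw [hu.even_eq_zero p hp, hu.even_eq_zero p hp, map_zero]
  have hreal : ∀ᵐ k ∂lam, conj (g k) = g k := ae_of_slice fun p => by
    refine fourierInv_injective ((LinearIsometryEquiv.integrable_comp_iff
      Complex.conjLIE).2 (integrable_slice hint p)) (integrable_slice hint p) fun x => ?_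
    refine (conj_fourierInv (fun η => g (p, η)) x).trans ?_
    rw [← hg, ← hg, ← hrev' p x]
  have heven : ∀ᵐ k ∂lam, g (-k) = g k := ae_of_slice fun p => by
    refine fourierInv_injective (integrable_slice hint (-p)).comp_neg
      (integrable_slice hint p) fun x => ?_
    refine (fourierInv_comp_neg (fun η => g (-p, η)) x).trans ?_
    rw [← hg, ← hg, hu.real, ← hrev' p x]
  set φ : ℤ × ℝ → ℝ := fun k => ((g k).re + (g (-k)).re) / 2 with hφ
  have hφg : ∀ᵐ k ∂lam, (φ k : ℂ) = g k := by
    filter_upwards [hreal, heven] with k h1 h2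
    rw [hφ]
    dsimp only
    rw [h2, add_self_div_two]
    exact Complex.conj_eq_iff_re.1 h1
  have hae : (fun k => ‖φ k‖ₑ) =ᵐ[lam] fun k => ‖g k‖ₑ := by
    filter_upwards [hφg] with k hk
    rw [← hk, ← ofReal_norm, ← ofReal_norm, Complex.norm_real]
  have hgm' : Measurable fun k => (g (-k)).re := Complex.measurable_re.comp
    (hgm.comp measurable_neg)
  refine ⟨φ, ⟨?_, fun k => ?_, fun k hk => ?_, ?_⟩, ?_⟩
  · exact ((Complex.measurable_re.comp hgm).add hgm').div_const 2
  · simp [hφ, add_comm]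
  · simp [hφ, hsupp k hk, hsupp (-k) (by simpa using hk)]
  · rw [wmass_congr hae]; exact hfin
  · ext p x
    rw [hg, phys]
    refine Real.fourierInv_congr_ae ?_ x
    filter_upwards [ae_slice hφg p] with η hη
    rw [hη]

theorem exists_rep_of_memX (hs : 1 < s) {u : ℤ → ℝ → ℂ} (hu : MemX s u)
    (hrev : IsReversible u) : ∃ f : XSpace s, u = phys (rep f) := by
  obtain ⟨φ, hφ, rfl⟩ := exists_good_of_memX hs hu hrev
  exact ⟨hφ.toX, phys_congr (rep_toX hφ).symm⟩

lemma phys_rep_injective (hs : 1 < s) {f g : XSpace s} (h : phys (rep f) = phys (rep g)) :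
    f = g :=
  XSpace_ext (phys_injective ((good_rep f).integrable hs) ((good_rep g).integrable hs)
    fun p x => by rw [h])

/-! ### Distributions in `X^{s-2}` -/

/-- The symbol of `-(∂² - p²)`. -/
noncomputable def helmholtz (p : ℤ) (η : ℝ) : ℂ := (p : ℂ) ^ 2 + (2 * Real.pi * η) ^ 2

lemma helmholtz_temperate (p : ℤ) : Function.HasTemperateGrowth (helmholtz p) := by
  unfold helmholtz
  have h : Function.HasTemperateGrowth fun η : ℝ => (η : ℂ) :=
    Complex.ofRealCLM.hasTemperateGrowth
  fun_prop

lemma helmholtz_eq_ofReal (p : ℤ) (η : ℝ) :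
    helmholtz p η = (((p : ℝ) ^ 2 + (2 * Real.pi * η) ^ 2 : ℝ) : ℂ) := by
  unfold helmholtz; push_cast; ring

lemma norm_helmholtz {p : ℤ} (hp : Odd p) (η : ℝ) : ‖helmholtz p η‖ = freqSq (p, η) := by
  rw [freqSq_of_odd hp, helmholtz_eq_ofReal, Complex.norm_real, Real.norm_of_nonneg (by positivity)]

/-- The distribution with Fourier transform `(p² + ξ²) ρ`. -/
noncomputable def helmholtzDist (p : ℤ) {ρ : ℝ → ℂ} (hρ : Integrable ρ) : 𝓢'(ℝ, ℂ) :=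
  𝓕⁻ (TemperedDistribution.smulLeftCLM ℂ (helmholtz p) (distOf hρ))

lemma schwartz_integrable_helmholtz (p : ℤ) {ρ : ℝ → ℂ} (hρ : Integrable ρ) (ψ : 𝓢(ℝ, ℂ)) :
    Integrable fun η => ψ η * (helmholtz p η * ρ η) := by
  refine (schwartz_integrable_mul (SchwartzMap.smulLeftCLM ℂ (helmholtz p) ψ) hρ).congr
    (Filter.Eventually.of_forall fun η => ?_)
  dsimp only
  rw [SchwartzMap.smulLeftCLM_apply_apply (helmholtz_temperate p), smul_eq_mul]
  ring

lemma helmholtzDist_apply (p : ℤ) {ρ : ℝ → ℂ} (hρ : Integrable ρ) (ψ : 𝓢(ℝ, ℂ)) :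
    helmholtzDist p hρ ψ = ∫ η, 𝓕⁻ ψ η * (helmholtz p η * ρ η) := by
  rw [helmholtzDist, TemperedDistribution.fourierInv_apply,
    TemperedDistribution.smulLeftCLM_apply_apply, distOf_apply]
  refine integral_congr_ae (Filter.Eventually.of_forall fun η => ?_)
  dsimp only
  rw [SchwartzMap.smulLeftCLM_apply_apply (helmholtz_temperate p), smul_eq_mul]
  ring

lemma represents_fourier_helmholtzDist (p : ℤ) {ρ : ℝ → ℂ} (hρ : Integrable ρ) :
    Represents (𝓕 (helmholtzDist p hρ)) fun η => helmholtz p η * ρ η := fun ψ =>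
  ⟨schwartz_integrable_helmholtz p hρ ψ, by
    rw [TemperedDistribution.fourier_apply, helmholtzDist_apply]
    simp⟩

open Classical in
/-- The element of `X^{s-2}` with Fourier densities `(p² + ξ²) φ_p`. -/
noncomputable def helmholtzFamily {φ : ℤ × ℝ → ℝ} (h : Integrable φ lam) (p : ℤ) : 𝓢'(ℝ, ℂ) :=
  if Odd p then helmholtzDist p (integrable_slice h p).ofReal else 0

lemma helmholtzFamily_odd {φ : ℤ × ℝ → ℝ} (h : Integrable φ lam) {p : ℤ} (hp : Odd p)
    (ψ : 𝓢(ℝ, ℂ)) : helmholtzFamily h p ψ = ∫ η, 𝓕⁻ ψ η * (helmholtz p η * φ (p, η)) := by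
  rw [helmholtzFamily, if_pos hp, helmholtzDist_apply]
  rfl

lemma schwartz_fourierInv_eq (ψ : 𝓢(ℝ, ℂ)) (x : ℝ) :
    𝓕⁻ ψ x = 𝓕⁻ (ψ : ℝ → ℂ) x := by
  rw [SchwartzMap.fourierInv_coe]

lemma fourierInv_schwartz_conj {ψ χ : 𝓢(ℝ, ℂ)} (h : ∀ x, χ x = conj (ψ x)) (η : ℝ) :
    𝓕⁻ χ η = conj (𝓕⁻ ψ (-η)) := by
  rw [schwartz_fourierInv_eq, schwartz_fourierInv_eq, ← conj_fourierInv,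
    show (χ : ℝ → ℂ) = fun x => conj (ψ x) from funext h]

lemma fourierInv_schwartz_conj_neg {ψ χ : 𝓢(ℝ, ℂ)} (h : ∀ x, χ x = conj (ψ (-x))) (η : ℝ) :
    𝓕⁻ χ η = conj (𝓕⁻ ψ η) := by
  have e : (χ : ℝ → ℂ) = fun x => (fun y => conj (ψ y)) (-x) := funext h
  rw [schwartz_fourierInv_eq, schwartz_fourierInv_eq, e]
  exact (fourierInv_comp_neg (fun y => conj (ψ y)) η).trans (by rw [conj_fourierInv, neg_neg])

lemma conj_helmholtz (p : ℤ) (η : ℝ) : conj (helmholtz p η) = helmholtz p η := by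
  rw [helmholtz_eq_ofReal, Complex.conj_ofReal]

lemma helmholtz_neg (p : ℤ) (η : ℝ) : helmholtz (-p) (-η) = helmholtz p η := by
  simp [helmholtz]

/-- The squared factor `(p² + ξ²)²` raises the weight from exponent `s - 2` to `s`. These
distributions are the right-hand sides on which the invertibility assumption is tested. -/
lemma memXDist_helmholtz (hs : 1 < s) {φ : ℤ × ℝ → ℝ} (h : Good s φ) :
    MemXDist (s - 2) (helmholtzFamily (h.integrable hs)) where
  norm_lt_top := by
    have hr : ∀ p : ℤ, Odd p → Represents (𝓕 (helmholtzFamily (h.integrable hs) p))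
        fun η => helmholtz p η * φ (p, η) := fun p hp => by
      rw [helmholtzFamily, if_pos hp]
      exact represents_fourier_helmholtzDist p _
    rw [xDistNorm_eq (s - 2) hr]
    refine ENNReal.rpow_lt_top_of_nonneg (by norm_num) (lt_of_eq_of_lt ?_ h.fin).ne
    rw [wmass_eq_tsum_odd s h.meas.enorm.aemeasurable (fun k hk => by simp [h.supp k hk])]
    refine tsum_congr fun p => lintegral_congr fun η => ?_
    have hpos := freqSq_pos ((p : ℤ), η)
    rw [← freqSq_of_odd p.2, ← ofReal_norm, norm_mul, norm_helmholtz p.2, Complex.norm_real,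
      ENNReal.ofReal_mul hpos.le, mul_pow, ofReal_norm, ← mul_assoc]
    congr 1
    rw [← ENNReal.ofReal_pow hpos.le, ← ENNReal.ofReal_mul (by positivity), ← Real.rpow_natCast,
      ← Real.rpow_add hpos]
    congr 2; push_cast; ring
  real p ψ χ hχ := by
    by_cases hp : Odd p
    · rw [helmholtzFamily_odd _ hp.neg, helmholtzFamily_odd _ hp, ← integral_conj,
        ← integral_neg_eq_self]
      refine integral_congr_ae (Filter.Eventually.of_forall fun η => ?_)
      have e := h.even (p, η)
      simp only [Prod.neg_mk] at e
      simp only [fourierInv_schwartz_conj hχ, map_mul, conj_helmholtz, helmholtz_neg,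
        Complex.conj_ofReal, neg_neg, e]
    · have hp' : ¬ Odd (-p) := by rwa [odd_neg]
      rw [helmholtzFamily, helmholtzFamily, if_neg hp, if_neg hp']
      simp
  even_eq_zero p hp := by
    rw [helmholtzFamily, if_neg (Int.not_odd_iff_even.2 hp)]

lemma isReversibleDist_helmholtz {φ : ℤ × ℝ → ℝ} (h : Integrable φ lam) :
    IsReversibleDist (helmholtzFamily h) := fun p hp ψ χ hχ => by
  rw [helmholtzFamily_odd _ hp, helmholtzFamily_odd _ hp, ← integral_conj]
  refine integral_congr_ae (Filter.Eventually.of_forall fun η => ?_)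
  simp only [fourierInv_schwartz_conj_neg hχ, map_mul, conj_helmholtz, Complex.conj_ofReal]

end Identification

/-! ### The equations on the Fourier side -/

section Equations

variable {s : ℝ}

/-- The multiplier `p² / (p² + ξ²)`. -/
noncomputable def multP (k : ℤ × ℝ) : ℝ := (k.1 : ℝ) ^ 2 / freqSq k

/-- The multiplier `p ξ / (p² + ξ²)`. -/
noncomputable def multQ (k : ℤ × ℝ) : ℝ := (k.1 : ℝ) * (2 * Real.pi * k.2) / freqSq k

lemma measurable_intCast_fst : Measurable fun k : ℤ × ℝ => (k.1 : ℝ) :=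
  (measurable_of_countable _).comp measurable_fst

lemma isMultiplier_P : IsMultiplier multP where
  meas := (measurable_intCast_fst.pow_const 2).div measurable_freqSq
  bound k := by
    rw [multP, abs_of_nonneg (div_nonneg (sq_nonneg _) (freqSq_pos k).le),
      div_le_one (freqSq_pos k), freqSq]
    have := le_max_right 1 ((k.1 : ℝ) ^ 2)
    nlinarith [sq_nonneg (2 * Real.pi * k.2)]
  even k := by simp [multP, freqSq_neg]

lemma isMultiplier_Q : IsMultiplier multQ where
  meas := (measurable_intCast_fst.mul (by fun_prop)).div measurable_freqSq
  bound k := by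
    rw [multQ, abs_div, abs_of_pos (freqSq_pos k), div_le_one (freqSq_pos k), freqSq, abs_le]
    have := le_max_right 1 ((k.1 : ℝ) ^ 2)
    constructor <;>
      nlinarith [sq_nonneg ((k.1 : ℝ) + 2 * Real.pi * k.2),
        sq_nonneg ((k.1 : ℝ) - 2 * Real.pi * k.2),
        sq_nonneg (k.1 : ℝ), sq_nonneg (2 * Real.pi * k.2)]
  even k := by simp [multQ, freqSq_neg]

/-- `T` is the trilinear convolution with symbol `m` followed by the multiplier `M`. -/
def IsTriOp (m : ℤ → ℤ → ℝ) (M : ℤ × ℝ → ℝ)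
    (T : XSpace s →L[ℝ] XSpace s →L[ℝ] XSpace s →L[ℝ] XSpace s) : Prop :=
  ∀ f g h, rep (T f g h) =ᵐ[lam] fun k => M k * tri m (rep f) (rep g) (rep h) k

variable {M : ℤ × ℝ → ℝ} {T₁ T₂ P₁ P₂ Q₁ Q₂ : XSpace s →L[ℝ] XSpace s →L[ℝ] XSpace s →L[ℝ] XSpace s}

lemma rep_cub (h₁ : IsTriOp oppSymbol M T₁) (h₂ : IsTriOp (fun _ _ => 1) M T₂) (a b : XSpace s) :
    rep (cub T₁ T₂ a b) =ᵐ[lam] fun k => M k * cubDensity (rep a) (rep b) k := by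
  filter_upwards [rep_add ((3 : ℝ) • T₁ b b a) (T₂ a a a), rep_smul 3 (T₁ b b a), h₁ b b a,
    h₂ a a a] with k e1 e2 e3 e4
  rw [cub, e1, e2, e3, e4, cubDensity]
  ring

lemma rep_add_of {F G : XSpace s} {f g : ℤ × ℝ → ℝ} (hF : rep F =ᵐ[lam] f)
    (hG : rep G =ᵐ[lam] g) : rep (F + G) =ᵐ[lam] fun k => f k + g k := by
  filter_upwards [rep_add F G, hF, hG] with k e e1 e2
  rw [e, e1, e2]

lemma rep_sub_of {F G : XSpace s} {f g : ℤ × ℝ → ℝ} (hF : rep F =ᵐ[lam] f)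
    (hG : rep G =ᵐ[lam] g) : rep (F - G) =ᵐ[lam] fun k => f k - g k := by
  filter_upwards [rep_sub F G, hF, hG] with k e e1 e2
  rw [e, e1, e2]

lemma rep_smul_of (c : ℝ) {F : XSpace s} {f : ℤ × ℝ → ℝ} (hF : rep F =ᵐ[lam] f) :
    rep (c • F) =ᵐ[lam] fun k => c * f k := by
  filter_upwards [rep_smul c F, hF] with k e e1
  rw [e, e1]

lemma rep_cubD (h₁ : IsTriOp oppSymbol M T₁) (h₂ : IsTriOp (fun _ _ => 1) M T₂) (a h : XSpace s) :
    rep (cubD T₁ T₂ a h) =ᵐ[lam] fun k => M k * cubDerivDensity (rep a) (rep h) k := by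
  have e := rep_add_of
    (rep_smul_of 3 (rep_add_of (rep_add_of (h₁ a a h) (h₁ a h a)) (h₁ h a a)))
    (rep_add_of (rep_add_of (h₂ a a h) (h₂ a h a)) (h₂ h a a))
  refine Filter.EventuallyEq.trans (f := rep (cubD T₁ T₂ a h)) e
    (Filter.Eventually.of_forall fun k => ?_)
  simp only [cubDerivDensity]
  ring

lemma XSpace_ext_odd {f g : XSpace s}
    (h : ∀ p : ℤ, Odd p → ∀ᵐ η : ℝ, rep f (p, η) = rep g (p, η)) : f = g := by
  refine XSpace_ext (ae_of_slice fun p => ?_)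
  by_cases hp : Odd p
  · exact h p hp
  · rw [Int.not_odd_iff_even] at hp
    exact Filter.Eventually.of_forall fun η => by
      rw [(good_rep f).supp _ hp, (good_rep g).supp _ hp]

lemma integrable_phys_slice {φ : ℤ × ℝ → ℝ} (h : Integrable φ lam) (p : ℤ) :
    Integrable fun η : ℝ => (φ (p, η) : ℂ) := (integrable_slice h p).ofReal

lemma fourierInv_add {ρ σ : ℝ → ℂ} (hρ : Integrable ρ) (hσ : Integrable σ) (x : ℝ) :
    𝓕⁻ (fun η => ρ η + σ η) x = 𝓕⁻ ρ x + 𝓕⁻ σ x := by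
  have hi (ρ : ℝ → ℂ) (h : Integrable ρ) : Integrable fun η : ℝ => wave (η * x) * ρ η :=
    h.bdd_mul (c := 1) (continuous_wave.comp (by fun_prop) :
      Continuous fun η : ℝ => wave (η * x)).aestronglyMeasurable
      (Filter.Eventually.of_forall fun η => (norm_wave _).le)
  have e (ρ : ℝ → ℂ) : 𝓕⁻ ρ x = ∫ η : ℝ, wave (η * x) * ρ η := by
    rw [Real.fourierInv_eq']
    simp [wave, mul_comm x]
  rw [e, e, e, ← integral_add (hi ρ hρ) (hi σ hσ)]
  simp only [mul_add]

lemma fourierInv_const_mul (c : ℂ) (ρ : ℝ → ℂ) (x : ℝ) :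
    𝓕⁻ (fun η => c * ρ η) x = c * 𝓕⁻ ρ x := by
  rw [Real.fourierInv_eq', Real.fourierInv_eq', ← integral_const_mul]
  congr 1; ext η; simp only [smul_eq_mul]; ring

/-- A profile solving the extended nonlinear Schrödinger system is a fixed point. -/
theorem nls_fixed_point (hs : 1 < s) {Γ : ℝ} {w : XSpace s}
    (h₁ : IsTriOp oppSymbol multP P₁) (h₂ : IsTriOp (fun _ _ => 1) multP P₂)
    (hsol : IsNLSSolution Γ (phys (rep w))) : w = (2 * Γ / 3) • cub P₁ P₂ w w := by
  have hw := good_rep w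
  have hwi := hw.integrable hs
  have hN := integrable_cubDensity hs hw hw
  refine XSpace_ext_odd fun p hp => ?_
  set σ : ℝ → ℂ := fun η => (p : ℂ) ^ 2 * (rep w (p, η) : ℂ)
    + (-(2 * (p : ℂ) ^ 2 / 3 * Γ)) * (cubDensity (rep w) (rep w) (p, η) : ℂ) with hσ
  have i1 := integrable_phys_slice hwi p
  have i2 := integrable_phys_slice hN p
  have hσi : Integrable σ := (i1.const_mul _).add (i2.const_mul _)
  have h := fourierInv_deriv_two_ae i1 hσi (hsol.contDiff p hp) fun x => by
    have e := hsol.eqn p hp x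
    rw [cubic_phys hs hw hw] at e
    rw [hσ, fourierInv_add (i1.const_mul _) (i2.const_mul _), fourierInv_const_mul,
      fourierInv_const_mul]
    change iteratedDeriv 2 (phys (rep w) p) x = (p : ℂ) ^ 2 * phys (rep w) p x
      + (-(2 * (p : ℂ) ^ 2 / 3 * Γ)) * phys (cubDensity (rep w) (rep w)) p x
    linear_combination e
  filter_upwards [h, ae_slice (rep_smul (2 * Γ / 3) (cub P₁ P₂ w w)) p,
    ae_slice (rep_cub h₁ h₂ w w) p] with η e1 e2 e3
  rw [e2, e3, multP]
  have e4 : (2 * Real.pi * η) ^ 2 * rep w (p, η) = -((p : ℝ) ^ 2 * rep w (p, η)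
      + (-(2 * (p : ℝ) ^ 2 / 3 * Γ)) * cubDensity (rep w) (rep w) (p, η)) := by
    have e1' : ((2 * Real.pi * η) ^ 2 * rep w (p, η) : ℂ) = -((p : ℂ) ^ 2 * (rep w (p, η) : ℂ)
      + (-(2 * (p : ℂ) ^ 2 / 3 * Γ)) * (cubDensity (rep w) (rep w) (p, η) : ℂ)) := e1
    exact_mod_cast e1'
  -- Moving `p² w` to the left of `e4` produces the factor `p² + ξ²`, and division by it gives the
  -- multiplier.
  have hF := freqSq_pos (p, η)
  have hF' := freqSq_of_odd hp η
  field_simp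
  rw [hF']
  linear_combination 3 * e4

lemma linearized_integral (hs : 1 < s) (Γ : ℝ) {u w : ℤ × ℝ → ℝ} (hu : Good s u) (hw : Good s w)
    (p : ℤ) (ψ : 𝓢(ℝ, ℂ)) :
    ∫ ζ : ℝ, (phys w p ζ * (iteratedDeriv 2 (fun x => ψ x) ζ - (p : ℂ) ^ 2 * ψ ζ)
      + 2 * (p : ℂ) ^ 2 / 3 * Γ * cubicDeriv (phys u) (phys w) p ζ * ψ ζ)
    = ∫ η, 𝓕⁻ ψ η * (-(helmholtz p η * w (p, η))
      + 2 * (p : ℂ) ^ 2 / 3 * Γ * cubDerivDensity u w (p, η)) := by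
  have i1 := integrable_phys_slice (hw.integrable hs) p
  have i2 := integrable_phys_slice (integrable_cubDerivDensity hs hu hw) p
  have hI (χ : 𝓢(ℝ, ℂ)) {τ : ℝ → ℂ} (hτ : Integrable τ) :
      Integrable (fun x => χ x * 𝓕⁻ τ x) :=
    schwartz_integrable_mul_bdd χ (continuous_fourierInv hτ) (norm_fourierInv_le τ)
  set D := SchwartzMap.derivCLM ℂ ℂ (SchwartzMap.derivCLM ℂ ℂ ψ) with hD
  set ρ : ℝ → ℂ := fun η => (w (p, η) : ℂ)
  set σ : ℝ → ℂ := fun η => (cubDerivDensity u w (p, η) : ℂ)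
  set c : ℂ := 2 * (p : ℂ) ^ 2 / 3 * Γ
  have e1 : ∀ ζ : ℝ, phys w p ζ * (iteratedDeriv 2 (fun x => ψ x) ζ - (p : ℂ) ^ 2 * ψ ζ)
      + c * cubicDeriv (phys u) (phys w) p ζ * ψ ζ
      = (D ζ * 𝓕⁻ ρ ζ + (-(p : ℂ) ^ 2) * (ψ ζ * 𝓕⁻ ρ ζ)) + c * (ψ ζ * 𝓕⁻ σ ζ) := fun ζ => by
    rw [iteratedDeriv_two_schwartz, cubicDeriv_phys hs hu hw]
    change 𝓕⁻ ρ ζ * (D ζ - (p : ℂ) ^ 2 * ψ ζ) + c * 𝓕⁻ σ ζ * ψ ζ = _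
    ring
  have j1 : Integrable fun ζ => D ζ * 𝓕⁻ ρ ζ + (-(p : ℂ) ^ 2) * (ψ ζ * 𝓕⁻ ρ ζ) :=
    (hI _ i1).add ((hI _ i1).const_mul _)
  have j2 : Integrable fun η => 𝓕⁻ D η * ρ η + (-(p : ℂ) ^ 2) * (𝓕⁻ ψ η * ρ η) :=
    (schwartz_integrable_mul _ i1).add ((schwartz_integrable_mul _ i1).const_mul _)
  simp only [e1]
  rw [integral_add j1 ((hI _ i2).const_mul _),
    integral_add (hI _ i1) ((hI _ i1).const_mul _), integral_const_mul, integral_const_mul,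
    integral_mul_fourierInv _ i1, integral_mul_fourierInv _ i1, integral_mul_fourierInv _ i2,
    ← integral_const_mul, ← integral_const_mul,
    ← integral_add (schwartz_integrable_mul _ i1) ((schwartz_integrable_mul _ i1).const_mul _),
    ← integral_add j2 ((schwartz_integrable_mul _ i2).const_mul _)]
  refine integral_congr_ae (Filter.Eventually.of_forall fun η => ?_)
  simp only [hD, fourierInv_iteratedDeriv_two, helmholtz]
  ring

/-- On the Fourier side the linearized operator multiplies the density of `w - (2Γ/3) cubD u w` by
`-(p² + ξ²)`. The target carries the same factor without the sign, and it can be divided out. -/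
theorem isLinearizedImage_iff (hs : 1 < s) {Γ : ℝ} (h₁ : IsTriOp oppSymbol multP P₁)
    (h₂ : IsTriOp (fun _ _ => 1) multP P₂) (u w h : XSpace s) :
    IsLinearizedImage Γ (phys (rep u)) (phys (rep w))
      (helmholtzFamily ((good_rep h).integrable hs)) ↔
      w - (2 * Γ / 3) • cubD P₁ P₂ u w = -h := by
  have hu := good_rep u
  have hw := good_rep w
  have hh := (good_rep h).integrable hs
  have hDi := integrable_cubDerivDensity hs hu hw
  have key : ∀ p : ℤ, Odd p → ((∀ ψ : 𝓢(ℝ, ℂ), helmholtzFamily hh p ψ =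
      ∫ ζ : ℝ, (phys (rep w) p ζ * (iteratedDeriv 2 (fun x => ψ x) ζ - (p : ℂ) ^ 2 * ψ ζ)
        + 2 * (p : ℂ) ^ 2 / 3 * Γ * cubicDeriv (phys (rep u)) (phys (rep w)) p ζ * ψ ζ)) ↔
      ∀ᵐ η : ℝ, rep (w - (2 * Γ / 3) • cubD P₁ P₂ u w) (p, η) = rep (-h) (p, η)) := fun p hp => by
    have step : (∀ ψ : 𝓢(ℝ, ℂ), helmholtzFamily hh p ψ =
      ∫ ζ : ℝ, (phys (rep w) p ζ * (iteratedDeriv 2 (fun x => ψ x) ζ - (p : ℂ) ^ 2 * ψ ζ)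
        + 2 * (p : ℂ) ^ 2 / 3 * Γ * cubicDeriv (phys (rep u)) (phys (rep w)) p ζ * ψ ζ)) ↔
      ∀ᵐ η : ℝ, helmholtz p η * rep h (p, η) = -(helmholtz p η * rep w (p, η))
        + 2 * (p : ℂ) ^ 2 / 3 * Γ * cubDerivDensity (rep u) (rep w) (p, η) := by
      simp only [helmholtzFamily_odd hh hp, linearized_integral hs Γ hu hw]
      constructor
      · intro H
        refine ae_eq_of_schwartz
          (fun ψ => schwartz_integrable_helmholtz p (integrable_phys_slice hh p) ψ)
          (fun ψ => ?_) (fun ψ => ?_)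
        · have j1 := (schwartz_integrable_helmholtz p
            (integrable_phys_slice (hw.integrable hs) p) ψ).neg
          have j2 := (schwartz_integrable_mul ψ (integrable_phys_slice hDi p)).const_mul
            (2 * (p : ℂ) ^ 2 / 3 * Γ)
          refine (j1.add j2).congr (Filter.Eventually.of_forall fun η => ?_)
          simp only [Pi.add_apply, Pi.neg_apply]
          ring
        · simpa using H (𝓕 ψ)
      · intro H ψ
        refine integral_congr_ae ?_
        filter_upwards [H] with η hη
        rw [hη]
    rw [step]
    have hsub := ae_slice (rep_sub w ((2 * Γ / 3) • cubD P₁ P₂ u w)) p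
    have hsmul := ae_slice (rep_smul (2 * Γ / 3) (cubD P₁ P₂ u w)) p
    have hD := ae_slice (rep_cubD h₁ h₂ u w) p
    have hneg := ae_slice (rep_smul (-1) h) p
    rw [neg_one_smul] at hneg
    refine Filter.eventually_congr ?_
    filter_upwards [hsub, hsmul, hD, hneg] with η e1 e2 e3 e4
    rw [e1, e2, e3, e4, multP]
    have hF := freqSq_pos (p, η)
    have hF' := freqSq_of_odd hp η
    rw [helmholtz_eq_ofReal, ← hF']
    constructor
    · intro E
      have E' : freqSq (p, η) * rep h (p, η) = -(freqSq (p, η) * rep w (p, η))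
        + 2 * (p : ℝ) ^ 2 / 3 * Γ * cubDerivDensity (rep u) (rep w) (p, η) := by exact_mod_cast E
      field_simp
      linear_combination 3 * E'
    · intro E
      field_simp at E
      have E' : freqSq (p, η) * rep h (p, η) = -(freqSq (p, η) * rep w (p, η))
        + 2 * (p : ℝ) ^ 2 / 3 * Γ * cubDerivDensity (rep u) (rep w) (p, η) := by
        linear_combination (1 / 3) * E
      exact_mod_cast E'
  constructor
  · intro H
    exact XSpace_ext_odd fun p hp => (key p hp).1 (H p hp)
  · intro H p hp
    refine (key p hp).2 ?_
    rw [H]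
    exact Filter.Eventually.of_forall fun _ => rfl

/-- Uniqueness of preimages gives injectivity and existence gives surjectivity, because every
reversible element of `X^s` comes from an element of `XSpace`. -/
theorem linearization_bijective (hs : 1 < s) {Γ : ℝ} (h₁ : IsTriOp oppSymbol multP P₁)
    (h₂ : IsTriOp (fun _ _ => 1) multP P₂) (u : XSpace s)
    (hinv : LinearizationInvertible s Γ (phys (rep u))) :
    Function.Bijective fun h : XSpace s => h - (2 * Γ / 3) • cubD P₁ P₂ u h := by
  have hex (h : XSpace s) := hinv.bijective (helmholtzFamily ((good_rep (-h)).integrable hs))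
    (memXDist_helmholtz hs (good_rep (-h))) (isReversibleDist_helmholtz _)
  constructor
  · intro w w' hww
    dsimp only at hww
    obtain ⟨W, -, hW⟩ := hex (w - (2 * Γ / 3) • cubD P₁ P₂ u w)
    have e1 := hW (phys (rep w)) ⟨memX_phys hs (good_rep w), isReversible_phys _,
      (isLinearizedImage_iff hs h₁ h₂ u w _).2 (by rw [neg_neg])⟩
    have e2 := hW (phys (rep w')) ⟨memX_phys hs (good_rep w'), isReversible_phys _,
      (isLinearizedImage_iff hs h₁ h₂ u w' _).2 (by rw [neg_neg, hww])⟩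
    exact phys_rep_injective hs (e1.trans e2.symm)
  · intro h
    obtain ⟨W, ⟨hWm, hWr, hWi⟩, -⟩ := hex h
    obtain ⟨w, rfl⟩ := exists_rep_of_memX hs hWm hWr
    exact ⟨w, by simpa using (isLinearizedImage_iff hs h₁ h₂ u w _).1 hWi⟩

/-! ### The coupled mode system as a system for densities. -/

/-- A first-order equation in the slow variable, on the Fourier side. -/
lemma ode_iff {ρ τ : ℝ → ℂ} (hρ : Integrable ρ) (hτ : Integrable τ) {e : ℂ} (he : e ≠ 0) {μ : ℝ}
    (hμ : μ ≠ 0) :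
    (Differentiable ℝ (fun Z : ℝ => 𝓕⁻ ρ (μ * Z)) ∧
      ∀ Z : ℝ, e * deriv (fun Z : ℝ => 𝓕⁻ ρ (μ * Z)) Z + 𝓕⁻ τ (μ * Z) = 0) ↔
      ∀ᵐ η : ℝ, e * μ * (2 * Real.pi * Complex.I * η * ρ η) + τ η = 0 := by
  have hμ' : (μ : ℂ) ≠ 0 := by exact_mod_cast hμ
  constructor
  · rintro ⟨hd, heq⟩
    have hder : ∀ x, HasDerivAt (𝓕⁻ ρ) (𝓕⁻ (fun η => -(e * μ)⁻¹ * τ η) x) x := fun x => by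
      have h1 : HasDerivAt (fun Z : ℝ => 𝓕⁻ ρ (μ * Z))
          (deriv (fun Z : ℝ => 𝓕⁻ ρ (μ * Z)) (μ⁻¹ * x)) (μ⁻¹ * x) := hd.differentiableAt.hasDerivAt
      have h2 := HasDerivAt.scomp (h := fun x : ℝ => μ⁻¹ * x) x h1
        ((hasDerivAt_id x).const_mul μ⁻¹)
      have e1 : ((fun Z : ℝ => 𝓕⁻ ρ (μ * Z)) ∘ fun x : ℝ => μ⁻¹ * x) = 𝓕⁻ ρ := by
        ext y; simp [hμ]
      rw [e1] at h2
      convert! h2 using 1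
      have h3 := heq (μ⁻¹ * x)
      rw [mul_inv_cancel_left₀ hμ] at h3
      rw [fourierInv_const_mul, mul_one, Complex.real_smul, Complex.ofReal_inv]
      generalize deriv (fun Z : ℝ => 𝓕⁻ ρ (μ * Z)) (μ⁻¹ * x) = d at h3
      field_simp
      linear_combination -h3
    have h := fourierInv_deriv_ae hρ (hτ.const_mul (-(e * μ)⁻¹)) hder
    filter_upwards [h] with η hη
    rw [hη]
    field_simp
    ring
  · intro H
    -- The equation itself expresses `η ρ(η)` through the integrable `τ`, which supplies the
    -- differentiability.
    have hI : Integrable fun η : ℝ => (η : ℂ) * ρ η := by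
      refine (hτ.const_mul (-(e * μ * (2 * Real.pi * Complex.I))⁻¹)).congr ?_
      filter_upwards [H] with η hη
      have : (Real.pi : ℂ) ≠ 0 := by exact_mod_cast Real.pi_ne_zero
      have hI := Complex.I_ne_zero
      field_simp
      linear_combination -hη
    have hder : ∀ Z : ℝ, HasDerivAt (fun Z : ℝ => 𝓕⁻ ρ (μ * Z))
        (μ * 𝓕⁻ (fun η : ℝ => 2 * Real.pi * Complex.I * η * ρ η) (μ * Z)) Z := fun Z => by
      have h2 := HasDerivAt.scomp (h := fun x : ℝ => μ * x) Z (hasDerivAt_fourierInv hρ hI (μ * Z))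
        ((hasDerivAt_id Z).const_mul μ)
      convert! h2 using 1
      rw [mul_one, Complex.real_smul]
    refine ⟨fun Z => (hder Z).differentiableAt, fun Z => ?_⟩
    rw [(hder Z).deriv, ← mul_assoc, ← fourierInv_const_mul, ← fourierInv_add _ hτ,
      Real.fourierInv_congr_ae (f₂ := fun _ => 0) H, Real.fourierInv_eq]
    · simp
    · have : Integrable fun η : ℝ => (e * μ * (2 * Real.pi * Complex.I)) * ((η : ℂ) * ρ η) :=
        hI.const_mul _
      refine this.congr (Filter.Eventually.of_forall fun η => ?_)
      dsimp only
      ring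

/-- The density of the right-hand side of the coupled mode system. -/
noncomputable def modeDensity (Γ Ω : ℝ) (a b : ℤ × ℝ → ℝ) (k : ℤ × ℝ) : ℝ :=
  k.1 * Ω * a k + k.1 * b k + k.1 * (Γ / 3) * cubDensity a b k

lemma fourierInv_modeDensity (hs : 1 < s) (Γ Ω : ℝ) {a b : ℤ × ℝ → ℝ} (ha : Good s a)
    (hb : Good s b) (p : ℤ) :
    Integrable (fun η : ℝ => (modeDensity Γ Ω a b (p, η) : ℂ)) ∧ ∀ x,
      𝓕⁻ (fun η : ℝ => (modeDensity Γ Ω a b (p, η) : ℂ)) x = p * Ω * phys a p x + p * phys b p x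
        + p * (Γ / 3) * cubic (phys a) (phys b) p x := by
  have i1 := integrable_phys_slice (ha.integrable hs) p
  have i2 := integrable_phys_slice (hb.integrable hs) p
  have i3 := integrable_phys_slice (integrable_cubDensity hs ha hb) p
  have e : (fun η : ℝ => (modeDensity Γ Ω a b (p, η) : ℂ)) = fun η : ℝ =>
      ((p : ℂ) * Ω * a (p, η) + p * b (p, η)) + p * (Γ / 3) * cubDensity a b (p, η) := by
    ext η; unfold modeDensity; push_cast; ring
  have j12 : Integrable fun η : ℝ => (p : ℂ) * Ω * a (p, η) + p * b (p, η) :=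
    (i1.const_mul _).add (i2.const_mul _)
  rw [e]
  refine ⟨j12.add (i3.const_mul _), fun x => ?_⟩
  rw [fourierInv_add j12 (i3.const_mul _), fourierInv_add (i1.const_mul _) (i2.const_mul _),
    fourierInv_const_mul, fourierInv_const_mul, fourierInv_const_mul, cubic_phys hs ha hb]
  rfl

/-- The factor `i` in front of the derivative meets the `i` of its symbol, so the equations for the
real densities have real coefficients. -/
theorem coupledMode_iff_density (hs : 1 < s) (Γ Ω : ℝ) {a b : ℤ × ℝ → ℝ} (ha : Good s a)
    (hb : Good s b) {μ : ℝ} (hμ : μ ≠ 0) :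
    IsCoupledModeSolution Γ Ω (fun p Z => phys a p (μ * Z)) (fun p Z => phys b p (μ * Z)) ↔
      ∀ p : ℤ, Odd p →
        (∀ᵐ η : ℝ, -(μ * (2 * Real.pi * η) * a (p, η)) + modeDensity Γ Ω a b (p, η) = 0) ∧
        ∀ᵐ η : ℝ, μ * (2 * Real.pi * η) * b (p, η) + modeDensity Γ Ω b a (p, η) = 0 := by
  have hA (p : ℤ) := ode_iff (integrable_phys_slice (ha.integrable hs) p)
    (fourierInv_modeDensity hs Γ Ω ha hb p).1 Complex.I_ne_zero hμ
  have hB (p : ℤ) := ode_iff (integrable_phys_slice (hb.integrable hs) p)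
    (fourierInv_modeDensity hs Γ Ω hb ha p).1 (neg_ne_zero.2 Complex.I_ne_zero) hμ
  have cA (p : ℤ) (η : ℝ) : (Complex.I * μ * (2 * Real.pi * Complex.I * η * (a (p, η) : ℂ))
      + (modeDensity Γ Ω a b (p, η) : ℂ) = 0) ↔
      -(μ * (2 * Real.pi * η) * a (p, η)) + modeDensity Γ Ω a b (p, η) = 0 := by
    rw [show Complex.I * μ * (2 * Real.pi * Complex.I * η * (a (p, η) : ℂ))
        = -(μ * (2 * Real.pi * η) * a (p, η)) by
      linear_combination μ * (2 * Real.pi * η) * a (p, η) * Complex.I_sq]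
    norm_cast
  have cB (p : ℤ) (η : ℝ) : (-Complex.I * μ * (2 * Real.pi * Complex.I * η * (b (p, η) : ℂ))
      + (modeDensity Γ Ω b a (p, η) : ℂ) = 0) ↔
      μ * (2 * Real.pi * η) * b (p, η) + modeDensity Γ Ω b a (p, η) = 0 := by
    rw [show -Complex.I * μ * (2 * Real.pi * Complex.I * η * (b (p, η) : ℂ))
        = μ * (2 * Real.pi * η) * b (p, η) by
      linear_combination -(μ * (2 * Real.pi * η) * b (p, η)) * Complex.I_sq]
    norm_cast
  simp only [(fourierInv_modeDensity hs Γ Ω ha hb _).2, cA] at hA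
  simp only [(fourierInv_modeDensity hs Γ Ω hb ha _).2, cB] at hB
  constructor
  · intro H p hp
    refine ⟨(hA p).1 ⟨H.differentiable_left p hp, fun Z => ?_⟩,
      (hB p).1 ⟨H.differentiable_right p hp, fun Z => ?_⟩⟩
    · have := H.left p hp Z
      rw [← this]
      simp only [cubic]
      change _ = Complex.I * deriv (fun Z => phys a p (μ * Z)) Z + _ + _ + _
      unfold phys
      ring
    · have := H.right p hp Z
      rw [← this]
      simp only [cubic]
      change _ = -Complex.I * deriv (fun Z => phys b p (μ * Z)) Z + _ + _ + _
      unfold phys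
      ring
  · intro H
    refine ⟨fun p hp => ((hA p).2 (H p hp).1).1, fun p hp => ((hB p).2 (H p hp).2).1,
      fun p hp Z => ?_, fun p hp Z => ?_⟩
    · have := ((hA p).2 (H p hp).1).2 Z
      rw [← this]
      simp only [cubic]
      change Complex.I * deriv (fun Z => phys a p (μ * Z)) Z + _ + _ + _ = _
      unfold phys
      ring
    · have := ((hB p).2 (H p hp).2).2 Z
      rw [← this]
      simp only [cubic]
      change -Complex.I * deriv (fun Z => phys b p (μ * Z)) Z + _ + _ + _ = _
      unfold phys
      ring

end Equations

/-! ### Reduction of the coupled mode system to the branch equation -/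

section Reduction

variable {s : ℝ}

/-- Cramer's rule for the matrix with diagonal entries `pΩ - μξ`, `pΩ + μξ` and off-diagonal entries
`p`; its determinant is `-μ² F`. The converse multiplies each equation by the nonzero `μ² F`. -/
lemma mode_algebra {p ξ μ Ω γ F a b n₁ n₂ : ℝ} (hF : F = p ^ 2 + ξ ^ 2) (hFp : 0 < F)
    (hμ : μ ≠ 0) (hΩ : Ω ^ 2 = 1 - μ ^ 2) :
    (-(μ * ξ * a) + (p * Ω * a + p * b + p * γ * n₁) = 0 ∧
      μ * ξ * b + (p * Ω * b + p * a + p * γ * n₂) = 0) ↔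
    (μ ^ 2 * a = γ * (Ω * (p ^ 2 / F * n₁) + μ * (p * ξ / F * n₁) - p ^ 2 / F * n₂) ∧
      μ ^ 2 * b = γ * (Ω * (p ^ 2 / F * n₂) - μ * (p * ξ / F * n₂) - p ^ 2 / F * n₁)) := by
  have hF0 := hFp.ne'
  have c₁ : (μ ^ 2 * a = γ * (Ω * (p ^ 2 / F * n₁) + μ * (p * ξ / F * n₁) - p ^ 2 / F * n₂)) ↔
      μ ^ 2 * F * a = γ * ((Ω * p ^ 2 + μ * (p * ξ)) * n₁ - p ^ 2 * n₂) := by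
    have e : γ * (Ω * (p ^ 2 / F * n₁) + μ * (p * ξ / F * n₁) - p ^ 2 / F * n₂)
      = γ * ((Ω * p ^ 2 + μ * (p * ξ)) * n₁ - p ^ 2 * n₂) / F := by field_simp
    rw [e, eq_div_iff hF0, mul_right_comm]
  have c₂ : (μ ^ 2 * b = γ * (Ω * (p ^ 2 / F * n₂) - μ * (p * ξ / F * n₂) - p ^ 2 / F * n₁)) ↔
      μ ^ 2 * F * b = γ * ((Ω * p ^ 2 - μ * (p * ξ)) * n₂ - p ^ 2 * n₁) := by
    have e : γ * (Ω * (p ^ 2 / F * n₂) - μ * (p * ξ / F * n₂) - p ^ 2 / F * n₁)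
      = γ * ((Ω * p ^ 2 - μ * (p * ξ)) * n₂ - p ^ 2 * n₁) / F := by field_simp
    rw [e, eq_div_iff hF0, mul_right_comm]
  rw [c₁, c₂]
  constructor
  · rintro ⟨h₁, h₂⟩
    constructor
    · rw [hF]
      linear_combination -(p * Ω + μ * ξ) * h₁ + p * h₂ + p ^ 2 * a * hΩ
    · rw [hF]
      linear_combination -(p * Ω - μ * ξ) * h₂ + p * h₁ + p ^ 2 * b * hΩ
  · rintro ⟨h₁, h₂⟩
    have hne : μ ^ 2 * F ≠ 0 := by positivity
    constructor
    · refine (mul_eq_zero.1 ?_).resolve_left hne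
      linear_combination (p * Ω - μ * ξ) * h₁ + p * h₂ + γ * p ^ 3 * n₁ * hΩ
        + γ * p * n₁ * μ ^ 2 * hF
    · refine (mul_eq_zero.1 ?_).resolve_left hne
      linear_combination p * h₁ + (p * Ω + μ * ξ) * h₂ + γ * p ^ 3 * n₂ * hΩ
        + γ * p * n₂ * μ ^ 2 * hF

variable {P₁ P₂ Q₁ Q₂ : XSpace s →L[ℝ] XSpace s →L[ℝ] XSpace s →L[ℝ] XSpace s}

/-- The coupled mode system in the slow variable, solved for its linear part. -/
theorem coupledMode_iff_cub (hs : 1 < s) (Γ : ℝ) (hP₁ : IsTriOp oppSymbol multP P₁)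
    (hP₂ : IsTriOp (fun _ _ => 1) multP P₂) (hQ₁ : IsTriOp oppSymbol multQ Q₁)
    (hQ₂ : IsTriOp (fun _ _ => 1) multQ Q₂) {μ Ω : ℝ} (hμ : μ ≠ 0) (hΩ : Ω ^ 2 = 1 - μ ^ 2)
    (α β : XSpace s) :
    IsCoupledModeSolution Γ Ω (fun p Z => phys (rep α) p (μ * Z))
      (fun p Z => phys (rep β) p (μ * Z)) ↔
    μ ^ 2 • α = (Γ / 3) • (Ω • cub P₁ P₂ α β + μ • cub Q₁ Q₂ α β - cub P₁ P₂ β α) ∧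
      μ ^ 2 • β = (Γ / 3) • (Ω • cub P₁ P₂ β α - μ • cub Q₁ Q₂ β α - cub P₁ P₂ α β) := by
  rw [coupledMode_iff_density hs Γ Ω (good_rep α) (good_rep β) hμ]
  have l₁ := rep_smul (μ ^ 2) α
  have l₂ := rep_smul (μ ^ 2) β
  have r₁ := rep_smul_of (Γ / 3) (rep_sub_of (rep_add_of
    (rep_smul_of Ω (rep_cub hP₁ hP₂ α β)) (rep_smul_of μ (rep_cub hQ₁ hQ₂ α β)))
    (rep_cub hP₁ hP₂ β α))
  have r₂ := rep_smul_of (Γ / 3) (rep_sub_of (rep_sub_of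
    (rep_smul_of Ω (rep_cub hP₁ hP₂ β α)) (rep_smul_of μ (rep_cub hQ₁ hQ₂ β α)))
    (rep_cub hP₁ hP₂ α β))
  generalize (Γ / 3) • (Ω • cub P₁ P₂ α β + μ • cub Q₁ Q₂ α β - cub P₁ P₂ β α) = R₁ at r₁ ⊢
  generalize (Γ / 3) • (Ω • cub P₁ P₂ β α - μ • cub Q₁ Q₂ β α - cub P₁ P₂ α β) = R₂ at r₂ ⊢
  generalize μ ^ 2 • α = L₁ at l₁ ⊢
  generalize μ ^ 2 • β = L₂ at l₂ ⊢
  have key (p : ℤ) (hp : Odd p) : ∀ᵐ η : ℝ,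
      (-(μ * (2 * Real.pi * η) * rep α (p, η)) + modeDensity Γ Ω (rep α) (rep β) (p, η) = 0 ∧
        μ * (2 * Real.pi * η) * rep β (p, η) + modeDensity Γ Ω (rep β) (rep α) (p, η) = 0) ↔
      (rep L₁ (p, η) = rep R₁ (p, η) ∧ rep L₂ (p, η) = rep R₂ (p, η)) := by
    filter_upwards [ae_slice l₁ p, ae_slice l₂ p, ae_slice r₁ p, ae_slice r₂ p]
      with η e₁ e₂ e₃ e₄
    rw [e₁, e₂, e₃, e₄]
    exact mode_algebra (freqSq_of_odd hp η) (freqSq_pos _) hμ hΩ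
  constructor
  · intro H
    constructor
    · refine XSpace_ext_odd fun p hp => ?_
      filter_upwards [key p hp, (H p hp).1, (H p hp).2] with η e h₁ h₂
      exact (e.1 ⟨h₁, h₂⟩).1
    · refine XSpace_ext_odd fun p hp => ?_
      filter_upwards [key p hp, (H p hp).1, (H p hp).2] with η e h₁ h₂
      exact (e.1 ⟨h₁, h₂⟩).2
  · rintro ⟨rfl, rfl⟩ p hp
    constructor
    · filter_upwards [key p hp] with η e
      exact (e.2 ⟨rfl, rfl⟩).1
    · filter_upwards [key p hp] with η e
      exact (e.2 ⟨rfl, rfl⟩).2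

lemma rotate_iff {E : Type*} [AddCommGroup E] [Module ℝ E] {g Ω μ : ℝ} {u v X Y X' Y' : E} :
    (u + v = (2 * g) • (Ω • X + μ • X' - Y) ∧ v - u = (2 * g) • (Ω • Y - μ • Y' - X)) ↔
      (u = g • ((Ω + 1) • (X - Y) + μ • (X' + Y')) ∧
        v = g • ((Ω - 1) • (X + Y) + μ • (X' - Y'))) := by
  constructor
  · rintro ⟨h₁, h₂⟩
    constructor
    · linear_combination (norm := module) (1 / 2 : ℝ) • h₁ - (1 / 2 : ℝ) • h₂
    · linear_combination (norm := module) (1 / 2 : ℝ) • h₁ + (1 / 2 : ℝ) • h₂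
  · rintro ⟨h₁, h₂⟩
    constructor
    · linear_combination (norm := module) h₁ + h₂
    · linear_combination (norm := module) h₂ - h₁

/-- Both sides are multiples of `μ³`: the left from `μ²` times the amplitude `μ`, the right from
cubic homogeneity. Half sums and half differences of what remains give `branchMap`, with `Γ/6` half
of `Γ/3`. -/
theorem cub_system_iff_branchMap {E : Type*} [NormedAddCommGroup E] [NormedSpace ℝ E]
    (P₁ P₂ Q₁ Q₂ : E →L[ℝ] E →L[ℝ] E →L[ℝ] E) (Γ : ℝ) {μ : ℝ} (hμ : μ ≠ 0) (u v : E) :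
    (μ ^ 2 • μ • (u + v) = (Γ / 3) • (Real.sqrt (1 - μ ^ 2) • cub P₁ P₂ (μ • (u + v)) (μ • (v - u))
        + μ • cub Q₁ Q₂ (μ • (u + v)) (μ • (v - u)) - cub P₁ P₂ (μ • (v - u)) (μ • (u + v))) ∧
      μ ^ 2 • μ • (v - u) = (Γ / 3) • (Real.sqrt (1 - μ ^ 2) • cub P₁ P₂ (μ • (v - u)) (μ • (u + v))
        - μ • cub Q₁ Q₂ (μ • (v - u)) (μ • (u + v)) - cub P₁ P₂ (μ • (u + v)) (μ • (v - u)))) ↔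
    (u, v) = branchMap P₁ P₂ Q₁ Q₂ Γ μ (u, v) := by
  have h3 : μ ^ 3 ≠ 0 := pow_ne_zero 3 hμ
  simp only [cub_smul, branchMap, Prod.mk.injEq]
  rw [← rotate_iff]
  generalize cub P₁ P₂ (u + v) (v - u) = X
  generalize cub P₁ P₂ (v - u) (u + v) = Y
  generalize cub Q₁ Q₂ (u + v) (v - u) = X'
  generalize cub Q₁ Q₂ (v - u) (u + v) = Y'
  generalize Real.sqrt (1 - μ ^ 2) = Ω
  have e (x : E) : μ ^ 2 • μ • x = μ ^ 3 • x := by rw [smul_smul, ← pow_succ]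
  rw [e, e, ← (smul_right_injective E h3).eq_iff (a := u + v),
    ← (smul_right_injective E h3).eq_iff (a := v - u)]
  refine and_congr ?_ ?_
  · refine Eq.congr rfl ?_
    module
  · refine Eq.congr rfl ?_
    module

end Reduction

/-! ### Dilations -/

section Dilation

variable {s : ℝ}

lemma lintegral_comp_div {μ : ℝ} (hμ : μ ≠ 0) (g : ℝ → ℝ≥0∞) :
    ∫⁻ η : ℝ, g (μ⁻¹ * η) = ENNReal.ofReal |μ| * ∫⁻ η : ℝ, g η := by
  have h' := Real.map_volume_mul_left (inv_ne_zero hμ)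
  rw [inv_inv] at h'
  have h := (Homeomorph.mulLeft₀ μ⁻¹ (inv_ne_zero hμ)).measurableEmbedding.lintegral_map
    (μ := volume) g
  simp only [Homeomorph.coe_mulLeft₀] at h
  rw [← h, h', lintegral_smul_measure, smul_eq_mul]

/-- The density of a dilated family. -/
noncomputable def dilate (μ : ℝ) (φ : ℤ × ℝ → ℝ) (k : ℤ × ℝ) : ℝ := |μ|⁻¹ * φ (k.1, μ⁻¹ * k.2)

lemma phys_dilate {μ : ℝ} (hμ : μ ≠ 0) (φ : ℤ × ℝ → ℝ) (p : ℤ) (x : ℝ) :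
    phys (dilate μ φ) p x = phys φ p (μ * x) := by
  rw [phys_eq, phys_eq]
  have h := Measure.integral_comp_mul_left (fun η : ℝ => wave (η * (μ * x)) * (φ (p, η) : ℂ)) μ⁻¹
  rw [inv_inv] at h
  have e : ∀ η : ℝ, wave (η * x) * (dilate μ φ (p, η) : ℂ)
      = (|μ|⁻¹ : ℝ) * (wave (μ⁻¹ * η * (μ * x)) * (φ (p, μ⁻¹ * η) : ℂ)) := fun η => by
    rw [dilate, show μ⁻¹ * η * (μ * x) = η * x by field_simp]
    push_cast; ring
  simp only [e]
  rw [integral_const_mul, h, Complex.real_smul, ← mul_assoc, ← Complex.ofReal_mul,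
    inv_mul_cancel₀ (abs_ne_zero.2 hμ), Complex.ofReal_one, one_mul]

/-- For `|μ| ≤ 1` the frequency `η/μ` is at least as large as `η` in modulus, so with `s ≥ 0` the
weight at `η` is bounded by the weight at `η/μ`; a change of variables finishes. Profiles in the
slow variable thus give members of `X^s` in `Z`. -/
lemma Good.dilate (hs : 0 ≤ s) {φ : ℤ × ℝ → ℝ} (h : Good s φ) {μ : ℝ} (hμ : μ ≠ 0)
    (hμ1 : |μ| ≤ 1) : Good s (dilate μ φ) where
  meas := by
    refine (h.meas.comp (measurable_fst.prodMk ?_)).const_mul _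
    exact measurable_snd.const_mul _
  even k := by
    have := h.even (k.1, μ⁻¹ * k.2)
    simp only [GapSoliton.dilate, Prod.fst_neg, Prod.snd_neg, mul_neg]
    rw [← this]; rfl
  supp k hk := by rw [GapSoliton.dilate, h.supp (k.1, μ⁻¹ * k.2) hk, mul_zero]
  fin := by
    have hm : Measurable fun k : ℤ × ℝ => wt s k * ‖φ k‖ₑ ^ 2 :=
      (measurable_wt s).mul (h.meas.enorm.pow_const 2)
    have hle : ∀ k : ℤ × ℝ, wt s k * ‖GapSoliton.dilate μ φ k‖ₑ ^ 2 ≤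
        ‖|μ|⁻¹‖ₑ ^ 2 * (wt s (k.1, μ⁻¹ * k.2) * ‖φ (k.1, μ⁻¹ * k.2)‖ₑ ^ 2) := fun k => by
      rw [GapSoliton.dilate, enorm_mul, mul_pow, mul_left_comm]
      gcongr
      refine ENNReal.ofReal_le_ofReal (Real.rpow_le_rpow (freqSq_pos _).le ?_ hs)
      have : k.2 ^ 2 ≤ (μ⁻¹ * k.2) ^ 2 := by
        rw [sq_le_sq, abs_mul, abs_inv]
        exact le_mul_of_one_le_left (abs_nonneg _) (one_le_inv_iff₀.2 ⟨abs_pos.2 hμ, hμ1⟩)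
      simp only [freqSq, mul_pow] at *
      nlinarith [sq_nonneg (2 * Real.pi)]
    refine (lintegral_mono hle).trans_lt ?_
    rw [lintegral_const_mul' _ _ (by simp)]
    refine ENNReal.mul_lt_top (by simp) ?_
    have hfin := h.fin
    unfold wmass at hfin
    rw [lam, lintegral_prod _ hm.aemeasurable] at hfin
    have hm' : Measurable fun k : ℤ × ℝ => wt s (k.1, μ⁻¹ * k.2) * ‖φ (k.1, μ⁻¹ * k.2)‖ₑ ^ 2 :=
      hm.comp (measurable_fst.prodMk (measurable_snd.const_mul _))
    rw [lam, lintegral_prod _ hm'.aemeasurable]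
    have e (p : ℤ) := lintegral_comp_div hμ fun η => wt s (p, η) * ‖φ (p, η)‖ₑ ^ 2
    simp only [e]
    rw [lintegral_const_mul' _ _ (by simp)]
    exact ENNReal.mul_lt_top (by simp) hfin

lemma memX_phys_comp_mul (hs : 1 < s) {φ : ℤ × ℝ → ℝ} (h : Good s φ) {μ : ℝ} (hμ : μ ≠ 0)
    (hμ1 : |μ| ≤ 1) : MemX s fun p Z => phys φ p (μ * Z) := by
  have := memX_phys hs (h.dilate (by linarith) hμ hμ1)
  rwa [show phys (dilate μ φ) = fun p Z => phys φ p (μ * Z) from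
    funext fun p => funext fun Z => phys_dilate hμ φ p Z] at this

end Dilation

/-! ### Norms of linear combinations of mode functions. -/

section Difference

variable {s : ℝ}

lemma phys_rep_sub_smul (hs : 1 < s) (c : ℝ) (f g : XSpace s) (p : ℤ) (x : ℝ) :
    phys (rep (f - c • g)) p x = phys (rep f) p x - c * phys (rep g) p x := by
  have e : rep (f - c • g) =ᵐ[lam] fun k => rep f k + -c * rep g k := by
    filter_upwards [rep_sub_of (Filter.EventuallyEq.refl (ae lam) (rep f)) (rep_smul c g)] with k h
    rw [h]; ring
  rw [phys_congr e, phys_add ((good_rep f).integrable hs)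
    (((good_rep g).integrable hs).const_mul _), phys_const_mul]
  push_cast; ring

lemma xNorm_phys_sub (hs : 1 < s) (c : ℝ) (f g : XSpace s) :
    xNorm s (fun p x => phys (rep f) p x - c * phys (rep g) p x) = ‖f - c • g‖ₑ := by
  rw [← xNorm_phys_rep hs]
  exact congrArg (xNorm s) (funext fun p => funext fun x => (phys_rep_sub_smul hs c f g p x).symm)

lemma xNorm_phys_add (hs : 1 < s) (c : ℝ) (f g : XSpace s) :
    xNorm s (fun p x => phys (rep f) p x + c * phys (rep g) p x) = ‖f + c • g‖ₑ := by
  have := xNorm_phys_sub hs (-c) f g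
  simpa only [neg_smul, sub_neg_eq_add, Complex.ofReal_neg, neg_mul] using this

lemma phys_rep_zero (s : ℝ) : phys (rep (0 : XSpace s)) = fun _ _ => 0 := by
  rw [phys_congr rep_zero]
  ext p x
  simp [phys_eq]

end Difference

/-! ### The branch of gap solitons -/

section GapSolitons

variable {s : ℝ}

lemma enorm_add_enorm_le_iff {E : Type*} [NormedAddCommGroup E] {x y : E} {δ : ℝ} (hδ : 0 ≤ δ) :
    ‖x‖ₑ + ‖y‖ₑ ≤ ENNReal.ofReal δ ↔ ‖x‖ + ‖y‖ ≤ δ := by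
  rw [← ofReal_norm, ← ofReal_norm,
    ← ENNReal.ofReal_add (norm_nonneg x) (norm_nonneg y), ENNReal.ofReal_le_ofReal_iff hδ]

lemma slowClose_phys (hs : 1 < s) (μ : ℝ) (w α β : XSpace s) {δ : ℝ} (hδ : 0 ≤ δ)
    (h : ‖α - μ • w‖ + ‖β + μ • w‖ ≤ δ) :
    SlowClose s μ (phys (rep w)) (fun p Z => phys (rep α) p (μ * Z))
      (fun p Z => phys (rep β) p (μ * Z)) δ :=
  ⟨phys (rep α), phys (rep β), memX_phys hs (good_rep α), memX_phys hs (good_rep β),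
    fun _ _ => rfl, fun _ _ => rfl, by
      rwa [xNorm_phys_sub hs, xNorm_phys_add hs, enorm_add_enorm_le_iff hδ]⟩

lemma isReversible_of_comp_mul {μ : ℝ} (hμ : μ ≠ 0) {A a : ℤ → ℝ → ℂ} (hA : IsReversible A)
    (h : ∀ p Z, A p Z = a p (μ * Z)) : IsReversible a := fun p hp x => by
  have := hA p hp (μ⁻¹ * x)
  rwa [h, h, mul_neg, mul_inv_cancel_left₀ hμ] at this

/-- Since `μ ≠ 0`, the slow profiles inherit reversibility from `A` and `B`, so any competitor for
uniqueness is described by two elements of `XSpace`. -/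
lemma exists_rep_of_slowClose (hs : 1 < s) {μ : ℝ} (hμ : μ ≠ 0) {w : XSpace s}
    {A B : ℤ → ℝ → ℂ} (hA : IsReversible A) (hB : IsReversible B) {δ : ℝ} (hδ : 0 ≤ δ)
    (h : SlowClose s μ (phys (rep w)) A B δ) :
    ∃ α β : XSpace s, A = (fun p Z => phys (rep α) p (μ * Z)) ∧
      B = (fun p Z => phys (rep β) p (μ * Z)) ∧ ‖α - μ • w‖ + ‖β + μ • w‖ ≤ δ := by
  obtain ⟨a, b, ha, hb, hAa, hBb, hab⟩ := h
  obtain ⟨α, rfl⟩ := exists_rep_of_memX hs ha (isReversible_of_comp_mul hμ hA hAa)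
  obtain ⟨β, rfl⟩ := exists_rep_of_memX hs hb (isReversible_of_comp_mul hμ hB hBb)
  rw [xNorm_phys_sub hs, xNorm_phys_add hs, enorm_add_enorm_le_iff hδ] at hab
  exact ⟨α, β, funext fun p => funext (hAa p), funext fun p => funext (hBb p), hab⟩

/-- By the Riemann–Lebesgue lemma the mode functions tend to zero at infinity, so a constant one
vanishes. -/
lemma eq_zero_of_memX_of_const (hs : 1 < s) {A : ℤ → ℝ → ℂ} (hA : MemX s A)
    (hrev : IsReversible A) {c : ℤ → ℂ} (h : ∀ p Z, A p Z = c p) : A = fun _ _ => 0 := by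
  obtain ⟨f, rfl⟩ := exists_rep_of_memX hs hA hrev
  ext p Z
  have ht := tendsto_fourierInv_cocompact fun η : ℝ => (rep f (p, η) : ℂ)
  have e : (𝓕⁻ fun η : ℝ => (rep f (p, η) : ℂ)) = fun _ => c p := funext (h p)
  rw [e] at ht
  rw [h, tendsto_nhds_unique tendsto_const_nhds ht]

lemma cubic_zero (p : ℤ) (x : ℝ) : cubic (fun _ _ => 0) (fun _ _ => 0) p x = 0 := by
  simp [cubic]

/-- For `μ = 0` the zero solution is the only one. -/
theorem existsUnique_zero (hs : 1 < s) (Γ Ω δ : ℝ) (hδ : 0 ≤ δ) (w : XSpace s) :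
    ∃! AB : (ℤ → ℝ → ℂ) × (ℤ → ℝ → ℂ), MemX s AB.1 ∧ MemX s AB.2 ∧
      IsCoupledModeSolution Γ Ω AB.1 AB.2 ∧ IsReversible AB.1 ∧ IsReversible AB.2 ∧
      SlowClose s 0 (phys (rep w)) AB.1 AB.2 δ := by
  have hm : MemX s fun _ _ => 0 := phys_rep_zero s ▸ memX_phys hs (good_rep 0)
  have hc := slowClose_phys hs 0 w 0 0 hδ (by simpa using hδ)
  simp only [phys_rep_zero] at hc
  refine ⟨(fun _ _ => 0, fun _ _ => 0), ⟨hm, hm, ?_, by simp [IsReversible],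
    by simp [IsReversible], hc⟩, ?_⟩
  · constructor <;> simp [cubic_zero]
  -- At `μ = 0` closeness in the slow variable makes `A` and `B` constant in `Z`, equal to `a p 0`
  -- and `b p 0`.
  · rintro ⟨A, B⟩ ⟨hA, hB, -, hAr, hBr, a, b, -, -, hAa, hBb, -⟩
    dsimp only at *
    rw [eq_zero_of_memX_of_const hs hA hAr (c := fun p => a p 0) fun p Z => by
        rw [hAa, zero_mul],
      eq_zero_of_memX_of_const hs hB hBr (c := fun p => b p 0) fun p Z => by
        rw [hBb, zero_mul]]

/-- Each of the two norms is at most `|μ|` times the sum of two quantities bounded by `c|μ|`, whence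
the `4`. -/
lemma rotate_norm_le {E : Type*} [NormedAddCommGroup E] [NormedSpace ℝ E] {μ c : ℝ} {u v w : E}
    (h : ‖((u, v) : E × E) - (w, 0)‖ ≤ c * |μ|) :
    ‖μ • (u + v) - μ • w‖ + ‖μ • (v - u) + μ • w‖ ≤ 4 * c * μ ^ 2 := by
  rw [Prod.mk_sub_mk, sub_zero, Prod.norm_def, max_le_iff] at h
  obtain ⟨h₁, h₂⟩ := h
  dsimp only at h₁ h₂
  have e₁ : μ • (u + v) - μ • w = μ • ((u - w) + v) := by module
  have e₂ : μ • (v - u) + μ • w = μ • (v - (u - w)) := by module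
  rw [e₁, e₂, norm_smul, norm_smul, Real.norm_eq_abs, ← sq_abs]
  have t₁ := norm_add_le (u - w) v
  have t₂ := norm_sub_le v (u - w)
  nlinarith [abs_nonneg μ]

/-- The components `u - w` and `v` are recovered from the difference and the sum of the two vectors,
divided by `2μ`. -/
lemma norm_le_of_rotate {E : Type*} [NormedAddCommGroup E] [NormedSpace ℝ E] {μ c : ℝ}
    (hμ : μ ≠ 0) {u v w : E}
    (h : ‖μ • (u + v) - μ • w‖ + ‖μ • (v - u) + μ • w‖ ≤ c * μ ^ 2) :
    ‖((u, v) : E × E) - (w, 0)‖ ≤ c * |μ| := by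
  have hμ' := abs_pos.2 hμ
  have e₁ : (2 * μ) • (u - w) = (μ • (u + v) - μ • w) - (μ • (v - u) + μ • w) := by module
  have e₂ : (2 * μ) • v = (μ • (u + v) - μ • w) + (μ • (v - u) + μ • w) := by module
  have n₁ := (norm_sub_le _ _).trans h
  have n₂ := (norm_add_le _ _).trans h
  rw [← e₁, norm_smul, Real.norm_eq_abs, abs_mul, abs_two, ← sq_abs] at n₁
  rw [← e₂, norm_smul, Real.norm_eq_abs, abs_mul, abs_two, ← sq_abs] at n₂
  have half {t : ℝ} (ht : 0 ≤ t) (hn : 2 * |μ| * t ≤ c * |μ| ^ 2) : t ≤ c * |μ| := by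
    nlinarith
  rw [Prod.mk_sub_mk, sub_zero, Prod.norm_def]
  exact max_le (half (norm_nonneg _) n₁) (half (norm_nonneg _) n₂)

/-- Existence and local uniqueness of gap solitons near a nondegenerate reversible profile. -/
theorem exists_gapSoliton (hs : 1 < s) (Γ : ℝ) (U : ℤ → ℝ → ℂ) (hU : MemX s U)
    (hUsol : IsNLSSolution Γ U) (hUrev : IsReversible U) (hinv : LinearizationInvertible s Γ U) :
    ∃ μ₀ : ℝ, 0 < μ₀ ∧ ∃ C : ℝ, 0 < C ∧ ∀ μ : ℝ, |μ| < μ₀ →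
      ∃! AB : (ℤ → ℝ → ℂ) × (ℤ → ℝ → ℂ),
        MemX s AB.1 ∧ MemX s AB.2 ∧
        IsCoupledModeSolution Γ (Real.sqrt (1 - μ ^ 2)) AB.1 AB.2 ∧
        IsReversible AB.1 ∧ IsReversible AB.2 ∧
        SlowClose s μ U AB.1 AB.2 (C * μ ^ 2) := by
  obtain ⟨w, rfl⟩ := exists_rep_of_memX hs hU hUrev
  obtain ⟨P₁, hP₁⟩ := exists_triOp hs isSymbol_opp isMultiplier_P
  obtain ⟨P₂, hP₂⟩ := exists_triOp hs isSymbol_one isMultiplier_P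
  obtain ⟨Q₁, hQ₁⟩ := exists_triOp hs isSymbol_opp isMultiplier_Q
  obtain ⟨Q₂, hQ₂⟩ := exists_triOp hs isSymbol_one isMultiplier_Q
  obtain ⟨c, hc, H⟩ := exists_branch P₁ P₂ Q₁ Q₂ Γ w (nls_fixed_point hs hP₁ hP₂ hUsol)
    (linearization_bijective hs hP₁ hP₂ w hinv)
  -- The existence estimate loses a factor `4`, so closeness is measured with `4c`; uniqueness of
  -- the branch is needed at that same radius.
  obtain ⟨ν, hν, H⟩ := H (4 * c)
  -- The bound `|μ| < 1` keeps `1 - μ²` nonnegative under the root and permits the dilation.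
  refine ⟨min ν 1, lt_min hν one_pos, 4 * c, by positivity, fun μ hμ => ?_⟩
  obtain ⟨hμν, hμ1⟩ := lt_min_iff.1 hμ
  have hδ : 0 ≤ 4 * c * μ ^ 2 := by positivity
  rcases eq_or_ne μ 0 with rfl | hμ0
  · exact existsUnique_zero hs Γ _ _ hδ w
  have hΩ : Real.sqrt (1 - μ ^ 2) ^ 2 = 1 - μ ^ 2 :=
    Real.sq_sqrt (sub_nonneg.2 ((sq_le_one_iff_abs_le_one μ).2 hμ1.le))
  have hiff (u v : XSpace s) :=
    (coupledMode_iff_cub hs Γ hP₁ hP₂ hQ₁ hQ₂ hμ0 hΩ (μ • (u + v)) (μ • (v - u))).trans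
      (cub_system_iff_branchMap P₁ P₂ Q₁ Q₂ Γ hμ0 u v)
  have hrev (α : XSpace s) : IsReversible fun p Z => phys (rep α) p (μ * Z) := fun p hp Z => by
    dsimp only
    rw [mul_neg]
    exact isReversible_phys _ p hp _
  obtain ⟨⟨u, v⟩, hx, hxw, hxu⟩ := H μ hμν
  refine ⟨(fun p Z => phys (rep (μ • (u + v))) p (μ * Z),
    fun p Z => phys (rep (μ • (v - u))) p (μ * Z)),
    ⟨memX_phys_comp_mul hs (good_rep _) hμ0 hμ1.le, memX_phys_comp_mul hs (good_rep _) hμ0 hμ1.le,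
      (hiff u v).2 hx, hrev _, hrev _, slowClose_phys hs μ w _ _ hδ (rotate_norm_le hxw)⟩, ?_⟩
  rintro ⟨A, B⟩ ⟨-, -, hsol, hA, hB, hclose⟩
  obtain ⟨α, β, rfl, rfl, hαβ⟩ := exists_rep_of_slowClose hs hμ0 hA hB hδ hclose
  -- The change of variables is invertible for `μ ≠ 0`, so every pair of profiles has the form
  -- required by `hiff`.
  obtain ⟨u', v', rfl, rfl⟩ : ∃ u' v' : XSpace s, α = μ • (u' + v') ∧ β = μ • (v' - u') := by
    refine ⟨(2 * μ)⁻¹ • (α - β), (2 * μ)⁻¹ • (α + β), ?_, ?_⟩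
    · match_scalars <;> field_simp <;> norm_num
    · match_scalars <;> field_simp <;> norm_num
  obtain ⟨rfl, rfl⟩ := Prod.mk.inj (hxu _ ((hiff u' v').1 hsol) (norm_le_of_rotate hμ0 hαβ))
  rfl

end GapSolitons

end GapSoliton

theorem theorem1 (s : ℝ) (hs : 1 < s) (Γ : ℝ) (U : ℤ → ℝ → ℂ)
    (hU : GapSoliton.MemX s U)
    (hUsol : GapSoliton.IsNLSSolution Γ U)
    (hUrev : GapSoliton.IsReversible U)
    (hinv : GapSoliton.LinearizationInvertible s Γ U) :
    ∃ μ₀ : ℝ, 0 < μ₀ ∧ ∃ C : ℝ, 0 < C ∧ ∀ μ : ℝ, |μ| < μ₀ →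
      ∃! AB : (ℤ → ℝ → ℂ) × (ℤ → ℝ → ℂ),
        GapSoliton.MemX s AB.1 ∧ GapSoliton.MemX s AB.2 ∧
        GapSoliton.IsCoupledModeSolution Γ (Real.sqrt (1 - μ ^ 2)) AB.1 AB.2 ∧
        GapSoliton.IsReversible AB.1 ∧ GapSoliton.IsReversible AB.2 ∧
        GapSoliton.SlowClose s μ U AB.1 AB.2 (C * μ ^ 2) := by
  exact GapSoliton.exists_gapSoliton hs Γ U hU hUsol hUrev hinv
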